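/- **Setting.** Let $f:[0,1]^s\to\mathbb R$ and $\mu=\int_{[0,1]^s}f$. Let $\alpha\in\mathbb N_0$, $\lambda\in(0,1]$, and assume $f\in C^{(\alpha,\dots,\alpha)}([0,1]^s)$, i.e. all mixed partial derivatives of order at most $\alpha$ in each coordinate exist and are continuous on $[0,1]^s$. *Estimator.* For $m\ge 1$ and $0\le i<2^m$, let $\vec i\in\{0,1\}^m$ be the vector of binary digits of $i$ (least significant first). Let $C_1,\dots,C_s\in\{0,1\}^{\infty\times m}$ be random matrices with an arbitrary joint law (the randomization scheme) and, independently of them, let $\vec D_1,\dots,\vec D_s\in\{0,1\}^{\infty}$ have i.i.d. Bernoulli$(1/2)$ entries. The point $\boldsymbol x_i\in[0,1]^s$ has $j$-th coordinate with binary digits $C_j\vec i+\vec D_j \bmod 2$, and $\hat\mu_\infty=2^{-m}\sum_{i=0}^{2^m-1}f(\boldsymbol x_i)$. The estimator $\hat\mu^{(r)}_\infty$ is the sample median of $2r-1$ independent replicates of $\hat\mu_\infty$. *Assumption on the scheme.* For $k\in\mathbb N_0$ let $\vec k$ be its vector of binary digits and $\kappa\subset\{1,2,\dots\}$ the set of positions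 of its nonzero digits ($k=\sum_{\ell\in\kappa}2^{\ell-1}$), and for an integer $d\ge1$ let $\|\kappa\|_{(d)}$ be the sum of the $d$ largest elements of $\kappa$ (of all its elements if $|\kappa|\le d$). The scheme satisfies the assumption with $d$ and nonnegative integers $\tilde t_u$ ($\emptyset\ne u\subseteq\{1,\dots,s\}$) if, for every nonzero $\boldsymbol k\in\mathbb N_0^s$, with $u=\{j: k_j\ne0\}$, $$\Pr\Big(\sum_{j=1}^s\vec k_j^{\mathsf T}C_j=\boldsymbol 0 \bmod 2\Big)\le 2^{-m+\tilde t_u}\,\mathbf 1\Big\{\sum_{j\in u}\|\kappa_j\|_{(d)}>d(m-\tilde t_u)\Big\}.$$ *Variation.* For $g:[0,1]^n\to\mathbb R$ let $$V^{(n)}_\lambda(g)=\sup_{\mathcal P}\Big(\sum_{J\in\mathcal P}\mathrm{Vol}(J)\Big|\frac{\Delta(g,J)}{\mathrm{Vol}(J)^\lambda}\Big|^2\Big)^{1/2},$$ where $\mathcal P$ ranges over the finite partitions of $[0,1)^n$ into boxes $\prod_j[a_j,b_j)$ and $\Delta(g,J)$ is the alternating sum of $g$ over the vertices of $J$; $V^{(0)}_\lambda(g)=|g|$.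 Let $f_u$, $u\subseteq\{1,\dots,s\}$, be the ANOVA components of $f$, defined recursively by $f_u=\int f\,\mathrm d\boldsymbol x_{u^c}-\sum_{v\subsetneq u}f_v$. For $v\subseteq u$ and a function $g$ of $\boldsymbol x_u$ let $V^v_\lambda(g)$ be the supremum of $V^{(|v|)}_\lambda\big(\int g\prod_{j\in u\setminus v}\rho_j(x_j)\,\mathrm d\boldsymbol x_{u\setminus v}\big)$ over continuous $\rho_j:[0,1]\to[0,1]$. For $u\ne\emptyset$ put $$\|f\|_{u,\alpha,\lambda}=\sup_{v\subseteq u}\ \sup_{\boldsymbol\alpha_u} V^v_\lambda\big(f_u^{(\boldsymbol\alpha_u)}\big),$$ with $\boldsymbol\alpha_u\in\{0,\dots,\alpha\}^{u}$ subject to $\alpha_j=\alpha$ for $j\in v$ and $\alpha_j>0$ for $j\in u\setminus v$; put $\|f\|_{\emptyset,\alpha,\lambda}=0$, $\|f\|_{\alpha,\lambda}=\max_u\|f\|_{u,\alpha,\lambda}$ and $\gamma_u=\|f\|_{u,\alpha,\lambda}/\|f\|_{\alpha,\lambda}$ (with $\gamma_u=0$ if $\|f\|_{\alpha,\lambda}=0$).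 **Theorem 5.3.** Let $\alpha\in\mathbb N_0$, $\lambda\in(0,1]$, let $d\ge1$ be an integer with $d<\alpha+\lambda$, and let $(\gamma_j)_{j\ge1}$ be nonnegative and $(\tilde t_j)_{j\ge1}$ real numbers such that $$\sum_{j=1}^\infty\Big(\gamma_j^{\frac1{\alpha+\lambda+1/2}}2^{\tilde t_j}\Big)^{\phi}<\infty,\qquad \phi=\frac{\alpha+\lambda+1/2}{\alpha+\lambda-d+1/2}.$$ Then for every $\eta>0$ there is a constant $C_\eta>0$, depending only on $\eta,\alpha,\lambda,d$ and the two sequences (in particular not on $s$), such that the following holds. For all dimensions $s$, all $m,r\in\{1,2,\dots\}$, all randomization schemes satisfying the assumption above with $d$ and some $\tilde t_u$, and all $f\in C^{(\alpha,\dots,\alpha)}([0,1]^s)$ with $\|f\|_{\alpha,\lambda}<\infty$, if $\gamma_u\le\prod_{j\in u}\gamma_j$ and $\tilde t_u\le\sum_{j\in u}\tilde t_j$ for all nonempty $u\subseteq\{1,\dots,s\}$, then $$\Pr\Big(\big|\hat\mu^{(r)}_\infty-\mu\big|^2>C_\eta\,\|f\|_{\alpha,\lambda}^2\,2^{-(2\alpha+2\lambda+1-2\eta)m}\Big)\le2^{-r}.$$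 -/

import Mathlib

open MeasureTheory
open scoped ENNReal

noncomputable section

namespace MedianNet

/-! ### Binary expansions, digital nets and their randomization -/

/-- The positions `ℓ ≥ 1` of the nonzero bits in `k = ∑ a_ℓ 2^(ℓ-1)`. -/
def bitPos (k : ℕ) : Finset ℕ := k.bitIndices.toFinset.image (· + 1)

/-- The sum of the `d` largest elements of `κ` (of all its elements if it has at most `d`). -/
def topSum (d : ℕ) (κ : Finset ℕ) : ℕ := ((κ.sort (· ≥ ·)).take d).sum

/-- The support of a vector index. -/
def supp {s : ℕ} (k : Fin s → ℕ) : Finset (Fin s) := Finset.univ.filter fun j => k j ≠ 0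

/-- Generating matrices `C_1, …, C_s` over the field with two elements, each with `m` columns and
infinitely many rows (precision `E = ∞`). The entry of `C_j` in row `ℓ + 1`, column `c + 1` is
`A j ℓ c`. -/
abbrev GenMatrices (s m : ℕ) := Fin s → ℕ → Fin m → ZMod 2

/-- Digital shifts `D_1, …, D_s`; the `(ℓ + 1)`-st digit of `D_j` is `D j ℓ`. -/
abbrev Shifts (s : ℕ) := Fin s → ℕ → ZMod 2

/-- The `(c + 1)`-st binary digit of `i`, counted from the least significant one. -/
def indexDigit (i c : ℕ) : ZMod 2 := if i.testBit c then 1 else 0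

/-- The `i`-th point of the shifted digital net: the digits of its `j`-th coordinate are
`C_j i + D_j` modulo 2. -/
def netPoint {s m : ℕ} (A : GenMatrices s m) (D : Shifts s) (i : ℕ) : Fin s → ℝ := fun j =>
  ∑' ℓ : ℕ, (((∑ c : Fin m, A j ℓ c * indexDigit i c) + D j ℓ).val : ℝ) / 2 ^ (ℓ + 1)

/-- The estimator `μ̂_∞`, the average of `f` over the `2 ^ m` points of the shifted net. -/
def netMean {s m : ℕ} (f : (Fin s → ℝ) → ℝ) (A : GenMatrices s m) (D : Shifts s) : ℝ :=
  (∑ i ∈ Finset.range (2 ^ m), f (netPoint A D i)) / 2 ^ m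

/-- The event `Z(k) = 1`: `∑_j k_j^T C_j = 0` modulo 2. -/
def zEvent {s m : ℕ} (k : Fin s → ℕ) : Set (GenMatrices s m) :=
  {A | ∀ c : Fin m, ∑ j, ∑ ℓ ∈ bitPos (k j), A j (ℓ - 1) c = 0}

open Classical in
/-- The assumption on a randomization scheme of the generating matrices with law `P`, with
parameters `d` and `tu u` for nonempty sets `u` of coordinates. -/
def SchemeBound {s m : ℕ} (P : Measure (GenMatrices s m)) (d : ℕ)
    (tu : Finset (Fin s) → ℕ) : Prop :=
  ∀ k : Fin s → ℕ, k ≠ 0 →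
    P.real (zEvent k) ≤
      (2 : ℝ) ^ (-(m : ℤ) + (tu (supp k) : ℤ)) *
        (if (d : ℤ) * ((m : ℤ) - (tu (supp k) : ℤ)) <
            ((∑ j ∈ supp k, topSum d (bitPos (k j)) : ℕ) : ℤ) then 1 else 0)

/-- The law of a digital shift: all digits are independent and Bernoulli(1/2). -/
def shiftLaw (s : ℕ) : Measure (Shifts s) :=
  Measure.pi fun _ : Fin s =>
    Measure.infinitePi fun _ : ℕ => (PMF.uniformOfFintype (ZMod 2)).toMeasure

/-- The joint law of `2 r - 1` independent replicates of (generating matrices, digital shift); in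
each replicate the matrices have law `P` and the shift is independent of them. -/
def replicateLaw {s m : ℕ} (P : Measure (GenMatrices s m)) (r : ℕ) :
    Measure (Fin (2 * r - 1) → GenMatrices s m × Shifts s) :=
  Measure.pi fun _ => P.prod (shiftLaw s)

/-- The sample median of `2 r - 1` real numbers: the `r`-th smallest one. -/
def sampleMedian {r : ℕ} (hr : 1 ≤ r) (y : Fin (2 * r - 1) → ℝ) : ℝ :=
  y (Tuple.sort y ⟨r - 1, by omega⟩)

/-- The median estimator, as a function of the `2 r - 1` replicates. -/
def medianEstimator {s m r : ℕ} (hr : 1 ≤ r) (f : (Fin s → ℝ) → ℝ)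
    (ω : Fin (2 * r - 1) → GenMatrices s m × Shifts s) : ℝ :=
  sampleMedian hr fun i => netMean f (ω i).1 (ω i).2

/-! ### Smoothness -/

/-- The closed unit cube. -/
def cube (ι : Type*) : Set (ι → ℝ) := Set.univ.pi fun _ => Set.Icc (0 : ℝ) 1

/-- The partial derivative in coordinate `j` on the closed cube (one-sided at its faces). -/
def partialDeriv {s : ℕ} (j : Fin s) (g : (Fin s → ℝ) → ℝ) : (Fin s → ℝ) → ℝ := fun x =>
  derivWithin (fun y => g (Function.update x j y)) (Set.Icc 0 1) (x j)

/-- The mixed partial derivative `∂^{|β|} g / ∂x_1^{β_1} ⋯ ∂x_s^{β_s}` on the closed cube. -/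
def mixedDeriv {s : ℕ} (β : Fin s → ℕ) (g : (Fin s → ℝ) → ℝ) : (Fin s → ℝ) → ℝ :=
  (List.finRange s).foldr (fun j h => (partialDeriv j)^[β j] h) g

/-- `f ∈ C^{(α,…,α)}([0,1]^s)`: all mixed partial derivatives of order at most `α` in each
coordinate exist and are continuous on the closed cube. -/
structure IsMixedSmooth {s : ℕ} (α : ℕ) (f : (Fin s → ℝ) → ℝ) : Prop where
  continuousOn : ∀ β : Fin s → ℕ, (∀ j, β j ≤ α) → ContinuousOn (mixedDeriv β f) (cube (Fin s))
  hasDeriv : ∀ (β : Fin s → ℕ) (i : Fin s), (∀ j, β j ≤ α) → β i < α → ∀ x ∈ cube (Fin s),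
    HasDerivWithinAt (fun y => mixedDeriv β f (Function.update x i y))
      (mixedDeriv (β + Pi.single i 1) f x) (Set.Icc 0 1) (x i)

/-! ### ANOVA decomposition -/

/-- The integral of `f` over the unit cube. -/
def cubeIntegral {s : ℕ} (f : (Fin s → ℝ) → ℝ) : ℝ := ∫ x in cube (Fin s), f x

/-- The ANOVA component `f_u`, defined recursively by integrating out the coordinates outside `u`
and subtracting the components of all proper subsets of `u`. (Integrating a function of the
coordinates outside `u` over the whole cube is the same as over those coordinates only.) -/
def anova {s : ℕ} (f : (Fin s → ℝ) → ℝ) (u : Finset (Fin s)) : (Fin s → ℝ) → ℝ := fun x =>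
  (∫ y in cube (Fin s), f (u.piecewise x y)) - ∑ v ∈ u.ssubsets.attach, anova f v.1 x
termination_by u.card
decreasing_by exact Finset.card_lt_card (Finset.mem_ssubsets.mp v.2)

/-! ### Fractional Vitali variation -/

/-- The half-open box `∏ [a_j, b_j)`. -/
def box {ι : Type*} (J : (ι → ℝ) × (ι → ℝ)) : Set (ι → ℝ) :=
  Set.univ.pi fun i => Set.Ico (J.1 i) (J.2 i)

/-- The volume of the box `∏ [a_j, b_j)`. -/
def boxVol {ι : Type*} [Fintype ι] (J : (ι → ℝ) × (ι → ℝ)) : ℝ := ∏ i, (J.2 i - J.1 i)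

/-- The alternating sum of `g` over the vertices of a box. -/
def altSum {ι : Type*} [Fintype ι] [DecidableEq ι] (g : (ι → ℝ) → ℝ)
    (J : (ι → ℝ) × (ι → ℝ)) : ℝ :=
  ∑ v : Finset ι, (-1) ^ (Fintype.card ι - v.card) * g (v.piecewise J.1 J.2)

/-- `Q` is a partition of `[0,1)^ι` into finitely many nonempty half-open boxes. -/
structure IsBoxPartition {ι : Type*} (Q : Finset ((ι → ℝ) × (ι → ℝ))) : Prop where
  lt : ∀ J ∈ Q, ∀ i, J.1 i < J.2 i
  disjoint : (Q : Set ((ι → ℝ) × (ι → ℝ))).PairwiseDisjoint box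
  cover : ⋃ J ∈ Q, box J = Set.univ.pi fun _ => Set.Ico (0 : ℝ) 1

/-- The fractional Vitali variation of order `lam` of `g` on the cube `[0,1]^ι`, possibly infinite.
If `ι` is empty, the only partition is the one-point space itself and the value is `|g|`. -/
def vitaliVar {ι : Type*} [Fintype ι] [DecidableEq ι] (lam : ℝ) (g : (ι → ℝ) → ℝ) : ℝ≥0∞ :=
  (⨆ (Q : Finset ((ι → ℝ) × (ι → ℝ))) (_ : IsBoxPartition Q),
    ENNReal.ofReal (∑ J ∈ Q, boxVol J * |altSum g J / boxVol J ^ lam| ^ 2)) ^ (1 / 2 : ℝ)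

/-- `I_v (g ∏_{j ∈ u \ v} ρ_j)`, as a function of the coordinates in `v`, for a function `g` of the
coordinates in `u ⊇ v`. -/
def partialInt {s : ℕ} (u v : Finset (Fin s)) (g : (Fin s → ℝ) → ℝ) (ρ : Fin s → ℝ → ℝ) :
    (v → ℝ) → ℝ := fun z =>
  ∫ y in cube (Fin s),
    g (fun j => if h : j ∈ v then z ⟨j, h⟩ else y j) * ∏ j ∈ u \ v, ρ j (y j)

/-- The partial fractional Vitali variation of order `lam` with respect to `v ⊆ u` of a function
`g` of the coordinates in `u`: the supremum is over all products of continuous functions `ρ_j` on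
`[0,1]` with values in `[0,1]`. -/
def partialVar {s : ℕ} (lam : ℝ) (u v : Finset (Fin s)) (g : (Fin s → ℝ) → ℝ) : ℝ≥0∞ :=
  ⨆ (ρ : Fin s → ℝ → ℝ) (_ : ∀ j, ContinuousOn (ρ j) (Set.Icc 0 1) ∧
      ∀ y ∈ Set.Icc (0 : ℝ) 1, 0 ≤ ρ j y ∧ ρ j y ≤ 1),
    vitaliVar lam (partialInt u v g ρ)

/-- `‖f‖_{u,α,lam}`. The multi-indices of `f_u` are those supported in `u`; the value at the empty
set is `0`. -/
def compVar {s : ℕ} (α : ℕ) (lam : ℝ) (f : (Fin s → ℝ) → ℝ) (u : Finset (Fin s)) : ℝ≥0∞ :=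
  if u = ∅ then 0 else
    ⨆ (v : Finset (Fin s)) (_ : v ⊆ u) (β : Fin s → ℕ)
      (_ : (∀ j, β j ≤ α) ∧ (∀ j, j ∉ u → β j = 0) ∧ (∀ j ∈ v, β j = α) ∧
        ∀ j ∈ u \ v, 0 < β j),
      partialVar lam u v (mixedDeriv β (anova f u))

/-- The global variation norm `‖f‖_{α,lam}`. -/
def varNorm {s : ℕ} (α : ℕ) (lam : ℝ) (f : (Fin s → ℝ) → ℝ) : ℝ≥0∞ :=
  ⨆ u : Finset (Fin s), compVar α lam f u

/-- The relative variation `γ_u = ‖f‖_{u,α,lam} / ‖f‖_{α,lam}` (equal to `0` for constant `f`, for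
which both norms vanish). -/
def relVar {s : ℕ} (α : ℕ) (lam : ℝ) (f : (Fin s → ℝ) → ℝ) (u : Finset (Fin s)) : ℝ :=
  (compVar α lam f u / varNorm α lam f).toReal

end MedianNet

end

open MedianNet

noncomputable section

namespace MedianNet

section WalshLine

/-! ### Rademacher and Walsh functions on the line -/

/-! The error of one replicate is a sum over nonzero digit sets `κ`: the Walsh coefficient of `f`,
times the indicator that `κ` belongs to the dual of the random net, times a character of the digital
shift. It suffices that one replicate exceeds the threshold `B` with probability at most 1/8. A bad
median forces `r` of the `2r - 1` replicates to be bad, and `4^r * 8^(-r) = 2^(-r)`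
(`exists_card_of_sampleMedian`, `measureReal_pi_majority_le`).

Coefficients are grouped by their leading digits `S`, the top `α + 1` digits in each coordinate (all
of them if there are fewer). Integration by parts consumes the top `α` digits, or all digits if
there are at most `α`. Each consumed digit gains 2 to the minus its position, because iterated
primitives of a Walsh function are a small periodic factor times the Walsh function of the remaining
digits (`exists_walPrim_eq`). The next digit turns the integral into one over box increments of a
derivative of an ANOVA component. Bessel's inequality then sums the squares over all lower digits at
once, and the fractional Vitali variation bounds the result, gaining the power `lam` of that digit's
scale (`sum_sq_integral_le`, `sum_walCoef_sq_le`).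

For the probability, let a group have at most `n` digit sets, total squared coefficient at most `X *
B`, and let each set be dual with probability at most `q`. It costs `q * n` by a union bound, or `q
* X` by Markov's inequality, since the shift removes all covariances. The cheaper choice costs at
most `q * n^(1-e) * X^e` (`measureReal_truncDev_le`, `sum_fiber_le`). In `q` the indicator of the
scheme assumption is relaxed to an exponential with parameter `θ`. The parameter `θ` is fixed so
that all powers of `2^m` cancel, and `e = 1/(2(α+lam)+1-2d)`. The cost then factorizes over
coordinates and decays geometrically in every leading digit, thanks to `η > 0` (`weight_le`,
`fiber_cost_le`).

Summing over all groups gives at most `C^(-e)` times the exponential of a constant multiple of the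
assumed convergent series, free of `s` and `m` (`sum_digitSets_le`), and `C` is chosen to make this
1/8. Only finite Walsh sums occur, since truncations approximate `f` uniformly in the digits
(`abs_walTrunc_sub_le`). -/

/-- The Rademacher function of the (0-based) digit `ℓ`. -/
def rad (ℓ : ℕ) (x : ℝ) : ℝ := if Even ⌊(2 : ℝ) ^ (ℓ + 1) * x⌋ then 1 else -1

/-- The Walsh function with digit set `κ`. -/
def wal (κ : Finset ℕ) (x : ℝ) : ℝ := ∏ ℓ ∈ κ, rad ℓ x

lemma rad_sq (ℓ : ℕ) (x : ℝ) : rad ℓ x * rad ℓ x = 1 := by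
  unfold rad; split_ifs <;> norm_num

lemma abs_rad (ℓ : ℕ) (x : ℝ) : |rad ℓ x| = 1 := by
  unfold rad; split_ifs <;> norm_num

lemma abs_wal (κ : Finset ℕ) (x : ℝ) : |wal κ x| = 1 := by
  unfold wal; rw [Finset.abs_prod]; simp [abs_rad]

lemma measurable_rad (ℓ : ℕ) : Measurable (rad ℓ) := by
  have h : Measurable fun x : ℝ => ⌊(2 : ℝ) ^ (ℓ + 1) * x⌋ :=
    Int.measurable_floor.comp (measurable_const.mul measurable_id)
  exact (measurable_from_top (f := fun z : ℤ => if Even z then (1 : ℝ) else -1)).comp h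

lemma measurable_wal (κ : Finset ℕ) : Measurable (wal κ) :=
  Finset.measurable_fun_prod κ fun ℓ _ => measurable_rad ℓ

lemma rad_add_self (ℓ : ℕ) (x : ℝ) : rad ℓ (x + (2 ^ (ℓ + 1))⁻¹) = -rad ℓ x := by
  have e : (2 : ℝ) ^ (ℓ + 1) * (x + (2 ^ (ℓ + 1))⁻¹) = 2 ^ (ℓ + 1) * x + (1 : ℤ) := by
    push_cast; field_simp
  unfold rad
  rw [e, Int.floor_add_intCast]
  by_cases h : Even ⌊(2 : ℝ) ^ (ℓ + 1) * x⌋ <;> simp [h]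

/-- The floor at a coarser dyadic scale is the integer quotient of the floor at a finer one, so the
finer floor determines every earlier digit. -/
lemma rad_congr {ℓ n : ℕ} (h : ℓ < n) {x y : ℝ} (hxy : ⌊(2 : ℝ) ^ n * x⌋ = ⌊(2 : ℝ) ^ n * y⌋) :
    rad ℓ x = rad ℓ y := by
  have key : ∀ z : ℝ, ⌊(2 : ℝ) ^ (ℓ + 1) * z⌋ = ⌊(2 : ℝ) ^ n * z⌋ / (2 ^ (n - (ℓ + 1)) : ℕ) := by
    intro z
    rw [← Int.floor_div_natCast]
    congr 1
    obtain ⟨k, rfl⟩ := Nat.exists_eq_add_of_le h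
    rw [Nat.succ_eq_add_one, Nat.add_sub_cancel_left]
    push_cast
    rw [pow_add _ (ℓ + 1) k]
    field_simp
  unfold rad
  rw [key, key, hxy]

lemma wal_congr {κ : Finset ℕ} {n : ℕ} (h : ∀ ℓ ∈ κ, ℓ < n) {x y : ℝ}
    (hxy : ⌊(2 : ℝ) ^ n * x⌋ = ⌊(2 : ℝ) ^ n * y⌋) : wal κ x = wal κ y :=
  Finset.prod_congr rfl fun ℓ hℓ => rad_congr (h ℓ hℓ) hxy

/-- Adding `2^{-(ℓ+1)}` to a number whose digit `ℓ` vanishes does not change the earlier digits. -/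
lemma rad_add_of_even {ℓ b : ℕ} (h : b < ℓ) {x : ℝ} (hx : rad ℓ x = 1) :
    rad b (x + (2 ^ (ℓ + 1))⁻¹) = rad b x := by
  have e : (2 : ℝ) ^ (ℓ + 1) * (x + (2 ^ (ℓ + 1))⁻¹) = 2 ^ (ℓ + 1) * x + (1 : ℤ) := by
    push_cast; field_simp
  have key : ∀ z : ℝ, ⌊(2 : ℝ) ^ ℓ * z⌋ = ⌊(2 : ℝ) ^ (ℓ + 1) * z⌋ / (2 : ℕ) := by
    intro z
    rw [← Int.floor_div_natCast]
    congr 1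
    push_cast
    rw [pow_succ]
    field_simp
  have hev : Even ⌊(2 : ℝ) ^ (ℓ + 1) * x⌋ := by
    by_contra hcon
    simp only [rad, if_neg hcon] at hx
    norm_num at hx
  refine rad_congr h ?_
  rw [key, key, e, Int.floor_add_intCast]
  obtain ⟨r, hr⟩ := hev
  rw [hr]
  push_cast
  omega

/-- A digit is constant from `x` up to the next dyadic point of its scale. Right continuity suffices
for the right derivatives used in integration by parts. -/
lemma rad_rightCts (ℓ : ℕ) (x : ℝ) : ∀ᶠ y in nhdsWithin x (Set.Ici x), rad ℓ y = rad ℓ x := by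
  have hp : (0 : ℝ) < 2 ^ (ℓ + 1) := by positivity
  have hlt : x < (⌊(2 : ℝ) ^ (ℓ + 1) * x⌋ + 1) / 2 ^ (ℓ + 1) := by
    rw [lt_div_iff₀ hp, mul_comm]; exact Int.lt_floor_add_one _
  filter_upwards [Ico_mem_nhdsGE hlt] with y hy
  refine rad_congr (Nat.lt_succ_self ℓ) ?_
  rw [Int.floor_eq_iff]
  constructor
  · exact (Int.floor_le _).trans (by gcongr; exact hy.1)
  · have := hy.2
    rwa [lt_div_iff₀ hp, mul_comm] at this

lemma wal_rightCts (κ : Finset ℕ) (x : ℝ) : ContinuousWithinAt (wal κ) (Set.Ici x) x := by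
  have : ∀ᶠ y in nhdsWithin x (Set.Ici x), wal κ y = wal κ x := by
    have h := (Filter.eventually_all_finset κ).2 fun ℓ _ => rad_rightCts ℓ x
    filter_upwards [h] with y hy
    exact Finset.prod_congr rfl hy
  exact continuousWithinAt_const.congr_of_eventuallyEq this rfl

/-! ### Iterated primitives of Walsh functions -/

/-- Iterated primitives of a Walsh function. -/
def walPrim (κ : Finset ℕ) : ℕ → ℝ → ℝ
  | 0 => wal κ
  | n + 1 => fun x => ∫ y in (0 : ℝ)..x, walPrim κ n y

lemma measurable_intervalIntegrable {φ : ℝ → ℝ} (hm : Measurable φ) {M : ℝ} (hM : ∀ x, |φ x| ≤ M)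
    (a b : ℝ) : IntervalIntegrable φ volume a b := by
  rw [intervalIntegrable_iff]
  exact Measure.integrableOn_of_bounded (M := M) (by simp)
    hm.aestronglyMeasurable (Filter.Eventually.of_forall fun x => by simpa using hM x)

/-- If `w` is constant on the cells of length `p` and `h` has vanishing integrals over them, then
`w` may be taken out of the primitive of `w h`. -/
lemma integral_cell_mul {w h : ℝ → ℝ} {p : ℝ} (hp : 0 < p)
    (hw : ∀ i : ℕ, ∀ x, i * p ≤ x → x < (i + 1) * p → w x = w (i * p))
    (hh : ∀ i : ℕ, ∫ y in (0 : ℝ)..(i * p), h y = 0)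
    (hi : ∀ a b, IntervalIntegrable h volume a b)
    (hwi : ∀ a b, IntervalIntegrable (fun y => w y * h y) volume a b) {x : ℝ} (hx : 0 ≤ x) :
    ∫ y in (0 : ℝ)..x, w y * h y = w x * ∫ y in (0 : ℝ)..x, h y := by
  have part : ∀ i : ℕ, ∀ x, i * p ≤ x → x ≤ (i + 1) * p →
      ∫ y in (i * p)..x, w y * h y = w (i * p) * ∫ y in (0 : ℝ)..x, h y := by
    intro i x h1 h2
    have e : ∫ y in (i * p)..x, w y * h y = ∫ y in (i * p)..x, w (i * p) * h y := by
      refine intervalIntegral.integral_congr_ae ?_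
      have hne : ∀ᵐ y : ℝ, y ≠ x := by simp [ae_iff]
      filter_upwards [hne] with y hy hmem
      rw [Set.uIoc_of_le h1] at hmem
      rw [hw i y hmem.1.le ((lt_of_le_of_ne hmem.2 hy).trans_le h2)]
    rw [e, intervalIntegral.integral_const_mul,
      ← intervalIntegral.integral_add_adjacent_intervals (hi 0 (i * p)) (hi (i * p) x), hh, zero_add]
  have zero : ∀ i : ℕ, ∫ y in (0 : ℝ)..(i * p), w y * h y = 0 := by
    intro i
    induction i with
    | zero => simp
    | succ i ih =>
      rw [← intervalIntegral.integral_add_adjacent_intervals (hwi 0 (i * p)) (hwi (i * p) _), ih,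
        zero_add, part i _ (by gcongr; linarith) (by push_cast; rfl), hh, mul_zero]
  have h0 : 0 ≤ x / p := by positivity
  have l1 : (⌊x / p⌋₊ : ℝ) * p ≤ x := by
    have := Nat.floor_le h0; rwa [le_div_iff₀ hp] at this
  have l2 : x < (⌊x / p⌋₊ + 1 : ℝ) * p := by
    have := Nat.lt_floor_add_one (x / p); rwa [div_lt_iff₀ hp] at this
  rw [← intervalIntegral.integral_add_adjacent_intervals (hwi 0 (⌊x / p⌋₊ * p)) (hwi _ _), zero,
    zero_add, part _ x l1 l2.le, hw _ x l1 l2]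

/-- The structure of the primitives of Walsh functions of order up to the number of digits. -/
lemma exists_walPrim_eq (S : Finset ℕ) : ∃ W : ℝ → ℝ, Continuous W ∧
    (∀ x, 0 ≤ W x ∧ W x ≤ ∏ a ∈ S, ((2 : ℝ) ^ (a + 1))⁻¹) ∧
    (∀ n : ℕ, (∀ a ∈ S, n ≤ a) → ∀ x, W (x + (2 ^ n)⁻¹) = W x) ∧
    (S.Nonempty → W 0 = 0) ∧
    ∀ R : Finset ℕ, (∀ b ∈ R, ∀ a ∈ S, b < a) → ∀ x, 0 ≤ x →
      walPrim (R ∪ S) S.card x = W x * wal R x := by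
  -- Digits are added from the highest downwards. The new digit `a` lies below all of `S`, so the
  -- old factor `W` has period `2^(-(a+1))`, on which `rad a` changes sign. The new factor `V` is
  -- the primitive of `W * rad a`.
  induction S using Finset.induction_on_min with
  | empty =>
    refine ⟨fun _ => 1, continuous_const, by simp, by simp, by simp, ?_⟩
    intro R _ x _
    simp [walPrim]
  | insert a S ha ih =>
    obtain ⟨W, hWc, hWb, hWp, -, hWw⟩ := ih
    have haS : a ∉ S := fun h => lt_irrefl a (ha a h)
    set q : ℝ := (2 ^ (a + 1))⁻¹ with hq
    have hq0 : 0 < q := by positivity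
    set h : ℝ → ℝ := fun x => W x * rad a x with hdef
    set M : ℝ := ∏ a ∈ S, ((2 : ℝ) ^ (a + 1))⁻¹ with hM
    have hM0 : 0 ≤ M := by positivity
    have hhm : Measurable h := hWc.measurable.mul (measurable_rad a)
    have hhb : ∀ x, |h x| ≤ M := fun x => by
      simp only [hdef, abs_mul, abs_rad, mul_one, abs_of_nonneg (hWb x).1]; exact (hWb x).2
    have hhi : ∀ a b, IntervalIntegrable h volume a b := measurable_intervalIntegrable hhm hhb
    have anti : ∀ x, h (x + q) = -h x := by
      intro x
      simp only [hdef, hq, rad_add_self, hWp (a + 1) (fun b hb => ha b hb), mul_neg]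
    set V : ℝ → ℝ := fun x => ∫ y in (0 : ℝ)..x, h y with hV
    have V0 : V 0 = 0 := by simp [hV]
    -- Antiperiodicity of `h` becomes a reflection rule for its primitive. It yields the period `2 *
    -- q`, and it reduces the bounds on `V` to `[0, q]`, where `rad a` is 1 and `V` increases from 0
    -- to at most `q * M`.
    have Vq : ∀ x, V (x + q) = V q - V x := by
      intro x
      have e : ∫ y in q..(x + q), h y = -∫ y in (0 : ℝ)..x, h y := by
        rw [← intervalIntegral.integral_neg]
        have := intervalIntegral.integral_comp_add_right (a := 0) (b := x) h q
        rw [zero_add] at this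
        rw [← this]
        simp only [anti]
      simp only [hV]
      rw [← intervalIntegral.integral_add_adjacent_intervals (hhi 0 q) (hhi q _), e]; ring
    have Vper : Function.Periodic V (2 * q) := by
      intro x
      rw [show x + 2 * q = (x + q) + q by ring, Vq, Vq]; ring
    have h2q : (2 : ℝ) * q = (2 ^ a)⁻¹ := by
      rw [hq, pow_succ]; field_simp
    have hradone : ∀ y, 0 ≤ y → y < q → rad a y = 1 := by
      intro y hy hyq
      have : ⌊(2 : ℝ) ^ (a + 1) * y⌋ = 0 := by
        rw [Int.floor_eq_zero_iff]
        refine ⟨by positivity, ?_⟩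
        calc (2 : ℝ) ^ (a + 1) * y < 2 ^ (a + 1) * q := by gcongr
          _ = 1 := by rw [hq]; field_simp
      simp [rad, this]
    have Vlow : ∀ x, 0 ≤ x → x ≤ q → V x = ∫ y in (0 : ℝ)..x, W y := by
      intro x h0 h1
      refine intervalIntegral.integral_congr_ae ?_
      have hne : ∀ᵐ y : ℝ, y ≠ x := by simp [ae_iff]
      filter_upwards [hne] with y hy hmem
      rw [Set.uIoc_of_le h0] at hmem
      simp only [hdef]
      rw [hradone y hmem.1.le ((lt_of_le_of_ne hmem.2 hy).trans_le h1), mul_one]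
    have hWi : ∀ a b, IntervalIntegrable W volume a b := fun a b => hWc.intervalIntegrable a b
    have Vlow0 : ∀ x, 0 ≤ x → x ≤ q → 0 ≤ V x ∧ V x ≤ V q := by
      intro x h0 h1
      rw [Vlow x h0 h1, Vlow q hq0.le le_rfl]
      refine ⟨intervalIntegral.integral_nonneg h0 fun y _ => (hWb y).1, ?_⟩
      rw [← intervalIntegral.integral_add_adjacent_intervals (hWi 0 x) (hWi x q)]
      have := intervalIntegral.integral_nonneg (μ := volume) h1 (fun y _ => (hWb y).1)
      linarith
    have Vqle : V q ≤ q * M := by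
      rw [Vlow q hq0.le le_rfl]
      have := intervalIntegral.integral_mono_on hq0.le (hWi 0 q)
        (intervalIntegrable_const (c := M)) (fun y _ => (hWb y).2)
      simpa using this
    refine ⟨V, intervalIntegral.continuous_primitive hhi 0, ?_, ?_, fun _ => V0, ?_⟩
    · intro x
      rw [Finset.prod_insert haS]
      obtain ⟨y, hy, hxy⟩ := Vper.exists_mem_Ico₀ (by positivity) x
      rw [hxy]
      rcases le_total y q with hyq | hyq
      · have := Vlow0 y hy.1 hyq
        exact ⟨this.1, this.2.trans Vqle⟩
      · have := Vlow0 (y - q) (by linarith) (by linarith [hy.2])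
        have e := Vq (y - q)
        rw [sub_add_cancel] at e
        rw [e]
        constructor <;> [skip; refine le_trans ?_ Vqle] <;> linarith
    · intro n hn x
      have hna : n ≤ a := hn a (Finset.mem_insert_self a S)
      have := Vper.nat_mul (2 ^ (a - n)) x
      rw [← this]
      congr 2
      rw [h2q]
      obtain ⟨k, rfl⟩ := Nat.exists_eq_add_of_le hna
      rw [Nat.add_sub_cancel_left, pow_add]; push_cast; field_simp
    · intro R hR x hx
      have hRa : ∀ b ∈ R, b < a := fun b hb => hR b hb a (Finset.mem_insert_self a S)
      have haR : a ∉ R := fun h => lt_irrefl a (hRa a h)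
      rw [Finset.card_insert_of_notMem haS, Finset.union_insert, ← Finset.insert_union]
      simp only [walPrim]
      have e : ∫ y in (0 : ℝ)..x, walPrim (insert a R ∪ S) S.card y =
          ∫ y in (0 : ℝ)..x, wal R y * h y := by
        refine intervalIntegral.integral_congr fun y hy => ?_
        rw [Set.uIcc_of_le hx] at hy
        rw [hWw (insert a R) ?_ y hy.1]
        · simp only [wal, Finset.prod_insert haR, hdef]; ring
        · intro b hb c hc
          rcases Finset.mem_insert.1 hb with rfl | hb
          · exact ha c hc
          · exact hR b hb c (Finset.mem_insert_of_mem hc)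
      -- On cells of length `2 * q = 2^(-a)` the digits of `R`, all below `a`, are constant, while
      -- `h` integrates to zero over each cell. Hence `wal R` leaves the integral.
      rw [e, integral_cell_mul (p := 2 * q) (by positivity) ?_ ?_ hhi ?_ hx, mul_comm]
      · intro i x h1 h2
        refine wal_congr hRa ?_
        have e1 : (2 : ℝ) ^ a * (i * (2 * q)) = i := by rw [h2q]; field_simp
        rw [e1, Int.floor_natCast, Int.floor_eq_iff]
        have hp : (0 : ℝ) < 2 ^ a := by positivity
        have e2 : (2 : ℝ) ^ a * ((i + 1) * (2 * q)) = i + 1 := by rw [h2q]; field_simp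
        constructor
        · calc (((i : ℕ) : ℤ) : ℝ) = (2 : ℝ) ^ a * (i * (2 * q)) := by rw [e1]; simp
            _ ≤ _ := by gcongr
        · calc (2 : ℝ) ^ a * x < (2 : ℝ) ^ a * ((i + 1) * (2 * q)) := by gcongr
            _ = _ := by rw [e2]; simp
      · intro i
        have := Vper.nat_mul i 0
        rw [zero_add] at this
        exact this.trans V0
      · refine measurable_intervalIntegrable ((measurable_wal R).mul hhm) (M := M) fun x => ?_
        rw [abs_mul, abs_wal, one_mul]; exact hhb x

end WalshLine

/-! ### Boundary values and integration by parts on the line -/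

section CubeLaw

/-- Moving the maximum of the remaining set upwards `n` times separates the digits to be integrated
away from those that stay. -/
lemma exists_top_split (κ : Finset ℕ) (n : ℕ) (hn : n ≤ κ.card) :
    ∃ R S : Finset ℕ, R ∪ S = κ ∧ S.card = n ∧ ∀ b ∈ R, ∀ a ∈ S, b < a := by
  induction n with
  | zero => exact ⟨κ, ∅, by simp, by simp, by simp⟩
  | succ n ih =>
    obtain ⟨R, S, hRS, hS, hlt⟩ := ih (by omega)
    have hdis : Disjoint R S := Finset.disjoint_left.2 fun b hb hb' => lt_irrefl b (hlt b hb b hb')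
    have hne : R.Nonempty := by
      rw [← Finset.card_pos]
      have := Finset.card_union_of_disjoint hdis
      rw [hRS] at this; omega
    have hmax := R.max'_mem hne
    refine ⟨R.erase (R.max' hne), insert (R.max' hne) S, ?_, ?_, ?_⟩
    · rw [Finset.union_insert, ← Finset.insert_union, Finset.insert_erase hmax, hRS]
    · rw [Finset.card_insert_of_notMem (Finset.disjoint_left.1 hdis hmax), hS]
    · intro b hb a ha
      rw [Finset.mem_erase] at hb
      rcases Finset.mem_insert.1 ha with rfl | ha
      · exact lt_of_le_of_ne (R.le_max' b hb.2) hb.1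
      · exact hlt b hb.2 a ha

/-- The periodic factor has period 1 and vanishes at 0, hence at 1. This removes the boundary terms
when integrating by parts, as long as no more primitives are taken than there are digits. -/
lemma walPrim_one (κ : Finset ℕ) {n : ℕ} (h1 : 1 ≤ n) (hn : n ≤ κ.card) : walPrim κ n 1 = 0 := by
  obtain ⟨R, S, rfl, rfl, hlt⟩ := exists_top_split κ n hn
  obtain ⟨W, -, -, hp, h0, hW⟩ := exists_walPrim_eq S
  rw [hW R hlt 1 zero_le_one]
  have := hp 0 (fun _ _ => Nat.zero_le _) 0
  rw [pow_zero, inv_one, zero_add, h0 (Finset.card_pos.1 h1)] at this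
  rw [this, zero_mul]

lemma wal_intervalIntegrable (κ : Finset ℕ) (a b : ℝ) :
    IntervalIntegrable (wal κ) volume a b :=
  measurable_intervalIntegrable (measurable_wal κ) (M := 1) (fun x => (abs_wal κ x).le) a b

lemma walPrim_intervalIntegrable (κ : Finset ℕ) (n : ℕ) (a b : ℝ) :
    IntervalIntegrable (walPrim κ n) volume a b := by
  induction n generalizing a b with
  | zero => exact wal_intervalIntegrable κ a b
  | succ n ih => exact (intervalIntegral.continuous_primitive ih 0).intervalIntegrable a b

lemma continuous_walPrim_succ (κ : Finset ℕ) (n : ℕ) : Continuous (walPrim κ (n + 1)) :=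
  intervalIntegral.continuous_primitive (walPrim_intervalIntegrable κ n) 0

lemma measurable_walPrim (κ : Finset ℕ) (n : ℕ) : Measurable (walPrim κ n) := by
  cases n with
  | zero => exact measurable_wal κ
  | succ n => exact (continuous_walPrim_succ κ n).measurable

lemma walPrim_rightCts (κ : Finset ℕ) (n : ℕ) (x : ℝ) :
    ContinuousWithinAt (walPrim κ n) (Set.Ici x) x := by
  cases n with
  | zero => exact wal_rightCts κ x
  | succ n => exact (continuous_walPrim_succ κ n).continuousWithinAt

/-- Only a right derivative is available: for `n = 0` the integrand is a Walsh function, which jumps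
at dyadic points. -/
lemma hasDerivWithinAt_walPrim (κ : Finset ℕ) (n : ℕ) (x : ℝ) :
    HasDerivWithinAt (walPrim κ (n + 1)) (walPrim κ n x) (Set.Ioi x) x :=
  (intervalIntegral.integral_hasDerivWithinAt_right (walPrim_intervalIntegrable κ n 0 x)
    (s := Set.Ici x) (t := Set.Ioi x)
    ((measurable_walPrim κ n).stronglyMeasurable.stronglyMeasurableAtFilter)
    ((walPrim_rightCts κ n x).mono Set.Ioi_subset_Ici_self)).mono Set.Ioi_subset_Ici_self

lemma abs_walPrim_le (κ : Finset ℕ) (n : ℕ) {x : ℝ} (hx : x ∈ Set.Icc (0 : ℝ) 1) :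
    |walPrim κ n x| ≤ 1 := by
  induction n generalizing x with
  | zero => exact (abs_wal κ x).le
  | succ n ih =>
    have := intervalIntegral.norm_integral_le_of_norm_le_const (a := 0) (b := x) (C := 1)
      (f := walPrim κ n) (fun y hy => by
        rw [Set.uIoc_of_le hx.1] at hy
        exact ih ⟨hy.1.le, hy.2.trans hx.2⟩)
    rw [sub_zero, abs_of_nonneg hx.1, one_mul] at this
    exact this.trans hx.2

lemma integral_wal {κ : Finset ℕ} (h : κ.Nonempty) : ∫ x in Set.Icc (0 : ℝ) 1, wal κ x = 0 := by
  rw [integral_Icc_eq_integral_Ioc, ← intervalIntegral.integral_of_le zero_le_one]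
  exact walPrim_one κ le_rfl (Finset.card_pos.2 h)

lemma wal_mul_wal (κ κ' : Finset ℕ) (x : ℝ) : wal κ x * wal κ' x = wal (symmDiff κ κ') x := by
  unfold wal
  rw [← Finset.prod_sdiff (Finset.inter_subset_left : κ ∩ κ' ⊆ κ),
    ← Finset.prod_sdiff (Finset.inter_subset_right : κ ∩ κ' ⊆ κ'), Finset.sdiff_inter_self_left,
    Finset.sdiff_inter_self_right,
    symmDiff_def, Finset.sup_eq_union, Finset.prod_union
      (Finset.disjoint_left.2 fun a ha hb => (Finset.mem_sdiff.1 hb).2 (Finset.mem_sdiff.1 ha).1)]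
  have : (∏ ℓ ∈ κ ∩ κ', rad ℓ x) * ∏ ℓ ∈ κ ∩ κ', rad ℓ x = 1 := by
    rw [← Finset.prod_mul_distrib]; exact Finset.prod_eq_one fun ℓ _ => rad_sq ℓ x
  linear_combination (∏ i ∈ κ \ κ', rad i x) * (∏ i ∈ κ' \ κ, rad i x) * this

/-- Integration by parts against a primitive of a Walsh function. -/
lemma integral_mul_walPrim {g g' : ℝ → ℝ} (hg' : Continuous g')
    (hg : ∀ y ∈ Set.Icc (0 : ℝ) 1, g y - g 0 = ∫ t in (0 : ℝ)..y, g' t)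
    (κ : Finset ℕ) {n : ℕ} (hn : n < κ.card) :
    ∫ y in Set.Icc (0 : ℝ) 1, g y * walPrim κ n y =
      -∫ y in Set.Icc (0 : ℝ) 1, g' y * walPrim κ (n + 1) y := by
  set G : ℝ → ℝ := fun y => g 0 + ∫ t in (0 : ℝ)..y, g' t with hG
  have hGd : ∀ x, HasDerivAt G (g' x) x := fun x =>
    (intervalIntegral.integral_hasDerivAt_right (hg'.intervalIntegrable 0 x)
      hg'.stronglyMeasurable.stronglyMeasurableAtFilter hg'.continuousAt).const_add _
  have e : ∫ y in Set.Icc (0 : ℝ) 1, g y * walPrim κ n y =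
      ∫ y in Set.Icc (0 : ℝ) 1, G y * walPrim κ n y := by
    refine setIntegral_congr_fun measurableSet_Icc fun y hy => ?_
    simp only [hG, ← hg y hy, add_sub_cancel]
  have hGc : Continuous G := continuous_iff_continuousAt.2 fun x => (hGd x).continuousAt
  rw [e]
  simp only [integral_Icc_eq_integral_Ioc]
  rw [← intervalIntegral.integral_of_le zero_le_one, ← intervalIntegral.integral_of_le zero_le_one,
    intervalIntegral.integral_mul_deriv_eq_deriv_mul_of_hasDeriv_right (u' := g')
      (v := walPrim κ (n + 1)) hGc.continuousOn (continuous_walPrim_succ κ n).continuousOn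
      (fun x _ => (hGd x).hasDerivWithinAt) (fun x _ => hasDerivWithinAt_walPrim κ n x)
      (hg'.intervalIntegrable _ _) (walPrim_intervalIntegrable κ n _ _),
    walPrim_one κ (by omega) hn]
  simp [walPrim]

/-! ### The uniform law on a cube -/

/-- The uniform law on `[0,1]`. -/
def unifI : Measure ℝ := volume.restrict (Set.Icc 0 1)

instance : IsProbabilityMeasure unifI := ⟨by simp [unifI]⟩

/-- The uniform law on the cube. -/
def unif (ι : Type*) [Fintype ι] : Measure (ι → ℝ) := Measure.pi fun _ => unifI

instance (ι : Type*) [Fintype ι] : IsProbabilityMeasure (unif ι) := by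
  unfold unif; infer_instance

variable {ι : Type*} [Fintype ι]

lemma unif_eq : unif ι = volume.restrict (cube ι) := by
  unfold unif unifI cube; rw [volume_pi, Measure.restrict_pi_pi]

lemma integral_cube_eq (h : (ι → ℝ) → ℝ) : ∫ x in cube ι, h x = ∫ x, h x ∂unif ι := by
  rw [unif_eq]

lemma measurableSet_cube : MeasurableSet (cube ι) :=
  MeasurableSet.univ_pi fun _ => measurableSet_Icc


lemma isCompact_cube {ι : Type*} : IsCompact (cube ι) := isCompact_univ_pi fun _ => isCompact_Icc

lemma ae_unif_mem : ∀ᵐ x ∂unif ι, x ∈ cube ι := by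
  rw [unif_eq]; exact ae_restrict_mem measurableSet_cube

/-- Taking the coordinates in `u` from one uniform point and the rest from an independent one gives
a uniform point. This is Fubini's theorem without leaving the full cube. -/
lemma measurePreserving_piecewise [DecidableEq ι] (u : Finset ι) :
    MeasurePreserving (fun p : (ι → ℝ) × (ι → ℝ) => u.piecewise p.1 p.2)
      ((unif ι).prod (unif ι)) (unif ι) := by
  have hm : Measurable fun p : (ι → ℝ) × (ι → ℝ) => u.piecewise p.1 p.2 := by
    refine measurable_pi_iff.2 fun i => ?_
    by_cases h : i ∈ u
    · simp only [Finset.piecewise_eq_of_mem _ _ _ h]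
      exact (measurable_pi_apply i).comp measurable_fst
    · simp only [Finset.piecewise_eq_of_notMem _ _ _ h]
      exact (measurable_pi_apply i).comp measurable_snd
  refine ⟨hm, ?_⟩
  refine (Measure.pi_eq fun S hS => ?_).symm
  rw [Measure.map_apply hm (MeasurableSet.univ_pi hS)]
  have : (fun p : (ι → ℝ) × (ι → ℝ) => u.piecewise p.1 p.2) ⁻¹' Set.univ.pi S =
      (Set.univ.pi fun i => if i ∈ u then S i else Set.univ) ×ˢ
        (Set.univ.pi fun i => if i ∈ u then Set.univ else S i) := by
    ext p
    simp only [Set.mem_preimage, Set.mem_pi, Set.mem_univ, true_implies, Set.mem_prod,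
      ← forall_and]
    refine forall_congr' fun i => ?_
    by_cases h : i ∈ u <;> simp [h]
  rw [this, Measure.prod_prod]
  unfold unif
  rw [Measure.pi_pi, Measure.pi_pi, ← Finset.prod_mul_distrib]
  refine Finset.prod_congr rfl fun i _ => ?_
  by_cases h : i ∈ u <;> simp [h]

lemma measurePreserving_update [DecidableEq ι] (j : ι) :
    MeasurePreserving (fun p : (ι → ℝ) × ℝ => Function.update p.1 j p.2)
      ((unif ι).prod unifI) (unif ι) := by
  have hm : Measurable fun p : (ι → ℝ) × ℝ => Function.update p.1 j p.2 := by
    refine measurable_pi_iff.2 fun i => ?_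
    by_cases h : i = j
    · subst h; simpa using measurable_snd
    · simp only [Function.update_of_ne h]
      exact (measurable_pi_apply i).comp measurable_fst
  refine ⟨hm, ?_⟩
  refine (Measure.pi_eq fun S hS => ?_).symm
  rw [Measure.map_apply hm (MeasurableSet.univ_pi hS)]
  have : (fun p : (ι → ℝ) × ℝ => Function.update p.1 j p.2) ⁻¹' Set.univ.pi S =
      (Set.univ.pi (Function.update S j Set.univ)) ×ˢ S j := by
    ext p
    simp only [Set.mem_preimage, Set.mem_pi, Set.mem_univ, true_implies, Set.mem_prod]
    constructor
    · intro h
      refine ⟨fun i => ?_, by simpa using h j⟩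
      by_cases hi : i = j
      · subst hi; simp
      · simpa [hi] using h i
    · rintro ⟨h, h'⟩ i
      by_cases hi : i = j
      · subst hi; simpa using h'
      · simpa [hi] using h i
  rw [this, Measure.prod_prod]
  unfold unif
  rw [Measure.pi_pi, ← Finset.mul_prod_erase _ _ (Finset.mem_univ j),
    ← Finset.mul_prod_erase _ (fun i => unifI (S i)) (Finset.mem_univ j)]
  simp only [Function.update_self, measure_univ, one_mul]
  rw [mul_comm]
  congr 1
  refine Finset.prod_congr rfl fun i hi => ?_
  rw [Function.update_of_ne (Finset.ne_of_mem_erase hi)]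

lemma integral_piecewise [DecidableEq ι] (u : Finset ι) {h : (ι → ℝ) → ℝ}
    (hh : Integrable h (unif ι)) :
    ∫ x, h x ∂unif ι = ∫ x, ∫ y, h (u.piecewise x y) ∂unif ι ∂unif ι := by
  have mp := measurePreserving_piecewise u
  have e := integral_map mp.measurable.aemeasurable (f := h) (by rw [mp.map_eq]; exact hh.1)
  rw [mp.map_eq] at e
  rw [e]
  exact integral_prod _ (mp.integrable_comp_of_integrable hh)

lemma integral_update [DecidableEq ι] (j : ι) {h : (ι → ℝ) → ℝ} (hh : Integrable h (unif ι)) :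
    ∫ x, h x ∂unif ι = ∫ x, ∫ y, h (Function.update x j y) ∂unifI ∂unif ι := by
  have mp := measurePreserving_update (ι := ι) j
  have e := integral_map mp.measurable.aemeasurable (f := h) (by rw [mp.map_eq]; exact hh.1)
  rw [mp.map_eq] at e
  rw [e]
  exact integral_prod _ (mp.integrable_comp_of_integrable hh)

lemma integrable_unif_of_bdd {h : (ι → ℝ) → ℝ} (hm : Measurable h) {M : ℝ}
    (hM : ∀ x ∈ cube ι, |h x| ≤ M) : Integrable h (unif ι) := by
  refine Integrable.of_bound hm.aestronglyMeasurable M ?_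
  filter_upwards [ae_unif_mem (ι := ι)] with x hx using hM x hx

lemma exists_bound_cube {ι : Type*} {h : (ι → ℝ) → ℝ} (hc : Continuous h) : ∃ M, ∀ x ∈ cube ι, |h x| ≤ M := by
  obtain ⟨M, hM⟩ := isCompact_cube.exists_bound_of_continuousOn (f := h) hc.continuousOn
  exact ⟨M, hM⟩

lemma integrable_mul_prod {h : (ι → ℝ) → ℝ} (hc : Continuous h) {φ : ι → ℝ → ℝ}
    (hφ : ∀ i, Measurable (φ i)) {M : ι → ℝ} (hM : ∀ i, ∀ x ∈ Set.Icc (0 : ℝ) 1, |φ i x| ≤ M i) :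
    Integrable (fun x => h x * ∏ i, φ i (x i)) (unif ι) := by
  obtain ⟨B, hB⟩ := exists_bound_cube hc
  refine integrable_unif_of_bdd (M := B * ∏ i, M i) (hc.measurable.mul
    (Finset.measurable_fun_prod _ fun i _ => (hφ i).comp (measurable_pi_apply i))) fun x hx => ?_
  rw [abs_mul, Finset.abs_prod]
  have hx' : ∀ i, x i ∈ Set.Icc (0 : ℝ) 1 := fun i => hx i (Set.mem_univ i)
  exact mul_le_mul (hB x hx) (Finset.prod_le_prod (fun i _ => abs_nonneg _)
    fun i _ => hM i _ (hx' i)) (Finset.prod_nonneg fun i _ => abs_nonneg _)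
    ((abs_nonneg _).trans (hB x hx))

end CubeLaw

/-! ### Multivariate Walsh functions and Bessel's inequality -/

section Walsh
variable {ι : Type*} [Fintype ι]

/-- The multivariate Walsh function with digit sets `κ`. -/
def mwal (κ : ι → Finset ℕ) (x : ι → ℝ) : ℝ := ∏ i, wal (κ i) (x i)

lemma abs_mwal (κ : ι → Finset ℕ) (x : ι → ℝ) : |mwal κ x| = 1 := by
  unfold mwal; rw [Finset.abs_prod]; simp [abs_wal]

lemma measurable_mwal (κ : ι → Finset ℕ) : Measurable (mwal κ) :=
  Finset.measurable_fun_prod _ fun i _ => (measurable_wal (κ i)).comp (measurable_pi_apply i)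

lemma integral_mwal (κ : ι → Finset ℕ) (h : ∃ i, κ i ≠ ∅) : ∫ x, mwal κ x ∂unif ι = 0 := by
  obtain ⟨i, hi⟩ := h
  unfold unif mwal
  rw [integral_fintype_prod_eq_prod (f := fun i y => wal (κ i) y)]
  exact Finset.prod_eq_zero (Finset.mem_univ i)
    (integral_wal (Finset.nonempty_iff_ne_empty.2 hi))

lemma integral_mwal_mul (κ κ' : ι → Finset ℕ) [Decidable (κ = κ')] :
    ∫ x, mwal κ x * mwal κ' x ∂unif ι = if κ = κ' then 1 else 0 := by
  have e : ∀ x, mwal κ x * mwal κ' x = mwal (fun i => symmDiff (κ i) (κ' i)) x := fun x => by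
    simp only [mwal, ← Finset.prod_mul_distrib, wal_mul_wal]
  simp only [e]
  split_ifs with h
  · subst h
    simp [mwal, wal]
  · refine integral_mwal _ ?_
    by_contra hcon
    push Not at hcon
    exact h (funext fun i => symmDiff_eq_bot.1 (hcon i))

/-- By orthonormality, the right side minus the left side is the integral of the square of `G` minus
its projection onto the span of `T`. -/
lemma bessel_mwal (T : Finset (ι → Finset ℕ)) {G : (ι → ℝ) → ℝ} (hm : Measurable G) {M : ℝ}
    (hM : ∀ x, |G x| ≤ M) :
    ∑ κ ∈ T, (∫ x, G x * mwal κ x ∂unif ι) ^ 2 ≤ ∫ x, G x ^ 2 ∂unif ι := by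
  classical
  set c : (ι → Finset ℕ) → ℝ := fun κ => ∫ x, G x * mwal κ x ∂unif ι with hc
  have iG2 : Integrable (fun x => G x ^ 2) (unif ι) :=
    integrable_unif_of_bdd (hm.pow_const 2) (M := M ^ 2) fun x _ => by
      rw [abs_pow]; exact pow_le_pow_left₀ (abs_nonneg _) (hM x) 2
  have iGw : ∀ κ, Integrable (fun x => G x * mwal κ x) (unif ι) := fun κ =>
    integrable_unif_of_bdd (hm.mul (measurable_mwal κ)) (M := M) fun x _ => by
      rw [abs_mul, abs_mwal, mul_one]; exact hM x
  have iww : ∀ κ κ', Integrable (fun x => mwal κ x * mwal κ' x) (unif ι) := fun κ κ' =>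
    integrable_unif_of_bdd ((measurable_mwal κ).mul (measurable_mwal κ')) (M := 1) fun x _ => by
      rw [abs_mul, abs_mwal, abs_mwal, mul_one]
  have key : ∫ x, (G x - ∑ κ ∈ T, c κ * mwal κ x) ^ 2 ∂unif ι =
      (∫ x, G x ^ 2 ∂unif ι) - ∑ κ ∈ T, c κ ^ 2 := by
    have e : ∀ x, (G x - ∑ κ ∈ T, c κ * mwal κ x) ^ 2 =
        G x ^ 2 - ∑ κ ∈ T, 2 * c κ * (G x * mwal κ x) +
          ∑ κ ∈ T, ∑ κ' ∈ T, c κ * c κ' * (mwal κ x * mwal κ' x) := by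
      intro x
      have e1 : ∑ κ ∈ T, ∑ κ' ∈ T, c κ * c κ' * (mwal κ x * mwal κ' x) =
          (∑ κ ∈ T, c κ * mwal κ x) * ∑ κ ∈ T, c κ * mwal κ x := by
        rw [Finset.sum_mul_sum]
        exact Finset.sum_congr rfl fun _ _ => Finset.sum_congr rfl fun _ _ => by ring
      have e2 : ∑ κ ∈ T, 2 * c κ * (G x * mwal κ x) = 2 * G x * ∑ κ ∈ T, c κ * mwal κ x := by
        rw [Finset.mul_sum]; exact Finset.sum_congr rfl fun _ _ => by ring
      rw [e1, e2]; ring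
    simp only [e]
    have iS : Integrable (fun x => G x ^ 2 - ∑ κ ∈ T, 2 * c κ * (G x * mwal κ x)) (unif ι) :=
      iG2.sub (integrable_finsetSum _ fun κ _ => (iGw κ).const_mul _)
    rw [integral_add iS (integrable_finsetSum _ fun κ _ => integrable_finsetSum _ fun κ' _ =>
        (iww κ κ').const_mul _),
      integral_sub iG2 (integrable_finsetSum _ fun κ _ => (iGw κ).const_mul _),
      integral_finsetSum _ (fun κ _ => (iGw κ).const_mul _),
      integral_finsetSum _ (fun κ _ => integrable_finsetSum _ fun κ' _ =>
        (iww κ κ').const_mul _)]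
    have e3 : ∀ κ ∈ T, ∫ x, ∑ κ' ∈ T, c κ * c κ' * (mwal κ x * mwal κ' x) ∂unif ι = c κ ^ 2 := by
      intro κ hκ
      rw [integral_finsetSum _ (fun κ' _ => (iww κ κ').const_mul _)]
      simp only [integral_const_mul, integral_mwal_mul]
      simp [hκ, sq]
    rw [Finset.sum_congr rfl e3]
    simp only [integral_const_mul]
    have e4 : ∑ κ ∈ T, 2 * c κ * ∫ x, G x * mwal κ x ∂unif ι = 2 * ∑ κ ∈ T, c κ ^ 2 := by
      rw [Finset.mul_sum]; exact Finset.sum_congr rfl fun _ _ => by simp only [hc]; ring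
    rw [e4]; ring
  have := integral_nonneg (μ := unif ι) (f := fun x => (G x - ∑ κ ∈ T, c κ * mwal κ x) ^ 2)
    fun x => sq_nonneg _
  rw [key] at this
  linarith

end Walsh

/-! ### Grid partitions -/

section Grid
variable {ι : Type*}

/-- The box of a grid with break points `b` that has the index `c`. -/
def gridBox (b : ι → ℕ → ℝ) (c : ι → ℕ) : (ι → ℝ) × (ι → ℝ) :=
  (fun i => b i (c i), fun i => b i (c i + 1))

lemma exists_lt_le_of_le_lt {b : ℕ → ℝ} {x : ℝ} (h0 : b 0 ≤ x) {n : ℕ} (hn : x < b n) :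
    ∃ k < n, b k ≤ x ∧ x < b (k + 1) := by
  induction n with
  | zero => exact absurd h0 (not_le.2 hn)
  | succ n ih =>
    rcases le_or_gt (b n) x with h | h
    · exact ⟨n, n.lt_succ_self, h, hn⟩
    · obtain ⟨k, hk, hk'⟩ := ih h
      exact ⟨k, hk.trans n.lt_succ_self, hk'⟩

variable [Fintype ι] [DecidableEq ι]

lemma isBoxPartition_grid {b : ι → ℕ → ℝ} {N : ι → ℕ} (hb : ∀ i, StrictMonoOn (b i) (Set.Iic (N i)))
    (h0 : ∀ i, b i 0 = 0) (h1 : ∀ i, b i (N i) = 1) [DecidableEq ((ι → ℝ) × (ι → ℝ))] :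
    IsBoxPartition ((Fintype.piFinset fun i => Finset.range (N i)).image (gridBox b)) where
  lt := by
    intro J hJ i
    obtain ⟨c, hc, rfl⟩ := Finset.mem_image.1 hJ
    have := Finset.mem_range.1 (Fintype.mem_piFinset.1 hc i)
    exact hb i (Set.mem_Iic.2 this.le) (Set.mem_Iic.2 this) (Nat.lt_succ_self _)
  disjoint := by
    intro J hJ J' hJ' hne
    rw [Finset.mem_coe] at hJ hJ'
    obtain ⟨c, hc, rfl⟩ := Finset.mem_image.1 hJ
    obtain ⟨c', hc', rfl⟩ := Finset.mem_image.1 hJ'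
    refine Set.disjoint_left.2 fun x hx hx' => hne ?_
    have : c = c' := by
      funext i
      have h1 := Finset.mem_range.1 (Fintype.mem_piFinset.1 hc i)
      have h2 := Finset.mem_range.1 (Fintype.mem_piFinset.1 hc' i)
      have hx1 := hx i (Set.mem_univ i)
      have hx2 := hx' i (Set.mem_univ i)
      simp only [gridBox] at hx1 hx2
      rcases lt_trichotomy (c i) (c' i) with h | h | h
      · have := (hb i).monotoneOn (Set.mem_Iic.2 h1) (Set.mem_Iic.2 h2.le) h
        linarith [hx1.2, hx2.1]
      · exact h
      · have := (hb i).monotoneOn (Set.mem_Iic.2 h2) (Set.mem_Iic.2 h1.le) h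
        linarith [hx1.1, hx2.2]
    rw [this]
  cover := by
    ext x
    simp only [Set.mem_iUnion, Finset.mem_image, exists_prop, exists_exists_and_eq_and, box,
      Set.mem_pi, Set.mem_univ, true_implies, gridBox, Fintype.mem_piFinset, Finset.mem_range]
    constructor
    · rintro ⟨c, hc, hx⟩ i
      have m1 := (hb i).monotoneOn (Set.mem_Iic.2 (Nat.zero_le _)) (Set.mem_Iic.2 (hc i).le)
        (Nat.zero_le _)
      have m2 := (hb i).monotoneOn (Set.mem_Iic.2 (hc i)) (Set.mem_Iic.2 le_rfl) (hc i)
      rw [h0] at m1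
      rw [h1] at m2
      exact ⟨m1.trans (hx i).1, (hx i).2.trans_le m2⟩
    · intro hx
      have : ∀ i, ∃ k < N i, b i k ≤ x i ∧ x i < b i (k + 1) := fun i =>
        exists_lt_le_of_le_lt (by rw [h0]; exact (hx i).1) (by rw [h1]; exact (hx i).2)
      choose c hc hc' using this
      exact ⟨c, hc, hc'⟩

lemma vitaliVar_sum_le {lam : ℝ} {g : (ι → ℝ) → ℝ} (hfin : vitaliVar lam g ≠ ∞)
    {Q : Finset ((ι → ℝ) × (ι → ℝ))} (hQ : IsBoxPartition Q) :
    ∑ J ∈ Q, boxVol J * |altSum g J / boxVol J ^ lam| ^ 2 ≤ (vitaliVar lam g).toReal ^ 2 := by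
  have h : ENNReal.ofReal (∑ J ∈ Q, boxVol J * |altSum g J / boxVol J ^ lam| ^ 2) ≤
      vitaliVar lam g ^ 2 := by
    unfold vitaliVar
    rw [← ENNReal.rpow_natCast, ← ENNReal.rpow_mul]
    norm_num
    exact le_iSup₂_of_le Q hQ le_rfl
  rw [← ENNReal.toReal_pow]
  exact (ENNReal.ofReal_le_iff_le_toReal (ENNReal.pow_ne_top hfin)).1 h

/-- The break points `0, y, y + q, …, y + (n - 1) q, 1`. -/
def breakPt (n : ℕ) (q y : ℝ) (k : ℕ) : ℝ :=
  if k = 0 then 0 else if k ≤ n then y + (k - 1 : ℝ) * q else 1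

lemma breakPt_strictMonoOn {n : ℕ} {q y : ℝ} (hq : n * q = 1) (hq0 : 0 < q) (hy0 : 0 < y)
    (hy : y < q) : StrictMonoOn (breakPt n q y) (Set.Iic (n + 1)) := by
  intro a ha b hb hab
  have hb' : b ≠ 0 := by omega
  simp only [Set.mem_Iic] at ha hb
  have han : a ≤ n := by omega
  unfold breakPt
  rw [if_neg hb', if_pos han]
  have hab' : (a : ℝ) + 1 ≤ b := by exact_mod_cast hab
  split_ifs with h1 h2 h2
  · have : (1 : ℝ) ≤ b := by exact_mod_cast Nat.one_le_iff_ne_zero.2 hb'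
    have := mul_nonneg (sub_nonneg.2 this) hq0.le
    linarith
  · norm_num
  · nlinarith
  · have : (a : ℝ) ≤ n := by exact_mod_cast han
    nlinarith

/-- The contribution of the boxes of a shifted regular grid to the Vitali variation. -/
lemma sum_altSum_shifted_le {lam : ℝ} {g : (ι → ℝ) → ℝ} (hfin : vitaliVar lam g ≠ ∞)
    {n : ι → ℕ} {q y : ι → ℝ} (hq : ∀ i, n i * q i = 1) (hq0 : ∀ i, 0 < q i)
    (hy0 : ∀ i, 0 < y i) (hy : ∀ i, y i < q i) :
    ∑ c ∈ Fintype.piFinset fun i => Finset.range (n i - 1),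
      altSum g (fun i => y i + c i * q i, fun i => y i + c i * q i + q i) ^ 2 ≤
      (∏ i, q i) ^ (2 * lam - 1) * (vitaliVar lam g).toReal ^ 2 := by
  classical
  -- Each coordinate has `n i + 1` intervals: `n i - 1` full cells and two incomplete end pieces.
  -- The index `c i + 1` below skips the first end piece.
  set b : ι → ℕ → ℝ := fun i => breakPt (n i) (q i) (y i) with hb
  have hQ := isBoxPartition_grid (b := b) (N := fun i => n i + 1)
    (fun i => breakPt_strictMonoOn (hq i) (hq0 i) (hy0 i) (hy i))
    (fun i => by simp [hb, breakPt]) (fun i => by simp [hb, breakPt])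
  have key := vitaliVar_sum_le hfin hQ
  set P : ℝ := ∏ i, q i with hP
  have hP0 : 0 < P := Finset.prod_pos fun i _ => hq0 i
  have hbox : ∀ c ∈ Fintype.piFinset fun i => Finset.range (n i - 1),
      gridBox b (fun i => c i + 1) = (fun i => y i + c i * q i, fun i => y i + c i * q i + q i) := by
    intro c hc
    have hc' : ∀ i, c i < n i - 1 := fun i => Finset.mem_range.1 (Fintype.mem_piFinset.1 hc i)
    refine Prod.ext (funext fun i => ?_) (funext fun i => ?_)
    · have : c i + 1 ≤ n i := by have := hc' i; omega
      simp only [gridBox, hb, breakPt, this, if_true]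
      push_cast
      simp
    · have : c i + 1 + 1 ≤ n i := by have := hc' i; omega
      simp only [gridBox, hb, breakPt, this, if_true]
      push_cast
      simp
      ring
  have hinj : Set.InjOn (fun c : ι → ℕ => gridBox b (fun i => c i + 1))
      (Fintype.piFinset fun i => Finset.range (n i - 1) : Finset (ι → ℕ)) := by
    intro c hc c' hc' h
    simp only at h
    rw [hbox c (Finset.mem_coe.1 hc), hbox c' (Finset.mem_coe.1 hc')] at h
    funext i
    have h1 := congrFun (congrArg Prod.fst h) i
    simp only [add_right_inj] at h1
    exact_mod_cast mul_right_cancel₀ (hq0 i).ne' h1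
  have hsub : (Fintype.piFinset fun i => Finset.range (n i - 1)).image
      (fun c : ι → ℕ => gridBox b (fun i => c i + 1)) ⊆
      (Fintype.piFinset fun i => Finset.range (n i + 1)).image (gridBox b) := by
    intro J hJ
    obtain ⟨c, hc, rfl⟩ := Finset.mem_image.1 hJ
    refine Finset.mem_image.2 ⟨fun i => c i + 1, Fintype.mem_piFinset.2 fun i => ?_, rfl⟩
    have := Finset.mem_range.1 (Fintype.mem_piFinset.1 hc i)
    exact Finset.mem_range.2 (by omega)
  have h2 := (Finset.sum_le_sum_of_subset_of_nonneg hsub (f := fun J =>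
    boxVol J * |altSum g J / boxVol J ^ lam| ^ 2) fun J hJ _ => mul_nonneg
      (Finset.prod_nonneg fun i _ => sub_nonneg.2 (hQ.lt J hJ i).le) (sq_nonneg _)).trans key
  rw [Finset.sum_image hinj] at h2
  -- All full cells have volume `P`, so the weight in the variation is the constant `P^(1 - 2 *
  -- lam)`. The remaining boxes of the partition contribute nonnegatively and were dropped.
  have h3 : ∀ c ∈ Fintype.piFinset fun i => Finset.range (n i - 1),
      boxVol (gridBox b (fun i => c i + 1)) * |altSum g (gridBox b (fun i => c i + 1)) /
        boxVol (gridBox b (fun i => c i + 1)) ^ lam| ^ 2 =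
      P ^ (1 - 2 * lam) *
        altSum g (fun i => y i + c i * q i, fun i => y i + c i * q i + q i) ^ 2 := by
    intro c hc
    rw [hbox c hc]
    have : boxVol (fun i => y i + c i * q i, fun i => y i + c i * q i + q i) = P := by
      simp [boxVol, hP]
    rw [this, sq_abs, div_pow, Real.rpow_sub hP0, Real.rpow_one, mul_comm 2 lam, Real.rpow_mul hP0.le,
      Real.rpow_two]
    field_simp
  rw [Finset.sum_congr rfl h3, ← Finset.mul_sum] at h2
  calc _ = P ^ (2 * lam - 1) * (P ^ (1 - 2 * lam) * ∑ c ∈ Fintype.piFinset fun i =>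
      Finset.range (n i - 1),
      altSum g (fun i => y i + c i * q i, fun i => y i + c i * q i + q i) ^ 2) := by
        rw [← mul_assoc, ← Real.rpow_add hP0]; simp
    _ ≤ _ := by gcongr

end Grid

/-! ### Splitting the cube according to given digits -/

section Split

/-- Switching digit `ℓ` from 0 to 1 never leaves `[0,1)`: the scaled floor is even, the bound
`2^(ℓ+1)` is even too, so there is room for one more unit. In the other direction parity excludes
negative `x`. -/
lemma add_mem_Ico_and_rad {ℓ : ℕ} {x : ℝ} :
    (x + (2 ^ (ℓ + 1))⁻¹ ∈ Set.Ico (0 : ℝ) 1 ∧ rad ℓ (x + (2 ^ (ℓ + 1))⁻¹) = -1) ↔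
      (x ∈ Set.Ico (0 : ℝ) 1 ∧ rad ℓ x = 1) := by
  have hq0 : (0 : ℝ) < (2 ^ (ℓ + 1))⁻¹ := by positivity
  have hp0 : (0 : ℝ) < 2 ^ (ℓ + 1) := by positivity
  rw [rad_add_self, neg_inj]
  refine and_congr_left fun h => ?_
  have hev : Even ⌊(2 : ℝ) ^ (ℓ + 1) * x⌋ := by
    by_contra hcon
    simp only [rad, if_neg hcon] at h
    norm_num at h
  obtain ⟨r, hr⟩ := hev
  have f1 := Int.floor_le ((2 : ℝ) ^ (ℓ + 1) * x)
  have f2 := Int.lt_floor_add_one ((2 : ℝ) ^ (ℓ + 1) * x)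
  rw [hr] at f1 f2
  push_cast at f1 f2
  constructor
  · rintro ⟨h1, h2⟩
    refine ⟨?_, by linarith⟩
    have : -1 ≤ (2 : ℝ) ^ (ℓ + 1) * x := by
      have := mul_le_mul_of_nonneg_left h1 hp0.le
      rw [mul_zero, mul_add, mul_inv_cancel₀ hp0.ne'] at this
      linarith
    have hr2 : (-2 : ℝ) < r + r := by linarith
    have hr3 : (-2 : ℤ) < r + r := by exact_mod_cast hr2
    have hr4 : (0 : ℤ) ≤ r := by omega
    have hr5 : (0 : ℝ) ≤ r := by exact_mod_cast hr4
    by_contra hx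
    have := mul_neg_of_pos_of_neg hp0 (not_le.1 hx)
    linarith
  · rintro ⟨h1, h2⟩
    refine ⟨by linarith, ?_⟩
    have h3 : (2 : ℝ) ^ (ℓ + 1) * x < 2 ^ (ℓ + 1) := by
      simpa using mul_lt_mul_of_pos_left h2 hp0
    have h4 : ((r + r : ℤ) : ℝ) < ((2 * 2 ^ ℓ : ℤ) : ℝ) := by
      push_cast; rw [pow_succ] at h3 f1; linarith
    have h5 : r + r < 2 * 2 ^ ℓ := by exact_mod_cast h4
    have h6 : r + r + 2 ≤ 2 * 2 ^ ℓ := by omega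
    have h7 : ((r + r + 2 : ℤ) : ℝ) ≤ ((2 * 2 ^ ℓ : ℤ) : ℝ) := by exact_mod_cast h6
    push_cast at h7
    have h8 : (2 : ℝ) ^ (ℓ + 1) * (x + (2 ^ (ℓ + 1))⁻¹) < 2 ^ (ℓ + 1) * 1 := by
      rw [mul_add, mul_inv_cancel₀ hp0.ne', mul_one]
      rw [pow_succ] at f2 ⊢
      linarith
    exact lt_of_mul_lt_mul_left h8 hp0.le

variable {ι : Type*} [Fintype ι] [DecidableEq ι]

/-- The part of the half-open cube where the digits `ℓ i` of the coordinates vanish. -/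
def lowPart (ℓ : ι → ℕ) : Set (ι → ℝ) :=
  {x | ∀ i, x i ∈ Set.Ico (0 : ℝ) 1 ∧ rad (ℓ i) (x i) = 1}

/-- The mesh sizes `2^{-(ℓ+1)}`. -/
def mesh (ℓ : ι → ℕ) (i : ι) : ℝ := (2 ^ (ℓ i + 1))⁻¹

omit [Fintype ι] [DecidableEq ι] in
lemma mesh_pos (ℓ : ι → ℕ) (i : ι) : 0 < mesh ℓ i := by unfold mesh; positivity

omit [DecidableEq ι] in
lemma measurableSet_lowPart (ℓ : ι → ℕ) : MeasurableSet (lowPart ℓ) := by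
  have : lowPart ℓ = ⋂ i, ({x | x i ∈ Set.Ico (0 : ℝ) 1} ∩ {x | rad (ℓ i) (x i) = 1}) := by
    ext x; simp [lowPart]
  rw [this]
  refine MeasurableSet.iInter fun i => MeasurableSet.inter ?_ ?_
  · exact (measurable_pi_apply i) measurableSet_Ico
  · exact ((measurable_rad (ℓ i)).comp (measurable_pi_apply i)) (measurableSet_singleton (1 : ℝ))

omit [DecidableEq ι] in
lemma unif_eq_Ico : unif ι = volume.restrict (Set.univ.pi fun _ : ι => Set.Ico (0 : ℝ) 1) := by
  rw [unif_eq, cube, Set.pi_univ_Icc]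
  exact (Measure.restrict_congr_set Measure.univ_pi_Ico_ae_eq_Icc).symm

/-- The digits `ℓ i` cut the half-open cube into pieces indexed by the set `S` of coordinates whose
digit is 1. Each piece is a translate of `lowPart ℓ` by the mesh in the directions of `S`. -/
lemma integral_unif_eq_sum_lowPart (ℓ : ι → ℕ) {h : (ι → ℝ) → ℝ} (hh : Integrable h (unif ι)) :
    (∀ S : Finset ι, IntegrableOn (fun x => h (x + S.piecewise (mesh ℓ) 0)) (lowPart ℓ)) ∧
    ∫ x, h x ∂unif ι = ∑ S : Finset ι,
      ∫ x in lowPart ℓ, h (x + S.piecewise (mesh ℓ) 0) := by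
  classical
  set A : Finset ι → Set (ι → ℝ) := fun S =>
    {x | ∀ i, x i ∈ Set.Ico (0 : ℝ) 1 ∧ rad (ℓ i) (x i) = if i ∈ S then -1 else 1} with hA
  have hAm : ∀ S, MeasurableSet (A S) := fun S => by
    have : A S = ⋂ i, ({x | x i ∈ Set.Ico (0 : ℝ) 1} ∩
        {x | rad (ℓ i) (x i) = if i ∈ S then -1 else 1}) := by
      ext x; simp [hA]
    rw [this]
    refine MeasurableSet.iInter fun i => MeasurableSet.inter ?_ ?_
    · exact (measurable_pi_apply i) measurableSet_Ico
    · exact ((measurable_rad (ℓ i)).comp (measurable_pi_apply i)) (measurableSet_singleton _)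
  have hU : (Set.univ.pi fun _ : ι => Set.Ico (0 : ℝ) 1) = ⋃ S ∈ (Finset.univ : Finset (Finset ι)), A S := by
    ext x
    simp only [Set.mem_pi, Set.mem_univ, true_implies, Finset.mem_univ, Set.iUnion_true,
      Set.mem_iUnion, hA, Set.mem_ofPred_eq]
    constructor
    · intro hx
      refine ⟨Finset.univ.filter fun i => rad (ℓ i) (x i) = -1, fun i => ⟨hx i, ?_⟩⟩
      simp only [Finset.mem_filter, Finset.mem_univ, true_and]
      split_ifs with h1
      · exact h1
      · unfold rad at h1 ⊢; split_ifs at h1 ⊢ <;> simp_all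
    · rintro ⟨S, hS⟩ i
      exact (hS i).1
  have hdis : (↑(Finset.univ : Finset (Finset ι)) : Set (Finset ι)).PairwiseDisjoint A := by
    intro S _ S' _ hne
    refine Set.disjoint_left.2 fun x hx hx' => hne ?_
    ext i
    have e := (hx i).2.symm.trans (hx' i).2
    by_cases h1 : i ∈ S <;> by_cases h2 : i ∈ S' <;> simp [h1, h2] at e ⊢ <;> norm_num at e
  rw [unif_eq_Ico] at hh ⊢
  have hh' : IntegrableOn h (⋃ S ∈ (Finset.univ : Finset (Finset ι)), A S) := by rw [← hU]; exact hh
  have hAi : ∀ S, IntegrableOn h (A S) := fun S =>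
    hh'.mono_set (Set.subset_biUnion_of_mem (Finset.mem_univ S))
  have hpre : ∀ S : Finset ι, (fun x => x + S.piecewise (mesh ℓ) 0) ⁻¹' A S = lowPart ℓ := by
    intro S
    ext x
    simp only [hA, Set.mem_preimage, Set.mem_ofPred_eq, lowPart, Pi.add_apply]
    refine forall_congr' fun i => ?_
    by_cases hi : i ∈ S
    · simp only [hi, Finset.piecewise_eq_of_mem, if_true, mesh]
      exact add_mem_Ico_and_rad
    · simp [hi]
  have mp : ∀ S : Finset ι, MeasurePreserving (fun x => x + S.piecewise (mesh ℓ) 0)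
      (volume : Measure (ι → ℝ)) volume := fun S => measurePreserving_add_right _ _
  refine ⟨fun S => ?_, ?_⟩
  · rw [← hpre S]
    exact ((mp S).integrableOn_comp_preimage (measurableEmbedding_addRight _)).2 (hAi S)
  · rw [hU, integral_biUnion_finset _ (fun S _ => hAm S) hdis fun S _ => hAi S]
    refine Finset.sum_congr rfl fun S _ => ?_
    rw [← (mp S).setIntegral_preimage_emb (measurableEmbedding_addRight _), hpre S]

/-- Splitting the low part into shifted cells. -/
lemma integral_lowPart_sq_le {lam : ℝ} {g : (ι → ℝ) → ℝ} (hg : Continuous g)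
    (hfin : vitaliVar lam g ≠ ∞) (ℓ : ι → ℕ) :
    ∫ x in lowPart ℓ, altSum g (x, x + mesh ℓ) ^ 2 ≤
      (∏ i, mesh ℓ i) ^ (2 * lam) * (vitaliVar lam g).toReal ^ 2 := by
  classical
  set φ : (ι → ℝ) → ℝ := fun x => altSum g (x, x + mesh ℓ) ^ 2 with hφ
  have hφc : Continuous φ := by
    refine Continuous.pow (continuous_finsetSum _ fun v _ => continuous_const.mul (hg.comp ?_)) 2
    refine continuous_pi fun i => ?_
    by_cases hi : i ∈ v
    · simpa [hi] using continuous_apply i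
    · simpa [hi] using Continuous.fun_add (continuous_apply i) continuous_const
  have hφi : ∀ a b : ι → ℝ, IntegrableOn φ (Set.Icc a b) := fun a b =>
    hφc.continuousOn.integrableOn_compact isCompact_Icc
  set n : ι → ℕ := fun i => 2 ^ (ℓ i + 1) with hn
  have hnq : ∀ i, (n i : ℝ) * mesh ℓ i = 1 := fun i => by
    simp only [hn, mesh]; push_cast; field_simp
  have hq0 := mesh_pos ℓ
  set P : ℝ := ∏ i, mesh ℓ i with hP
  have hP0 : 0 < P := Finset.prod_pos fun i _ => hq0 i
  set T := Fintype.piFinset fun i => Finset.range (n i - 1) with hT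
  set cell : (ι → ℕ) → Set (ι → ℝ) := fun c =>
    Set.univ.pi fun i => Set.Ico (c i * mesh ℓ i) (c i * mesh ℓ i + mesh ℓ i) with hcell
  have hcm : ∀ c, MeasurableSet (cell c) := fun c => MeasurableSet.univ_pi fun i => measurableSet_Ico
  have hcsub : ∀ c, cell c ⊆ Set.Icc (fun i => c i * mesh ℓ i) (fun i => c i * mesh ℓ i + mesh ℓ i) :=
    fun c x hx => ⟨fun i => (hx i trivial).1, fun i => (hx i trivial).2.le⟩
  have hci : ∀ c, IntegrableOn φ (cell c) := fun c => (hφi _ _).mono_set (hcsub c)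
  -- A point of the low part stays in `[0,1)` when moved by one mesh, so it never lies in a last
  -- cell. Only indices below `n i - 1` occur, exactly those that the shifted grids reach.
  have hsub : lowPart ℓ ⊆ ⋃ c ∈ T, cell c := by
    intro x hx
    have h1 : ∀ i, 0 ≤ x i / mesh ℓ i := fun i => div_nonneg (hx i).1.1 (hq0 i).le
    have l1 : ∀ i, (⌊x i / mesh ℓ i⌋₊ : ℝ) * mesh ℓ i ≤ x i := fun i => by
      have := Nat.floor_le (h1 i); rwa [le_div_iff₀ (hq0 i)] at this
    refine Set.mem_iUnion₂.2 ⟨fun i => ⌊x i / mesh ℓ i⌋₊, Fintype.mem_piFinset.2 fun i =>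
      Finset.mem_range.2 ?_, fun i _ => ⟨l1 i, ?_⟩⟩
    · have h2 := (add_mem_Ico_and_rad.2 (hx i)).1.2
      have h3 : ((⌊x i / mesh ℓ i⌋₊ + 1 : ℕ) : ℝ) * mesh ℓ i < n i * mesh ℓ i := by
        rw [hnq]; push_cast
        have := l1 i
        simp only [mesh] at this ⊢
        linarith
      have h4 := lt_of_mul_lt_mul_right h3 (hq0 i).le
      have h5 : ⌊x i / mesh ℓ i⌋₊ + 1 < n i := by exact_mod_cast h4
      omega
    · have := Nat.lt_floor_add_one (x i / mesh ℓ i)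
      rw [div_lt_iff₀ (hq0 i)] at this
      linarith
  have hdis : (↑T : Set (ι → ℕ)).PairwiseDisjoint cell := by
    intro c _ c' _ hne
    refine Set.disjoint_left.2 fun x hx hx' => hne ?_
    funext i
    have a1 := hx i trivial
    have a2 := hx' i trivial
    have b1 : (c i : ℝ) * mesh ℓ i < (c' i + 1 : ℕ) * mesh ℓ i := by push_cast; linarith [a1.1, a2.2]
    have b2 : (c' i : ℝ) * mesh ℓ i < (c i + 1 : ℕ) * mesh ℓ i := by push_cast; linarith [a1.2, a2.1]
    have d1 : c i < c' i + 1 := by exact_mod_cast lt_of_mul_lt_mul_right b1 (hq0 i).le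
    have d2 : c' i < c i + 1 := by exact_mod_cast lt_of_mul_lt_mul_right b2 (hq0 i).le
    omega
  have hUi : IntegrableOn φ (⋃ c ∈ T, cell c) := integrableOn_finset_iUnion.2 fun c _ => hci c
  calc ∫ x in lowPart ℓ, φ x ≤ ∫ x in ⋃ c ∈ T, cell c, φ x :=
        setIntegral_mono_set hUi (Filter.Eventually.of_forall fun x => sq_nonneg _)
          hsub.eventuallyLE
    _ = ∑ c ∈ T, ∫ x in cell c, φ x :=
        integral_biUnion_finset _ (fun c _ => hcm c) hdis fun c _ => hci c
    _ = ∑ c ∈ T, ∫ y in cell 0, φ (y + fun i => c i * mesh ℓ i) := by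
        refine Finset.sum_congr rfl fun c _ => ?_
        have mp := measurePreserving_add_right (volume : Measure (ι → ℝ)) (fun i => c i * mesh ℓ i)
        rw [← mp.setIntegral_preimage_emb (measurableEmbedding_addRight _)]
        congr 2
        ext y
        simp only [hcell, Set.mem_preimage, Set.mem_pi, Set.mem_univ, true_implies, Pi.add_apply,
          Set.mem_Ico, Pi.zero_apply, Nat.cast_zero, zero_mul, zero_add]
        refine forall_congr' fun i => ?_
        constructor <;> rintro ⟨h1, h2⟩ <;> constructor <;> linarith
    -- With the sum inside, each offset `y` gives a grid of boxes based at `y`, whose squared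
    -- increments sum to a variation bound uniform in `y`. Integrating over a cell of volume `P`
    -- raises the exponent `2 * lam - 1` to `2 * lam`.
    _ = ∫ y in cell 0, ∑ c ∈ T, φ (y + fun i => c i * mesh ℓ i) := by
        rw [integral_finsetSum]
        intro c _
        exact ((hφc.comp (continuous_id.add continuous_const)).continuousOn.integrableOn_compact
          isCompact_Icc).mono_set (hcsub 0)
    _ ≤ ∫ y in cell 0, P ^ (2 * lam - 1) * (vitaliVar lam g).toReal ^ 2 := by
        -- A zero offset would make two break points of the grid coincide.
        have hne : ∀ᵐ y : ι → ℝ, ∀ i, y i ≠ 0 := by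
          rw [ae_all_iff]; intro i
          rw [volume_pi]
          exact Measure.ae_eval_ne _ i 0
        refine setIntegral_mono_ae_restrict ?_ ?_ ?_
        · exact ((continuous_finsetSum T fun c _ => hφc.comp
            (continuous_id.add continuous_const)).continuousOn.integrableOn_compact
              isCompact_Icc).mono_set (hcsub 0)
        · exact (continuous_const.continuousOn.integrableOn_compact isCompact_Icc).mono_set (hcsub 0)
        · filter_upwards [ae_restrict_mem (hcm 0), ae_restrict_of_ae hne] with y hy hy0
          have := sum_altSum_shifted_le hfin (n := n) hnq hq0 (y := y)
            (fun i => lt_of_le_of_ne (by simpa using (hy i trivial).1) (hy0 i).symm)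
            (fun i => by simpa using (hy i trivial).2)
          exact this
    _ = P ^ (2 * lam) * (vitaliVar lam g).toReal ^ 2 := by
        rw [setIntegral_const, smul_eq_mul, ← mul_assoc]
        congr 1
        have : volume.real (cell 0) = P := by
          simp only [hcell, Measure.real, volume_pi, Measure.pi_pi, Real.volume_Ico]
          rw [ENNReal.toReal_prod]
          refine Finset.prod_congr rfl fun i _ => ?_
          rw [ENNReal.toReal_ofReal] <;> simp [(hq0 i).le]
        rw [this, Real.rpow_sub hP0, Real.rpow_one]
        field_simp

/-- The square sum of the Walsh coefficients over all choices of the digits in front of the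
leading ones is controlled by the fractional Vitali variation. -/
lemma sum_sq_integral_le {lam : ℝ} {g : (ι → ℝ) → ℝ} (hg : Continuous g)
    (hfin : vitaliVar lam g ≠ ∞) (ℓ : ι → ℕ) {W : ι → ℝ → ℝ} {M : ι → ℝ}
    (hWc : ∀ i, Continuous (W i)) (hW : ∀ i x, 0 ≤ W i x ∧ W i x ≤ M i)
    (hWp : ∀ i x, W i (x + (2 ^ (ℓ i + 1))⁻¹) = W i x) :
    ∑ R ∈ Fintype.piFinset fun i => (Finset.range (ℓ i)).powerset,
      (∫ x, g x * ∏ i, (W i (x i) * wal (insert (ℓ i) (R i)) (x i)) ∂unif ι) ^ 2 ≤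
      (∏ i, M i) ^ 2 * ((∏ i, mesh ℓ i) ^ (2 * lam) * (vitaliVar lam g).toReal ^ 2) := by
  classical
  set Δ : (ι → ℝ) → ℝ := fun x => altSum g (x, x + mesh ℓ) with hΔ
  have hΔc : Continuous Δ := by
    refine continuous_finsetSum _ fun v _ => continuous_const.mul (hg.comp ?_)
    refine continuous_pi fun i => ?_
    by_cases hi : i ∈ v
    · simpa [hi] using continuous_apply i
    · simpa [hi] using Continuous.fun_add (continuous_apply i) continuous_const
  have hM0 : ∀ i, 0 ≤ M i := fun i => (hW i 0).1.trans (hW i 0).2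
  -- Folding the cube onto the low part leaves `W` and the lower digits unchanged, while digit `ℓ i`
  -- supplies the sign of a shift. The signed sum is the box increment `Δ`, so the integrals are the
  -- Walsh coefficients of `G` with digits `R`, to which Bessel's inequality applies.
  set G : (ι → ℝ) → ℝ := (lowPart ℓ).indicator fun x => Δ x * ∏ i, W i (x i) with hG
  have hGm : Measurable G := (hΔc.measurable.mul (Finset.measurable_fun_prod _ fun i _ =>
    (hWc i).measurable.comp (measurable_pi_apply i))).indicator (measurableSet_lowPart ℓ)
  have hsubI : lowPart ℓ ⊆ Set.univ.pi fun _ : ι => Set.Ico (0 : ℝ) 1 := fun x hx i _ => (hx i).1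
  have hsubC : lowPart ℓ ⊆ cube ι := fun x hx i _ => ⟨(hx i).1.1, (hx i).1.2.le⟩
  obtain ⟨B, hB⟩ := exists_bound_cube hΔc
  have hWle : ∀ x : ι → ℝ, |∏ i, W i (x i)| ≤ ∏ i, M i := fun x => by
    rw [Finset.abs_prod]
    exact Finset.prod_le_prod (fun i _ => abs_nonneg _) fun i _ => by
      rw [abs_of_nonneg (hW i _).1]; exact (hW i _).2
  have hGb : ∀ x, |G x| ≤ |B| * ∏ i, M i := fun x => by
    by_cases hx : x ∈ lowPart ℓ
    · rw [hG, Set.indicator_of_mem hx, abs_mul]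
      exact mul_le_mul ((hB x (hsubC hx)).trans (le_abs_self B)) (hWle x) (abs_nonneg _)
        (abs_nonneg _)
    · rw [hG, Set.indicator_of_notMem hx, abs_zero]
      exact mul_nonneg (abs_nonneg _) (Finset.prod_nonneg fun i _ => hM0 i)
  have hlow : ∀ F : (ι → ℝ) → ℝ, ∫ x, (lowPart ℓ).indicator F x ∂unif ι = ∫ x in lowPart ℓ, F x := by
    intro F
    rw [integral_indicator (measurableSet_lowPart ℓ), unif_eq_Ico,
      Measure.restrict_restrict (measurableSet_lowPart ℓ), Set.inter_eq_left.2 hsubI]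
  have coeff : ∀ R ∈ Fintype.piFinset fun i => (Finset.range (ℓ i)).powerset,
      ∫ x, g x * ∏ i, (W i (x i) * wal (insert (ℓ i) (R i)) (x i)) ∂unif ι =
        ∫ x, G x * mwal R x ∂unif ι := by
    intro R hR
    have hRlt : ∀ i, ∀ b ∈ R i, b < ℓ i := fun i b hb =>
      Finset.mem_range.1 (Finset.mem_powerset.1 (Fintype.mem_piFinset.1 hR i) hb)
    have hint : Integrable (fun x => g x * ∏ i, (W i (x i) * wal (insert (ℓ i) (R i)) (x i)))
        (unif ι) := by
      refine integrable_mul_prod hg (φ := fun i y => W i y * wal (insert (ℓ i) (R i)) y)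
        (fun i => (hWc i).measurable.mul (measurable_wal _)) (M := M) fun i x _ => ?_
      rw [abs_mul, abs_wal, mul_one, abs_of_nonneg (hW i x).1]; exact (hW i x).2
    obtain ⟨hint', hsum⟩ := integral_unif_eq_sum_lowPart ℓ hint
    rw [hsum]
    have e1 : ∀ x, G x * mwal R x =
        (lowPart ℓ).indicator (fun x => Δ x * (∏ i, W i (x i)) * mwal R x) x := fun x => by
      rw [hG]
      by_cases hx : x ∈ lowPart ℓ
      · simp only [Set.indicator_of_mem hx]
      · simp only [Set.indicator_of_notMem hx, zero_mul]
    simp only [e1]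
    rw [hlow, ← integral_finsetSum]
    · refine setIntegral_congr_fun (measurableSet_lowPart ℓ) fun x hx => ?_
      have e2 : ∀ S : Finset ι, g (x + S.piecewise (mesh ℓ) 0) *
          ∏ i, (W i ((x + S.piecewise (mesh ℓ) 0) i) *
            wal (insert (ℓ i) (R i)) ((x + S.piecewise (mesh ℓ) 0) i)) =
          (-1) ^ S.card * g (Sᶜ.piecewise x (x + mesh ℓ)) * ((∏ i, W i (x i)) * mwal R x) := by
        intro S
        have e3 : x + S.piecewise (mesh ℓ) 0 = Sᶜ.piecewise x (x + mesh ℓ) := by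
          funext i
          by_cases hi : i ∈ S <;> simp [hi]
        have e4 : ∀ i, W i ((x + S.piecewise (mesh ℓ) 0) i) *
            wal (insert (ℓ i) (R i)) ((x + S.piecewise (mesh ℓ) 0) i) =
            (if i ∈ S then -1 else 1) * (W i (x i) * wal (R i) (x i)) := by
          intro i
          have hnot : ℓ i ∉ R i := fun h => lt_irrefl _ (hRlt i _ h)
          by_cases hi : i ∈ S
          · simp only [Pi.add_apply, Finset.piecewise_eq_of_mem _ _ _ hi, mesh, hWp, hi, if_true]
            unfold wal
            rw [Finset.prod_insert hnot, rad_add_self, (hx i).2, Finset.prod_congr rfl fun b hb =>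
              rad_add_of_even (hRlt i b hb) (hx i).2]
            ring
          · simp only [Pi.add_apply, Finset.piecewise_eq_of_notMem _ _ _ hi, Pi.zero_apply,
              add_zero, hi, if_false]
            unfold wal
            rw [Finset.prod_insert hnot, (hx i).2]; ring
        rw [Finset.prod_congr rfl fun i _ => e4 i, Finset.prod_mul_distrib,
          Finset.prod_mul_distrib, e3, Finset.prod_ite]
        simp [mwal]
        ring
      simp only [e2]
      rw [← Finset.sum_mul, mul_assoc]
      congr 1
      simp only [hΔ, altSum]
      -- The shift set `S` corresponds to the vertex taking its lower coordinates on the complement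
      -- of `S`.
      refine Fintype.sum_bijective compl compl_involutive.bijective _ _ fun S => ?_
      rw [Finset.card_compl, Nat.sub_sub_self (Finset.card_le_univ S)]
    · intro S _
      exact hint' S
  rw [Finset.sum_congr rfl fun R hR => by rw [coeff R hR]]
  refine (bessel_mwal _ hGm hGb).trans ?_
  have e5 : ∀ x, G x ^ 2 = (lowPart ℓ).indicator (fun x => (Δ x * ∏ i, W i (x i)) ^ 2) x := fun x => by
    rw [hG]
    by_cases hx : x ∈ lowPart ℓ
    · simp only [Set.indicator_of_mem hx]
    · simp only [Set.indicator_of_notMem hx]; norm_num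
  simp only [e5]
  rw [hlow]
  have hlowC : lowPart ℓ ⊆ Set.Icc (0 : ι → ℝ) 1 := fun x hx =>
    ⟨fun i => (hx i).1.1, fun i => (hx i).1.2.le⟩
  calc ∫ x in lowPart ℓ, (Δ x * ∏ i, W i (x i)) ^ 2
      ≤ ∫ x in lowPart ℓ, (∏ i, M i) ^ 2 * Δ x ^ 2 := by
        refine setIntegral_mono_on ?_ ?_ (measurableSet_lowPart ℓ) fun x _ => ?_
        · exact (((hΔc.mul (continuous_finsetProd _ fun i _ => (hWc i).comp
            (continuous_apply i))).pow 2).continuousOn.integrableOn_compact isCompact_Icc).mono_set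
            hlowC
        · exact ((continuous_const.mul (hΔc.pow 2)).continuousOn.integrableOn_compact
            isCompact_Icc).mono_set hlowC
        · rw [mul_pow, mul_comm, ← sq_abs (∏ i, W i (x i))]
          gcongr
          exact hWle x
    _ = (∏ i, M i) ^ 2 * ∫ x in lowPart ℓ, Δ x ^ 2 := integral_const_mul _ _
    _ ≤ _ := by
        gcongr
        exact integral_lowPart_sq_le hg hfin ℓ

end Split

/-! ### Families of mixed derivatives -/

section Family
variable {s : ℕ}

/-- The nearest point of the unit cube. -/
def clamp {ι : Type*} (x : ι → ℝ) : ι → ℝ := fun j => max 0 (min 1 (x j))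

lemma clamp_mem {ι : Type*} (x : ι → ℝ) : clamp x ∈ cube ι := fun _ _ =>
  ⟨le_max_left _ _, max_le zero_le_one (min_le_left _ _)⟩

lemma clamp_of_mem {ι : Type*} {x : ι → ℝ} (hx : x ∈ cube ι) : clamp x = x := by
  funext j
  have := hx j trivial
  simp only [clamp]
  rw [min_eq_right this.2, max_eq_right this.1]

lemma continuous_clamp {ι : Type*} : Continuous (clamp : (ι → ℝ) → ι → ℝ) :=
  continuous_pi fun j => continuous_const.max (continuous_const.min (continuous_apply j))

lemma continuous_comp_clamp {ι : Type*} {g : (ι → ℝ) → ℝ} (hg : ContinuousOn g (cube ι)) :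
    Continuous fun x => g (clamp x) :=
  hg.comp_continuous continuous_clamp clamp_mem

lemma clamp_update {ι : Type*} [DecidableEq ι] (x : ι → ℝ) (i : ι) {y : ℝ}
    (hy : y ∈ Set.Icc (0 : ℝ) 1) :
    clamp (Function.update x i y) = Function.update (clamp x) i y := by
  funext j
  by_cases h : j = i
  · subst h
    simp only [clamp, Function.update_self]
    rw [min_eq_right hy.2, max_eq_right hy.1]
  · simp [clamp, h]

lemma update_mem_cube {ι : Type*} [DecidableEq ι] {x : ι → ℝ} (hx : x ∈ cube ι) (i : ι) {y : ℝ}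
    (hy : y ∈ Set.Icc (0 : ℝ) 1) : Function.update x i y ∈ cube ι := fun j _ => by
  by_cases h : j = i
  · subst h; simpa using hy
  · simpa [h] using hx j trivial

/-- A family of continuous functions that are the mixed derivatives of order at most `α` in each
coordinate of its first member, in integrated form. -/
structure IsDerivFamily (α : ℕ) (F : (Fin s → ℕ) → (Fin s → ℝ) → ℝ) : Prop where
  continuous : ∀ β, (∀ j, β j ≤ α) → Continuous (F β)
  ftc : ∀ (β : Fin s → ℕ) (i : Fin s), (∀ j, β j ≤ α) → β i < α → ∀ x, ∀ y ∈ Set.Icc (0 : ℝ) 1,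
    F β (Function.update x i y) - F β (Function.update x i 0) =
      ∫ t in (0 : ℝ)..y, F (β + Pi.single i 1) (Function.update x i t)

lemma add_single_le {α : ℕ} {β : Fin s → ℕ} {i : Fin s} (hβ : ∀ j, β j ≤ α) (hi : β i < α) :
    ∀ j, (β + Pi.single i 1 : Fin s → ℕ) j ≤ α := fun j => by
  by_cases h : j = i
  · subst h; simpa using hi
  · simpa [h] using hβ j

/-- Composing with `clamp` makes the derivatives continuous on the whole space without changing them
on the cube. The integrated form passes easily through sums and integrals over other coordinates. -/
lemma IsMixedSmooth.isDerivFamily {α : ℕ} {f : (Fin s → ℝ) → ℝ} (hf : IsMixedSmooth α f) :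
    IsDerivFamily α fun β x => mixedDeriv β f (clamp x) where
  continuous β hβ := continuous_comp_clamp (hf.continuousOn β hβ)
  ftc := by
    intro β i hβ hi x y hy
    have hc := continuous_comp_clamp (hf.continuousOn _ (add_single_le hβ hi))
    have h0 : (0 : ℝ) ∈ Set.Icc (0 : ℝ) 1 := ⟨le_rfl, zero_le_one⟩
    simp only [clamp_update x i hy, clamp_update x i h0]
    have hd : ∀ t ∈ Set.Icc (0 : ℝ) 1,
        HasDerivWithinAt (fun y => mixedDeriv β f (Function.update (clamp x) i y))
          (mixedDeriv (β + Pi.single i 1) f (clamp (Function.update x i t))) (Set.Icc 0 1) t := by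
      intro t ht
      have := hf.hasDeriv β i hβ hi (Function.update (clamp x) i t)
        (update_mem_cube (clamp_mem x) i ht)
      simpa only [Function.update_idem, Function.update_self, clamp_update x i ht] using this
    rw [eq_comm]
    refine intervalIntegral.integral_eq_sub_of_hasDeriv_right_of_le hy.1
      (fun t ht => ((hd t ⟨ht.1, ht.2.trans hy.2⟩).continuousWithinAt).mono
        (Set.Icc_subset_Icc_right hy.2)) (fun t ht => ?_) ?_
    · exact ((hd t ⟨ht.1.le, ht.2.le.trans hy.2⟩).hasDerivAt
        (Icc_mem_nhds ht.1 (ht.2.trans_le hy.2))).hasDerivWithinAt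
    · exact (hc.comp (continuous_const.update i continuous_id)).intervalIntegrable _ _

lemma IsDerivFamily.hasDerivWithinAt {α : ℕ} {F : (Fin s → ℕ) → (Fin s → ℝ) → ℝ}
    (hF : IsDerivFamily α F) {β : Fin s → ℕ} {i : Fin s} (hβ : ∀ j, β j ≤ α) (hi : β i < α)
    (x : Fin s → ℝ) {y : ℝ} (hy : y ∈ Set.Icc (0 : ℝ) 1) :
    HasDerivWithinAt (fun y => F β (Function.update x i y))
      (F (β + Pi.single i 1) (Function.update x i y)) (Set.Icc 0 1) y := by
  have hc : Continuous fun t => F (β + Pi.single i 1) (Function.update x i t) :=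
    (hF.continuous _ (add_single_le hβ hi)).comp (continuous_const.update i continuous_id)
  have h1 : HasDerivAt (fun y => F β (Function.update x i 0) +
      ∫ t in (0 : ℝ)..y, F (β + Pi.single i 1) (Function.update x i t))
      (F (β + Pi.single i 1) (Function.update x i y)) y :=
    (intervalIntegral.integral_hasDerivAt_right (hc.intervalIntegrable 0 y)
      hc.stronglyMeasurable.stronglyMeasurableAtFilter hc.continuousAt).const_add _
  refine h1.hasDerivWithinAt.congr (fun z hz => ?_) ?_
  · rw [← hF.ftc β i hβ hi x z hz]; ring
  · rw [← hF.ftc β i hβ hi x y hy]; ring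

/-- Derivatives within the closed cube are unique, so the iterated partial derivatives must follow
the family. This identifies the derivatives of the recursively defined ANOVA components that occur
in the norm. -/
lemma IsDerivFamily.mixedDeriv_eq {α : ℕ} {F : (Fin s → ℕ) → (Fin s → ℝ) → ℝ}
    (hF : IsDerivFamily α F) {g : (Fin s → ℝ) → ℝ} (hg : ∀ x ∈ cube (Fin s), g x = F 0 x)
    {β : Fin s → ℕ} (hβ : ∀ j, β j ≤ α) : ∀ x ∈ cube (Fin s), mixedDeriv β g x = F β x := by
  -- Once the coordinates in `l` are processed, the order reached is `β` restricted to `l`.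
  have key : ∀ l : List (Fin s), l.Nodup → ∀ x ∈ cube (Fin s),
      l.foldr (fun j h => (partialDeriv j)^[β j] h) g x = F (fun j => if j ∈ l then β j else 0) x := by
    intro l
    induction l with
    | nil =>
      intro _ x hx
      have e : (fun j : Fin s => if j ∈ ([] : List (Fin s)) then β j else 0) = 0 := by
        funext j; simp
      rw [e]; exact hg x hx
    | cons j l ih =>
      intro hl
      rw [List.nodup_cons] at hl
      specialize ih hl.2
      set h := l.foldr (fun j h => (partialDeriv j)^[β j] h) g with hh
      set b : Fin s → ℕ := fun j => if j ∈ l then β j else 0 with hb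
      have inner : ∀ n ≤ β j, ∀ x ∈ cube (Fin s),
          (partialDeriv j)^[n] h x = F (Function.update b j n) x := by
        intro n
        induction n with
        | zero =>
          intro _ x hx
          have : b j = 0 := by simp [hb, hl.1]
          rw [Function.iterate_zero, id, ih x hx, ← this, Function.update_eq_self]
        | succ n ihn =>
          intro hn x hx
          specialize ihn (by omega)
          rw [Function.iterate_succ_apply']
          have hxj := hx j trivial
          have hbα : ∀ i, Function.update b j n i ≤ α := fun i => by
            by_cases hi : i = j
            · subst hi; simpa using (by have := hβ i; omega : n ≤ α)
            · simp only [Function.update_of_ne hi, hb]; split_ifs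
              · exact hβ i
              · exact Nat.zero_le _
          have hd := hF.hasDerivWithinAt (i := j) hbα
            (by simpa using (by have := hβ j; omega : n < α)) x hxj
          have e : Function.update b j n + Pi.single j 1 = Function.update b j (n + 1) := by
            funext i
            by_cases hi : i = j
            · subst hi; simp
            · simp [hi]
          rw [e, Function.update_eq_self] at hd
          unfold partialDeriv
          rw [← hd.derivWithin (uniqueDiffOn_Icc zero_lt_one _ hxj)]
          refine derivWithin_congr (fun y hy => ?_) ?_
          · exact ihn _ (update_mem_cube hx j hy)
          · exact ihn _ (update_mem_cube hx j hxj)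
      intro x hx
      rw [List.foldr_cons, inner (β j) le_rfl x hx]
      congr 1
      funext i
      by_cases hi : i = j
      · subst hi; simp
      · simp [hi, hb]
  intro x hx
  have := key (List.finRange s) (List.nodup_finRange s) x hx
  simpa [mixedDeriv] using this

lemma IsDerivFamily.sub {α : ℕ} {F G : (Fin s → ℕ) → (Fin s → ℝ) → ℝ}
    (hF : IsDerivFamily α F) (hG : IsDerivFamily α G) :
    IsDerivFamily α fun β x => F β x - G β x where
  continuous β hβ := (hF.continuous β hβ).sub (hG.continuous β hβ)
  ftc := by
    intro β i hβ hi x y hy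
    have cF := (hF.continuous _ (add_single_le hβ hi)).comp
      (continuous_const.update i continuous_id : Continuous fun t => Function.update x i t)
    have cG := (hG.continuous _ (add_single_le hβ hi)).comp
      (continuous_const.update i continuous_id : Continuous fun t => Function.update x i t)
    have e := intervalIntegral.integral_sub (μ := volume)
      (cF.intervalIntegrable 0 y) (cG.intervalIntegrable 0 y)
    simp only [Function.comp_apply] at e
    rw [e, ← hF.ftc β i hβ hi x y hy, ← hG.ftc β i hβ hi x y hy]; ring

lemma IsDerivFamily.sum {α : ℕ} {κ : Type*} (T : Finset κ)
    {F : κ → (Fin s → ℕ) → (Fin s → ℝ) → ℝ} (hF : ∀ k, IsDerivFamily α (F k)) :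
    IsDerivFamily α fun β x => ∑ k ∈ T, F k β x where
  continuous β hβ := continuous_finsetSum _ fun k _ => (hF k).continuous β hβ
  ftc := by
    intro β i hβ hi x y hy
    have cF := fun k => ((hF k).continuous _ (add_single_le hβ hi)).comp
      (continuous_const.update i continuous_id : Continuous fun t => Function.update x i t)
    have e := intervalIntegral.integral_finsetSum (s := T) (μ := volume) (a := 0) (b := y)
      fun k (_ : k ∈ T) => (cF k).intervalIntegrable 0 y
    simp only [Function.comp_apply] at e
    rw [e, ← Finset.sum_sub_distrib]
    exact Finset.sum_congr rfl fun k _ => (hF k).ftc β i hβ hi x y hy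

lemma continuous_integral_piecewise {ι : Type*} [Fintype ι] [DecidableEq ι] (v : Finset ι)
    {g : (ι → ℝ) → ℝ} (hg : Continuous g) :
    Continuous fun x : ι → ℝ => ∫ y, g (v.piecewise x y) ∂unif ι := by
  rw [unif_eq]
  have hp : Continuous fun p : (ι → ℝ) × (ι → ℝ) => v.piecewise p.1 p.2 := by
    refine continuous_pi fun i => ?_
    by_cases h : i ∈ v
    · simp only [h, Finset.piecewise_eq_of_mem]; fun_prop
    · simp only [h, not_false_eq_true, Finset.piecewise_eq_of_notMem]; fun_prop
  exact continuous_parametric_integral_of_continuous (f := fun x y => g (v.piecewise x y))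
    (hg.comp hp) isCompact_cube

lemma piecewise_update_of_mem {ι : Type*} [DecidableEq ι] {v : Finset ι} {i : ι} (hi : i ∈ v)
    (x y : ι → ℝ) (t : ℝ) :
    v.piecewise (Function.update x i t) y = Function.update (v.piecewise x y) i t := by
  funext j
  by_cases h : j = i
  · subst h; simp [hi]
  · by_cases hj : j ∈ v <;> simp [h, hj]

lemma piecewise_update_of_notMem {ι : Type*} [DecidableEq ι] {v : Finset ι} {i : ι} (hi : i ∉ v)
    (x y : ι → ℝ) (t : ℝ) :
    v.piecewise (Function.update x i t) y = v.piecewise x y := by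
  funext j
  by_cases h : j = i
  · subst h; simp [hi]
  · by_cases hj : j ∈ v <;> simp [h, hj]

-- For a coordinate in `v`, Fubini's theorem differentiates under the integral. The integral does
-- not depend on the coordinates outside `v`, so derivatives of positive order there are zero.
open Classical in
lemma IsDerivFamily.integral {α : ℕ} {F : (Fin s → ℕ) → (Fin s → ℝ) → ℝ}
    (hF : IsDerivFamily α F) (v : Finset (Fin s)) :
    IsDerivFamily α fun β x =>
      if ∀ j ∉ v, β j = 0 then ∫ y, F β (v.piecewise x y) ∂unif (Fin s) else 0 where
  continuous β hβ := by
    by_cases h : ∀ j ∉ v, β j = 0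
    · simp only [if_pos h]; exact continuous_integral_piecewise v (hF.continuous β hβ)
    · simp only [if_neg h]; exact continuous_const
  ftc := by
    intro β i hβ hi x y hy
    by_cases hiv : i ∈ v
    · have hiff : (∀ j ∉ v, (β + Pi.single i 1 : Fin s → ℕ) j = 0) ↔ ∀ j ∉ v, β j = 0 := by
        refine forall₂_congr fun j hj => ?_
        have : j ≠ i := fun h => hj (h ▸ hiv)
        simp [this]
      simp only [hiff]
      by_cases h : ∀ j ∉ v, β j = 0
      · simp only [if_pos h, piecewise_update_of_mem hiv]
        have hc := hF.continuous _ (add_single_le hβ hi)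
        have hcp : ∀ x : Fin s → ℝ, Continuous fun y : Fin s → ℝ => v.piecewise x y := fun x =>
          continuous_pi fun j => by
            by_cases hj : j ∈ v
            · simpa [hj] using continuous_const
            · simpa [hj] using continuous_apply j
        have hint : ∀ t : ℝ, Integrable (fun z => F β (Function.update (v.piecewise x z) i t))
            (unif (Fin s)) := fun t => by
          have hc' : Continuous fun z => F β (Function.update (v.piecewise x z) i t) :=
            (hF.continuous β hβ).comp ((hcp x).update i continuous_const)
          obtain ⟨M, hM⟩ := exists_bound_cube hc'
          exact integrable_unif_of_bdd hc'.measurable hM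
        rw [← integral_sub (hint y) (hint 0)]
        simp only [hF.ftc β i hβ hi _ y hy]
        simp only [intervalIntegral.integral_of_le hy.1]
        refine integral_integral_swap
          (f := fun z t => F (β + Pi.single i 1) (Function.update (v.piecewise x z) i t)) ?_
        rw [unif_eq, Measure.prod_restrict]
        have hu : Continuous fun p : (Fin s → ℝ) × ℝ =>
            Function.update (v.piecewise x p.1) i p.2 :=
          ((hcp x).comp continuous_fst).update i continuous_snd
        exact ((hc.comp hu).continuousOn.integrableOn_compact
          (isCompact_cube.prod isCompact_Icc)).mono_set
            (Set.prod_mono_right (Set.Ioc_subset_Icc_self (a := (0 : ℝ)) (b := y)))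
      · simp [if_neg h]
    · have hz : ¬ ∀ j ∉ v, (β + Pi.single i 1 : Fin s → ℕ) j = 0 := fun h => by simpa using h i hiv
      simp only [if_neg hz, piecewise_update_of_notMem hiv]
      simp

end Family

/-! ### Walsh coefficients, ANOVA components and repeated integration by parts -/

section Coefficients
variable {s : ℕ}

/-- The Walsh coefficient with digit sets `κ`. -/
def walCoef (f : (Fin s → ℝ) → ℝ) (κ : Fin s → Finset ℕ) : ℝ := ∫ x, f x * mwal κ x ∂unif (Fin s)

lemma walCoef_congr {f g : (Fin s → ℝ) → ℝ} (h : ∀ x ∈ cube (Fin s), f x = g x)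
    (κ : Fin s → Finset ℕ) : walCoef f κ = walCoef g κ := by
  refine integral_congr_ae ?_
  filter_upwards [ae_unif_mem (ι := Fin s)] with x hx
  rw [h x hx]

lemma integrable_mul_mwal {g : (Fin s → ℝ) → ℝ} (hg : Continuous g) (κ : Fin s → Finset ℕ) :
    Integrable (fun x => g x * mwal κ x) (unif (Fin s)) :=
  integrable_mul_prod hg (fun i => measurable_wal (κ i)) (M := fun _ => 1)
    fun i x _ => (abs_wal (κ i) x).le

lemma walCoef_eq_zero {g : (Fin s → ℝ) → ℝ} (hg : Continuous g) {j : Fin s}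
    (hj : ∀ x y, g (Function.update x j y) = g x) {κ : Fin s → Finset ℕ} (hκ : κ j ≠ ∅) :
    walCoef g κ = 0 := by
  unfold walCoef
  rw [integral_update j (integrable_mul_mwal hg κ)]
  have e : ∀ x : Fin s → ℝ, ∀ y, g (Function.update x j y) * mwal κ (Function.update x j y) =
      (g x * ∏ i ∈ Finset.univ.erase j, wal (κ i) (x i)) * wal (κ j) y := by
    intro x y
    unfold mwal
    rw [hj, ← Finset.mul_prod_erase _ _ (Finset.mem_univ j), Function.update_self]
    rw [Finset.prod_congr rfl fun i hi => by
      rw [Function.update_of_ne (Finset.ne_of_mem_erase hi)]]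
    ring
  simp only [e, integral_const_mul]
  have : ∫ y, wal (κ j) y ∂unifI = 0 := integral_wal (Finset.nonempty_iff_ne_empty.2 hκ)
  simp [this]

lemma mixedDeriv_zero (f : (Fin s → ℝ) → ℝ) : mixedDeriv 0 f = f := by
  unfold mixedDeriv
  induction List.finRange s with
  | nil => rfl
  | cons j l ih => rw [List.foldr_cons, ih]; rfl

lemma piecewise_mem_cube {ι : Type*} [DecidableEq ι] (u : Finset ι) {x y : ι → ℝ}
    (hx : x ∈ cube ι) (hy : y ∈ cube ι) : u.piecewise x y ∈ cube ι := fun i _ => by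
  by_cases h : i ∈ u
  · simpa [h] using hx i trivial
  · simpa [h] using hy i trivial

/-- The ANOVA component `f_u` heads a family of mixed derivatives, does not depend on the
coordinates outside `u`, and has the same Walsh coefficients with support `u` as `f`. -/
lemma exists_anova_family {α : ℕ} {f : (Fin s → ℝ) → ℝ} (hf : IsMixedSmooth α f)
    (u : Finset (Fin s)) : ∃ G : (Fin s → ℕ) → (Fin s → ℝ) → ℝ, IsDerivFamily α G ∧
      (∀ x ∈ cube (Fin s), anova f u x = G 0 x) ∧
      (∀ x, ∀ j ∉ u, ∀ y, G 0 (Function.update x j y) = G 0 x) ∧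
      ∀ κ : Fin s → Finset ℕ, (∀ j, κ j ≠ ∅ ↔ j ∈ u) → walCoef f κ = walCoef (G 0) κ := by
  classical
  induction u using Finset.strongInduction with
  | H u ih =>
  choose G hG1 hG2 hG3 hG4 using ih
  set F : (Fin s → ℕ) → (Fin s → ℝ) → ℝ := fun β x => mixedDeriv β f (clamp x) with hFdef
  have hF : IsDerivFamily α F := hf.isDerivFamily
  have hF0 : ∀ x ∈ cube (Fin s), F 0 x = f x := fun x hx => by
    simp only [hFdef, mixedDeriv_zero, clamp_of_mem hx]
  have hFc : Continuous (F 0) := hF.continuous 0 fun _ => Nat.zero_le _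
  set Gs : {v // v ∈ u.ssubsets} → (Fin s → ℕ) → (Fin s → ℝ) → ℝ :=
    fun v => G v.1 (Finset.mem_ssubsets.1 v.2) with hGs
  set I : (Fin s → ℕ) → (Fin s → ℝ) → ℝ := fun β x =>
    if ∀ j ∉ u, β j = 0 then ∫ y, F β (u.piecewise x y) ∂unif (Fin s) else 0 with hI
  have hIfam : IsDerivFamily α I := hF.integral u
  have hsfam : IsDerivFamily α fun β x => ∑ v ∈ u.ssubsets.attach, Gs v β x :=
    IsDerivFamily.sum _ fun v => hG1 v.1 _
  have hI0 : ∀ x, I 0 x = ∫ y, F 0 (u.piecewise x y) ∂unif (Fin s) := fun x => by simp [hI]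
  refine ⟨_, hIfam.sub hsfam, ?_, ?_, ?_⟩
  · intro x hx
    rw [anova, integral_cube_eq]
    congr 1
    · rw [hI0]
      refine integral_congr_ae ?_
      filter_upwards [ae_unif_mem (ι := Fin s)] with y hy
      rw [hF0 _ (piecewise_mem_cube u hx hy)]
    · exact Finset.sum_congr rfl fun v _ => hG2 v.1 _ x hx
  · intro x j hj y
    have h1 : I 0 (Function.update x j y) = I 0 x := by
      simp only [hI0, piecewise_update_of_notMem hj]
    have h2 : ∀ v : {v // v ∈ u.ssubsets},
        Gs v 0 (Function.update x j y) = Gs v 0 x := fun v =>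
      hG3 v.1 _ x j (fun h => hj ((Finset.mem_ssubsets.1 v.2).1 h)) y
    simp only [h1, h2]
  · intro κ hκ
    have hIc : Continuous (I 0) := hIfam.continuous 0 fun _ => Nat.zero_le _
    have hGc : ∀ v, Continuous (Gs v 0) := fun v =>
      (hG1 v.1 _).continuous 0 fun _ => Nat.zero_le _
    have e1 : walCoef (fun x => I 0 x - ∑ v ∈ u.ssubsets.attach, Gs v 0 x) κ =
        walCoef (I 0) κ - ∑ v ∈ u.ssubsets.attach, walCoef (Gs v 0) κ := by
      unfold walCoef
      simp only [sub_mul, Finset.sum_mul]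
      rw [integral_sub (integrable_mul_mwal hIc κ)
        (integrable_finsetSum _ fun v _ => integrable_mul_mwal (hGc v) κ),
        integral_finsetSum _ fun v _ => integrable_mul_mwal (hGc v) κ]
    -- Every proper subset of `u` misses a coordinate where `κ` has digits, so its component has
    -- coefficient zero. Integrating out the coordinates outside `u` changes nothing, as the Walsh
    -- function does not depend on them.
    rw [e1, Finset.sum_eq_zero, sub_zero, walCoef_congr (fun x hx => (hF0 x hx).symm)]
    · unfold walCoef
      rw [integral_piecewise u (integrable_mul_mwal hFc κ)]
      refine integral_congr_ae (Filter.Eventually.of_forall fun x => ?_)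
      simp only
      rw [hI0, ← integral_mul_const]
      refine integral_congr_ae (Filter.Eventually.of_forall fun y => ?_)
      simp only
      congr 1
      refine Finset.prod_congr rfl fun j _ => ?_
      by_cases hj : j ∈ u
      · simp [hj]
      · have : κ j = ∅ := by by_contra h; exact hj ((hκ j).1 h)
        simp [this, wal]
    · intro v _
      obtain ⟨j, hju, hjv⟩ := Finset.exists_of_ssubset (Finset.mem_ssubsets.1 v.2)
      exact walCoef_eq_zero (hGc v) (fun x y => hG3 v.1 _ x j hjv y) ((hκ j).2 hju)

/-- One integration by parts. -/
lemma IsDerivFamily.integral_walPrim_step {α : ℕ} {F : (Fin s → ℕ) → (Fin s → ℝ) → ℝ}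
    (hF : IsDerivFamily α F) {β : Fin s → ℕ} {i : Fin s} (hβ : ∀ j, β j ≤ α) (hi : β i < α)
    {κ : Fin s → Finset ℕ} (hκ : β i < (κ i).card) :
    ∫ x, F β x * ∏ j, walPrim (κ j) (β j) (x j) ∂unif (Fin s) =
      -∫ x, F (β + Pi.single i 1) x *
        ∏ j, walPrim (κ j) ((β + Pi.single i 1 : Fin s → ℕ) j) (x j) ∂unif (Fin s) := by
  have hint : ∀ β : Fin s → ℕ, (∀ j, β j ≤ α) →
      Integrable (fun x => F β x * ∏ j, walPrim (κ j) (β j) (x j)) (unif (Fin s)) := fun β hβ =>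
    integrable_mul_prod (hF.continuous β hβ) (fun j => measurable_walPrim (κ j) (β j))
      (M := fun _ => 1) fun j x hx => abs_walPrim_le _ _ hx
  have hβ' := add_single_le hβ hi
  rw [integral_update i (hint β hβ), integral_update i (hint _ hβ'), ← integral_neg]
  refine integral_congr_ae (Filter.Eventually.of_forall fun x => ?_)
  simp only
  have e : ∀ β' : Fin s → ℕ, (∀ j, j ≠ i → β' j = β j) → ∀ y,
      F β' (Function.update x i y) * ∏ j, walPrim (κ j) (β' j) (Function.update x i y j) =
      (∏ j ∈ Finset.univ.erase i, walPrim (κ j) (β j) (x j)) *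
        (F β' (Function.update x i y) * walPrim (κ i) (β' i) y) := by
    intro β' h y
    rw [← Finset.mul_prod_erase _ _ (Finset.mem_univ i), Function.update_self]
    rw [Finset.prod_congr rfl fun j hj => by
      rw [Function.update_of_ne (Finset.ne_of_mem_erase hj), h j (Finset.ne_of_mem_erase hj)]]
    ring
  simp only [e β fun _ _ => rfl, e (β + Pi.single i 1) fun j hj => by simp [hj],
    integral_const_mul, ← mul_neg]
  congr 1
  have := integral_mul_walPrim (g := fun y => F β (Function.update x i y))
    ((hF.continuous _ hβ').comp (continuous_const.update i continuous_id))
    (fun y hy => hF.ftc β i hβ hi x y hy) (κ i) hκ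
  simpa [unifI] using this

/-- Each step lowers one positive entry of `β` by 1. No boundary term appears because the order
never exceeds the number of digits in that coordinate. -/
lemma IsDerivFamily.integral_walPrim {α : ℕ} {F : (Fin s → ℕ) → (Fin s → ℝ) → ℝ}
    (hF : IsDerivFamily α F) {κ : Fin s → Finset ℕ} (n : ℕ) :
    ∀ β : Fin s → ℕ, ∑ j, β j = n → (∀ j, β j ≤ α) → (∀ j, β j ≤ (κ j).card) →
    walCoef (F 0) κ = (-1) ^ n * ∫ x, F β x * ∏ j, walPrim (κ j) (β j) (x j) ∂unif (Fin s) := by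
  induction n with
  | zero =>
    intro β hsum _ _
    have : β = 0 := funext fun j => Finset.sum_eq_zero_iff.1 hsum j (Finset.mem_univ j)
    subst this
    simp [walCoef, mwal, walPrim]
  | succ n ih =>
    intro β hsum hα hκ
    obtain ⟨i, hi⟩ : ∃ i, 0 < β i := by
      by_contra h
      push Not at h
      rw [Finset.sum_eq_zero fun j _ => Nat.le_zero.1 (h j)] at hsum
      omega
    set β' : Fin s → ℕ := Function.update β i (β i - 1) with hβ'
    have hle : ∀ j, β' j ≤ β j := fun j => by
      by_cases h : j = i
      · subst h; simp [hβ']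
      · simp [hβ', h]
    have hadd : β' + Pi.single i 1 = β := by
      funext j
      by_cases h : j = i
      · subst h; simp [hβ']; omega
      · simp [hβ', h]
    have hi' : β' i < β i := by simp [hβ']; omega
    have hs : ∑ j, β' j = n := by
      have : ∑ j, (β' + Pi.single i 1 : Fin s → ℕ) j = n + 1 := by rw [hadd]; exact hsum
      simp only [Pi.add_apply, Finset.sum_add_distrib, Finset.sum_pi_single', Finset.mem_univ,
        if_true] at this
      omega
    rw [ih β' hs (fun j => (hle j).trans (hα j)) fun j => (hle j).trans (hκ j),
      hF.integral_walPrim_step (fun j => (hle j).trans (hα j)) (hi'.trans_le (hα i))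
        (hi'.trans_le (hκ i)), hadd, pow_succ]
    ring

end Coefficients

section Group

/-! ### The variation depends only on values in the closed cube -/

section Congr
variable {ι : Type*} [Fintype ι] [DecidableEq ι]

omit [Fintype ι] in
-- If an upper end exceeded 1, the half-open box would contain a point with that coordinate equal to
-- 1, outside the region covered by the partition.
lemma IsBoxPartition.mem_Icc {Q : Finset ((ι → ℝ) × (ι → ℝ))} (hQ : IsBoxPartition Q)
    {J : (ι → ℝ) × (ι → ℝ)} (hJ : J ∈ Q) :
    J.1 ∈ cube ι ∧ J.2 ∈ cube ι := by
  have hsub : box J ⊆ Set.univ.pi fun _ => Set.Ico (0 : ℝ) 1 := by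
    rw [← hQ.cover]; exact Set.subset_biUnion_of_mem (u := box) hJ
  have h1 := hsub (show J.1 ∈ box J from fun i _ => ⟨le_rfl, hQ.lt J hJ i⟩)
  refine ⟨fun i _ => ⟨(h1 i trivial).1, (h1 i trivial).2.le⟩,
    fun i _ => ⟨(h1 i trivial).1.trans (hQ.lt J hJ i).le, ?_⟩⟩
  by_contra hcon
  have h2 := hsub (show Function.update J.1 i 1 ∈ box J from fun k _ => by
    by_cases hk : k = i
    · subst hk
      simp only [Function.update_self]
      exact ⟨(h1 k trivial).2.le, not_le.1 hcon⟩
    · simp only [Function.update_of_ne hk]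
      exact ⟨le_rfl, hQ.lt J hJ k⟩)
  have := (h2 i trivial).2
  simp at this

lemma vitaliVar_congr {lam : ℝ} {g h : (ι → ℝ) → ℝ} (hgh : ∀ x ∈ cube ι, g x = h x) :
    vitaliVar lam g = vitaliVar lam h := by
  unfold vitaliVar
  congr 1
  refine iSup_congr fun Q => iSup_congr fun hQ => ?_
  congr 1
  refine Finset.sum_congr rfl fun J hJ => ?_
  have : altSum g J = altSum h J := by
    unfold altSum
    refine Finset.sum_congr rfl fun v _ => ?_
    rw [hgh _ (piecewise_mem_cube v (hQ.mem_Icc hJ).1 (hQ.mem_Icc hJ).2)]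
  rw [this]

end Congr

lemma measurePreserving_restrict {s : ℕ} (v : Finset (Fin s)) :
    MeasurePreserving (fun (x : Fin s → ℝ) (j : v) => x j) (unif (Fin s)) (unif v) := by
  have h1 := measurePreserving_piEquivPiSubtypeProd (fun _ : Fin s => unifI) (· ∈ v)
  have h2 := measurePreserving_fst.comp h1
  convert! h2 using 1
  unfold unif
  congr!

/-! ### Groups of Walsh coefficients -/

/-- The smallest element of a set of digits. -/
def lead (τ : Finset ℕ) : ℕ := sInf (τ : Set ℕ)

lemma lead_mem {τ : Finset ℕ} (h : τ.Nonempty) : lead τ ∈ τ := by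
  have := Nat.sInf_mem (s := (τ : Set ℕ)) h
  exact_mod_cast this

lemma lead_le {τ : Finset ℕ} {a : ℕ} (h : a ∈ τ) : lead τ ≤ a :=
  Nat.sInf_le (Finset.mem_coe.2 h)

/-- The digits that are removed by `α` integrations by parts. -/
def ibpPart (α : ℕ) (τ : Finset ℕ) : Finset ℕ := if τ.card = α + 1 then τ.erase (lead τ) else τ

/-- The sets of lower digits that may accompany `τ` when `τ` consists of the `α + 1` leading
digits. -/
def lowerDigits (α : ℕ) (τ : Finset ℕ) : Finset (Finset ℕ) :=
  if τ.card = α + 1 then (Finset.range (lead τ)).powerset else {∅}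

/-- The decay of the Walsh coefficients with leading digits `τ` in one coordinate. -/
def decay (α : ℕ) (lam : ℝ) (τ : Finset ℕ) : ℝ :=
  (∏ a ∈ ibpPart α τ, ((2 : ℝ) ^ (a + 1))⁻¹) *
    if τ.card = α + 1 then (((2 : ℝ) ^ (lead τ + 1))⁻¹) ^ lam else 1

lemma lowerDigits_lt {α : ℕ} {τ R : Finset ℕ} (hR : R ∈ lowerDigits α τ) :
    ∀ b ∈ R, ∀ a ∈ τ, b < a := by
  intro b hb a ha
  unfold lowerDigits at hR
  split_ifs at hR with h
  · have := Finset.mem_range.1 (Finset.mem_powerset.1 hR hb)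
    exact this.trans_le (lead_le ha)
  · rw [Finset.mem_singleton] at hR; subst hR; simp at hb

variable {s : ℕ}

lemma partialVar_le_compVar {α : ℕ} {lam : ℝ} {f : (Fin s → ℝ) → ℝ} {u v : Finset (Fin s)}
    (hu : u ≠ ∅) (hv : v ⊆ u) {β : Fin s → ℕ} (h1 : ∀ j, β j ≤ α) (h2 : ∀ j, j ∉ u → β j = 0)
    (h3 : ∀ j ∈ v, β j = α) (h4 : ∀ j ∈ u \ v, 0 < β j) :
    partialVar lam u v (mixedDeriv β (anova f u)) ≤ compVar α lam f u := by
  unfold compVar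
  rw [if_neg hu]
  exact le_iSup₂_of_le v hv (le_iSup₂_of_le (f := fun (β : Fin s → ℕ)
    (_ : (∀ j, β j ≤ α) ∧ (∀ j, j ∉ u → β j = 0) ∧ (∀ j ∈ v, β j = α) ∧ ∀ j ∈ u \ v, 0 < β j) =>
      partialVar lam u v (mixedDeriv β (anova f u))) β ⟨h1, h2, h3, h4⟩ le_rfl)

/-- The square sum of the Walsh coefficients with given leading digits. -/
lemma sum_walCoef_sq_le {α : ℕ} {lam : ℝ} {f : (Fin s → ℝ) → ℝ} (hf : IsMixedSmooth α f)
    {u : Finset (Fin s)} (hu : u ≠ ∅) (hfin : compVar α lam f u ≠ ∞)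
    {S : Fin s → Finset ℕ} (hS : ∀ j, S j ≠ ∅ ↔ j ∈ u) (hcard : ∀ j, (S j).card ≤ α + 1) :
    ∑ R ∈ Fintype.piFinset fun j => lowerDigits α (S j), walCoef f (fun j => R j ∪ S j) ^ 2 ≤
      (∏ j, decay α lam (S j)) ^ 2 * (compVar α lam f u).toReal ^ 2 := by
  classical
  obtain ⟨G, hG, hG0, -, hGw⟩ := exists_anova_family hf u
  -- `T` holds the digits consumed by integration by parts, `β` their numbers. The set `v` marks the
  -- coordinates with all `α + 1` leading digits; there one leading digit survives for the
  -- variation. In the coordinates of `u \ v` every digit is consumed.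
  set T : Fin s → Finset ℕ := fun j => ibpPart α (S j) with hT
  set β : Fin s → ℕ := fun j => (T j).card with hβ
  set v : Finset (Fin s) := Finset.univ.filter fun j => (S j).card = α + 1 with hv
  have hvS : ∀ j, j ∈ v ↔ (S j).card = α + 1 := fun j => by simp [hv]
  have hTv : ∀ j ∈ v, T j = (S j).erase (lead (S j)) := fun j hj => by
    simp only [hT, ibpPart, if_pos ((hvS j).1 hj)]
  have hTnv : ∀ j ∉ v, T j = S j := fun j hj => by
    simp only [hT, ibpPart, if_neg (fun h => hj ((hvS j).2 h))]
  have hne : ∀ j ∈ v, (S j).Nonempty := fun j hj => by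
    rw [← Finset.card_pos, (hvS j).1 hj]; omega
  have hvu : v ⊆ u := fun j hj => (hS j).1 (Finset.nonempty_iff_ne_empty.1 (hne j hj))
  have hβv : ∀ j ∈ v, β j = α := fun j hj => by
    simp only [hβ, hTv j hj]
    rw [Finset.card_erase_of_mem (lead_mem (hne j hj)), (hvS j).1 hj]; rfl
  have hβα : ∀ j, β j ≤ α := fun j => by
    by_cases hj : j ∈ v
    · exact (hβv j hj).le
    · have h1 := hcard j
      have h2 : (S j).card ≠ α + 1 := fun h => hj ((hvS j).2 h)
      simp only [hβ, hTnv j hj]; omega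
  have hunot : ∀ j ∉ u, S j = ∅ := fun j hj => by
    by_contra h; exact hj ((hS j).1 h)
  have hβ0 : ∀ j, j ∉ u → β j = 0 := fun j hj => by
    simp only [hβ, hTnv j (fun h => hj (hvu h)), hunot j hj, Finset.card_empty]
  have hβpos : ∀ j ∈ u \ v, 0 < β j := fun j hj => by
    rw [Finset.mem_sdiff] at hj
    simp only [hβ, hTnv j hj.2, Finset.card_pos]
    exact Finset.nonempty_iff_ne_empty.2 ((hS j).2 hj.1)
  choose W hWc hWb hWp hW0 hWw using fun j => exists_walPrim_eq (T j)
  set M : Fin s → ℝ := fun j => ∏ a ∈ T j, ((2 : ℝ) ^ (a + 1))⁻¹ with hM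
  have hMpos : ∀ j, 0 < M j := fun j => Finset.prod_pos fun a _ => by positivity
  -- After dividing by their maximal size, the periodic factors in the coordinates of `u \ v` are
  -- admissible weights in the partial variation.
  set ρ : Fin s → ℝ → ℝ := fun j y => W j y / M j with hρ
  have hρok : ∀ j, ContinuousOn (ρ j) (Set.Icc 0 1) ∧
      ∀ y ∈ Set.Icc (0 : ℝ) 1, 0 ≤ ρ j y ∧ ρ j y ≤ 1 := fun j =>
    ⟨((hWc j).div_const _).continuousOn, fun y _ =>
      ⟨div_nonneg (hWb j y).1 (hMpos j).le, (div_le_one (hMpos j)).2 (hWb j y).2⟩⟩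
  have hρc : ∀ j, Continuous (ρ j) := fun j => (hWc j).div_const _
  -- the integrated function
  set H : (v → ℝ) → ℝ := fun z => ∫ y, G β (fun j => if h : j ∈ v then z ⟨j, h⟩ else y j) *
    ∏ j ∈ u \ v, ρ j (y j) ∂unif (Fin s) with hH
  have hGc := hG.continuous β hβα
  have hHc : Continuous H := by
    simp only [hH]
    rw [unif_eq]
    have hp : Continuous fun p : (v → ℝ) × (Fin s → ℝ) =>
        (fun j => if h : j ∈ v then p.1 ⟨j, h⟩ else p.2 j : Fin s → ℝ) := by
      refine continuous_pi fun j => ?_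
      by_cases h : j ∈ v
      · simp only [h, dif_pos]; fun_prop
      · simp only [h, dif_neg, not_false_eq_true]; fun_prop
    refine continuous_parametric_integral_of_continuous
      (f := fun (z : v → ℝ) (y : Fin s → ℝ) => G β (fun j => if h : j ∈ v then z ⟨j, h⟩ else y j) *
        ∏ j ∈ u \ v, ρ j (y j)) ((hGc.comp hp).mul ?_) isCompact_cube
    exact continuous_finsetProd _ fun j _ => (hρc j).comp
      ((continuous_apply j).comp continuous_snd)
  have hHle : vitaliVar lam H ≤ compVar α lam f u := by
    refine le_trans ?_ (partialVar_le_compVar (lam := lam) (f := f) hu hvu hβα hβ0 hβv hβpos)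
    unfold partialVar
    refine le_trans (le_of_eq (vitaliVar_congr fun z hz => ?_))
      (le_iSup₂_of_le (f := fun (ρ : Fin s → ℝ → ℝ) (_ : ∀ j, ContinuousOn (ρ j) (Set.Icc 0 1) ∧
        ∀ y ∈ Set.Icc (0 : ℝ) 1, 0 ≤ ρ j y ∧ ρ j y ≤ 1) =>
        vitaliVar lam (partialInt u v (mixedDeriv β (anova f u)) ρ)) ρ hρok le_rfl)
    simp only [hH, partialInt]
    rw [integral_cube_eq]
    refine integral_congr_ae ?_
    filter_upwards [ae_unif_mem (ι := Fin s)] with y hy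
    rw [hG.mixedDeriv_eq hG0 hβα]
    intro j _
    by_cases h : j ∈ v
    · simpa [h] using hz ⟨j, h⟩ trivial
    · simpa [h] using hy j trivial
  have hHfin : vitaliVar lam H ≠ ∞ := (hHle.trans_lt hfin.lt_top).ne
  -- the coefficients
  have coef : ∀ R ∈ Fintype.piFinset fun j => lowerDigits α (S j),
      walCoef f (fun j => R j ∪ S j) ^ 2 = (∏ j ∈ u \ v, M j) ^ 2 *
        (∫ z, H z * ∏ j : v, (W j (z j) * wal (insert (lead (S j)) (R j)) (z j)) ∂unif v) ^ 2 := by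
    intro R hR
    have hRm : ∀ j, R j ∈ lowerDigits α (S j) := fun j => Fintype.mem_piFinset.1 hR j
    have hRnv : ∀ j ∉ v, R j = ∅ := fun j hj => by
      have := hRm j
      rw [lowerDigits, if_neg (fun h => hj ((hvS j).2 h)), Finset.mem_singleton] at this
      exact this
    -- `E` collects the digits that stay as Walsh functions: the smallest leading digit and the
    -- lower ones in `v`, none elsewhere.
    set E : Fin s → Finset ℕ := fun j => if j ∈ v then insert (lead (S j)) (R j) else ∅ with hE
    have hET : ∀ j, R j ∪ S j = E j ∪ T j := fun j => by
      by_cases hj : j ∈ v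
      · simp only [hE, if_pos hj, hTv j hj]
        rw [Finset.insert_union, ← Finset.union_insert, Finset.insert_erase (lead_mem (hne j hj))]
      · simp only [hE, if_neg hj, hTnv j hj, hRnv j hj]
    have hElt : ∀ j, ∀ b ∈ E j, ∀ a ∈ T j, b < a := fun j b hb a ha => by
      by_cases hj : j ∈ v
      · simp only [hE, if_pos hj] at hb
        rw [hTv j hj, Finset.mem_erase] at ha
        rcases Finset.mem_insert.1 hb with rfl | hb
        · exact lt_of_le_of_ne (lead_le ha.2) ha.1.symm
        · exact lowerDigits_lt (hRm j) b hb a ha.2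
      · simp [hE, if_neg hj] at hb
    have hκ : ∀ j, R j ∪ S j ≠ ∅ ↔ j ∈ u := fun j => by
      rw [← hS j, Ne, Finset.union_eq_empty, not_and_or]
      refine ⟨fun h => h.elim (fun h h' => ?_) id, Or.inr⟩
      exact h (hRnv j fun hj => (Finset.nonempty_iff_ne_empty.1 (hne j hj)) h')
    have hprim : ∀ j, ∀ x, 0 ≤ x → walPrim (R j ∪ S j) (β j) x = W j x * wal (E j) x :=
      fun j x hx => by rw [hET j]; exact hWw j (E j) (hElt j) x hx
    rw [hGw _ hκ, hG.integral_walPrim _ β rfl hβα fun j => by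
      rw [hET j]; exact Finset.card_le_card Finset.subset_union_right]
    have e1 : ∫ x, G β x * ∏ j, walPrim (R j ∪ S j) (β j) (x j) ∂unif (Fin s) =
        ∫ x, G β x * ∏ j, (W j (x j) * wal (E j) (x j)) ∂unif (Fin s) := by
      refine integral_congr_ae ?_
      filter_upwards [ae_unif_mem (ι := Fin s)] with x hx
      rw [Finset.prod_congr rfl fun j _ => hprim j (x j) (hx j trivial).1]
    have hint : Integrable (fun x => G β x * ∏ j, (W j (x j) * wal (E j) (x j))) (unif (Fin s)) :=
      integrable_mul_prod hGc (φ := fun j y => W j y * wal (E j) y)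
        (fun j => (hWc j).measurable.mul (measurable_wal _)) (M := M) fun j x _ => by
          rw [abs_mul, abs_wal, mul_one, abs_of_nonneg (hWb j x).1]; exact (hWb j x).2
    set Ψ : (v → ℝ) → ℝ := fun z =>
      ∏ j : v, (W j (z j) * wal (insert (lead (S j)) (R j)) (z j)) with hΨ
    have hW1 : ∀ j ∉ u, ∀ y, 0 ≤ y → W j y = 1 := fun j hj y hy => by
      have h1 := hWw j ∅ (by simp) y hy
      rw [hTnv j (fun h => hj (hvu h)), hunot j hj] at h1
      simpa [walPrim, wal] using h1.symm
    have e2 : ∀ x : Fin s → ℝ, ∀ y ∈ cube (Fin s),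
        G β (v.piecewise x y) * ∏ j, (W j (v.piecewise x y j) * wal (E j) (v.piecewise x y j)) =
        (∏ j ∈ u \ v, M j) * Ψ (fun j => x j) *
          (G β (fun j => if h : j ∈ v then x j else y j) * ∏ j ∈ u \ v, ρ j (y j)) := by
      intro x y hy
      have e3 : (v.piecewise x y) = fun j => if h : j ∈ v then x j else y j := by
        funext j; by_cases h : j ∈ v <;> simp [h]
      have e4 : ∏ j, (W j (v.piecewise x y j) * wal (E j) (v.piecewise x y j)) =
          Ψ (fun j => x j) * ∏ j ∈ u \ v, W j (y j) := by
        rw [← Finset.prod_mul_prod_compl v]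
        congr 1
        · rw [← Finset.prod_coe_sort v]
          refine Finset.prod_congr rfl fun j _ => ?_
          simp [hE, j.2]
        · rw [← Finset.prod_subset (s₁ := u \ v) (s₂ := vᶜ)]
          · refine Finset.prod_congr rfl fun j hj => ?_
            have hjv := (Finset.mem_sdiff.1 hj).2
            simp [hE, hjv, wal]
          · intro j hj; exact Finset.mem_compl.2 (Finset.mem_sdiff.1 hj).2
          · intro j hj hju
            have hjv := Finset.mem_compl.1 hj
            have hju' : j ∉ u := fun h => hju (Finset.mem_sdiff.2 ⟨h, hjv⟩)
            simp [hE, hjv, wal, hW1 j hju' (y j) (hy j trivial).1]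
      have e5 : ∏ j ∈ u \ v, W j (y j) = (∏ j ∈ u \ v, M j) * ∏ j ∈ u \ v, ρ j (y j) := by
        rw [← Finset.prod_mul_distrib]
        refine Finset.prod_congr rfl fun j _ => ?_
        simp only [hρ]; rw [mul_div_cancel₀ _ (hMpos j).ne']
      rw [e4, e5, e3]; ring
    have e6 : ∫ x, G β x * ∏ j, (W j (x j) * wal (E j) (x j)) ∂unif (Fin s) =
        (∏ j ∈ u \ v, M j) * ∫ z, H z * Ψ z ∂unif v := by
      rw [integral_piecewise v hint]
      have e7 : ∀ x : Fin s → ℝ, ∫ y, G β (v.piecewise x y) *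
          ∏ j, (W j (v.piecewise x y j) * wal (E j) (v.piecewise x y j)) ∂unif (Fin s) =
          (∏ j ∈ u \ v, M j) * (H (fun j => x j) * Ψ (fun j => x j)) := by
        intro x
        rw [integral_congr_ae (g := fun y => (∏ j ∈ u \ v, M j) * Ψ (fun j => x j) *
          (G β (fun j => if h : j ∈ v then x j else y j) * ∏ j ∈ u \ v, ρ j (y j))),
          integral_const_mul]
        · simp only [hH]; ring
        · filter_upwards [ae_unif_mem (ι := Fin s)] with y hy using e2 x y hy
      simp only [e7, integral_const_mul]
      congr 1
      have mp := measurePreserving_restrict v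
      have hΨm : Measurable Ψ := Finset.measurable_fun_prod _ fun j _ =>
        ((hWc j).measurable.mul (measurable_wal _)).comp (measurable_pi_apply j)
      have := integral_map (μ := unif (Fin s)) mp.measurable.aemeasurable
        (f := fun z => H z * Ψ z)
        (hHc.measurable.mul hΨm).aestronglyMeasurable
      rw [mp.map_eq] at this
      exact this.symm
    rw [e1, e6, mul_pow, ← pow_mul, mul_comm _ 2, pow_mul, neg_one_sq, one_pow, one_mul, mul_pow]
  rw [Finset.sum_congr rfl coef, ← Finset.mul_sum]
  -- restriction to the coordinates in `v`
  have hsum : ∑ R ∈ Fintype.piFinset fun j => lowerDigits α (S j),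
      (∫ z, H z * ∏ j : v, (W j (z j) * wal (insert (lead (S j)) (R j)) (z j)) ∂unif v) ^ 2 ≤
      ∑ R ∈ Fintype.piFinset fun j : v => (Finset.range (lead (S j))).powerset,
        (∫ z, H z * ∏ j : v, (W j (z j) * wal (insert (lead (S j)) (R j)) (z j)) ∂unif v) ^ 2 := by
    -- Outside `v` the lower set is forced to be empty, so restricting to `v` loses nothing.
    have hinj : Set.InjOn (fun (R : Fin s → Finset ℕ) (j : v) => R j)
        (Fintype.piFinset fun j => lowerDigits α (S j) : Finset (Fin s → Finset ℕ)) := by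
      intro R hR R' hR' h
      have hRm := fun j => Fintype.mem_piFinset.1 (Finset.mem_coe.1 hR) j
      have hRm' := fun j => Fintype.mem_piFinset.1 (Finset.mem_coe.1 hR') j
      funext j
      by_cases hj : j ∈ v
      · exact congrFun h ⟨j, hj⟩
      · have h1 := hRm j
        have h2 := hRm' j
        rw [lowerDigits, if_neg (fun h => hj ((hvS j).2 h)), Finset.mem_singleton] at h1 h2
        rw [h1, h2]
    rw [← Finset.sum_image (f := fun R : v → Finset ℕ => (∫ z, H z * ∏ j : v, (W j (z j) *
      wal (insert (lead (S j)) (R j)) (z j)) ∂unif v) ^ 2) hinj]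
    refine Finset.sum_le_sum_of_subset_of_nonneg ?_ fun _ _ _ => sq_nonneg _
    intro R' hR'
    obtain ⟨R, hR, rfl⟩ := Finset.mem_image.1 hR'
    refine Fintype.mem_piFinset.2 fun j => ?_
    have := Fintype.mem_piFinset.1 hR j
    rwa [lowerDigits, if_pos ((hvS j).1 j.2)] at this
  have hcore := sum_sq_integral_le hHc hHfin (fun j : v => lead (S j)) (W := fun j => W j)
    (M := fun j => M j) (fun j => hWc j) (fun j => hWb j) fun j x => by
      refine hWp j _ (fun a ha => ?_) x
      rw [hTv j j.2, Finset.mem_erase] at ha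
      exact lt_of_le_of_ne (lead_le ha.2) ha.1.symm
  have hVle : (vitaliVar lam H).toReal ^ 2 ≤ (compVar α lam f u).toReal ^ 2 :=
    pow_le_pow_left₀ ENNReal.toReal_nonneg (ENNReal.toReal_mono hfin hHle) 2
  have hdec : (∏ j ∈ u \ v, M j) ^ 2 * ((∏ j : v, M j) ^ 2 *
      (∏ j : v, mesh (fun j : v => lead (S j)) j) ^ (2 * lam)) = (∏ j, decay α lam (S j)) ^ 2 := by
    have d1 : ∏ j, decay α lam (S j) =
        (∏ j, M j) * ∏ j, if j ∈ v then (((2 : ℝ) ^ (lead (S j) + 1))⁻¹) ^ lam else 1 := by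
      rw [← Finset.prod_mul_distrib]
      refine Finset.prod_congr rfl fun j _ => ?_
      simp only [decay, hM, hT, hvS]
    have d2 : ∏ j, M j = (∏ j : v, M j) * ∏ j ∈ u \ v, M j := by
      rw [← Finset.prod_mul_prod_compl v, Finset.prod_coe_sort v]
      congr 1
      refine (Finset.prod_subset (fun j hj => Finset.mem_compl.2 (Finset.mem_sdiff.1 hj).2)
        fun j hj hju => ?_).symm
      have hju' : j ∉ u := fun h => hju (Finset.mem_sdiff.2 ⟨h, Finset.mem_compl.1 hj⟩)
      simp only [hM, hTnv j (Finset.mem_compl.1 hj), hunot j hju', Finset.prod_empty]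
    have d3 : (∏ j, if j ∈ v then (((2 : ℝ) ^ (lead (S j) + 1))⁻¹) ^ lam else 1) ^ 2 =
        (∏ j : v, mesh (fun j : v => lead (S j)) j) ^ (2 * lam) := by
      rw [Finset.prod_ite_mem, Finset.univ_inter, ← Finset.prod_coe_sort v,
        Real.finsetProd_rpow _ _ fun j _ => by positivity]
      rw [mul_comm, Real.rpow_mul (Finset.prod_nonneg fun j _ => (mesh_pos _ j).le), Real.rpow_two]
      rfl
    rw [d1, d2, mul_pow, d3]; ring
  calc _ ≤ (∏ j ∈ u \ v, M j) ^ 2 * ((∏ j : v, M j) ^ 2 *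
        ((∏ j : v, mesh (fun j : v => lead (S j)) j) ^ (2 * lam) *
          (compVar α lam f u).toReal ^ 2)) := by
        gcongr
        refine hsum.trans (hcore.trans ?_)
        gcongr
        exact Real.rpow_nonneg (Finset.prod_nonneg fun j _ => (mesh_pos _ j).le) _
    _ = _ := by rw [← hdec]; ring

end Group

section Net

/-! ### Signs of binary digits -/

/-- The nontrivial character of the field with two elements. -/
def sgn (b : ZMod 2) : ℝ := if b = 0 then 1 else -1

lemma sgn_add (a b : ZMod 2) : sgn (a + b) = sgn a * sgn b := by
  have h : ∀ a : ZMod 2, a = 0 ∨ a = 1 := by decide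
  have h11 : (1 : ZMod 2) + 1 = 0 := by decide
  have h10 : (1 : ZMod 2) ≠ 0 := by decide
  rcases h a with rfl | rfl <;> rcases h b with rfl | rfl <;> simp [sgn, h11]

lemma sgn_sum {κ : Type*} (T : Finset κ) (g : κ → ZMod 2) :
    sgn (∑ k ∈ T, g k) = ∏ k ∈ T, sgn (g k) := by
  classical
  induction T using Finset.induction_on with
  | empty => simp [sgn]
  | insert a T ha ih => rw [Finset.sum_insert ha, Finset.prod_insert ha, sgn_add, ih]

lemma abs_sgn (b : ZMod 2) : |sgn b| = 1 := by unfold sgn; split_ifs <;> norm_num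

lemma sgn_mul_sgn (b : ZMod 2) : sgn b * sgn b = 1 := by unfold sgn; split_ifs <;> norm_num

lemma measurable_sgn : Measurable sgn := measurable_of_countable _

/-! ### Points given by binary digits -/

/-- The number in `[0,1]` with given binary digits. -/
def binPt (b : ℕ → ZMod 2) : ℝ := ∑' ℓ : ℕ, ((b ℓ).val : ℝ) / 2 ^ (ℓ + 1)

lemma val_le_one (b : ZMod 2) : ((b.val : ℕ) : ℝ) ≤ 1 := by
  have := ZMod.val_lt b
  exact_mod_cast (by omega : b.val ≤ 1)

lemma hasSum_tail (n : ℕ) : HasSum (fun ℓ : ℕ => (1 : ℝ) / 2 ^ (ℓ + n + 1)) ((2 ^ n)⁻¹) := by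
  have h := (hasSum_geometric_two' ((2 : ℝ) ^ n)⁻¹)
  refine h.congr_fun fun ℓ => ?_
  rw [pow_succ, pow_add]; field_simp

lemma summable_binPt (b : ℕ → ZMod 2) : Summable fun ℓ : ℕ => ((b ℓ).val : ℝ) / 2 ^ (ℓ + 1) := by
  refine Summable.of_nonneg_of_le (fun ℓ => by positivity) (fun ℓ => ?_) (hasSum_tail 0).summable
  simp only [add_zero]
  gcongr
  exact val_le_one _

lemma binPt_sub_mem (b : ℕ → ZMod 2) (n : ℕ) :
    binPt b - ∑ ℓ ∈ Finset.range n, ((b ℓ).val : ℝ) / 2 ^ (ℓ + 1) ∈ Set.Icc (0 : ℝ) ((2 ^ n)⁻¹) := by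
  have h := (summable_binPt b).sum_add_tsum_nat_add n
  have hs : Summable fun ℓ : ℕ => ((b (ℓ + n)).val : ℝ) / 2 ^ (ℓ + n + 1) :=
    (summable_nat_add_iff (f := fun ℓ : ℕ => ((b ℓ).val : ℝ) / 2 ^ (ℓ + 1)) n).2 (summable_binPt b)
  unfold binPt
  rw [← h, add_sub_cancel_left]
  refine ⟨tsum_nonneg fun ℓ => by positivity, ?_⟩
  rw [← (hasSum_tail n).tsum_eq]
  refine hs.tsum_le_tsum (fun ℓ => ?_) (hasSum_tail n).summable
  gcongr
  exact val_le_one _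

lemma binPt_mem (b : ℕ → ZMod 2) : binPt b ∈ Set.Icc (0 : ℝ) 1 := by
  simpa using binPt_sub_mem b 0

/-- Both numbers lie in the closed dyadic interval fixed by the first `n` entries of `b`. The
hypothesis refers to `b` rather than to the digits of `binPt b`, because these may differ when `b`
ends in ones. -/
lemma abs_sub_binPt_le {b : ℕ → ZMod 2} {y : ℝ} (hy : y ∈ Set.Ico (0 : ℝ) 1) {n : ℕ}
    (h : ∀ ℓ < n, rad ℓ y = sgn (b ℓ)) : |y - binPt b| ≤ (2 ^ n)⁻¹ := by
  have key : ∀ k ≤ n, (⌊(2 : ℝ) ^ k * y⌋ : ℝ) =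
      2 ^ k * ∑ ℓ ∈ Finset.range k, ((b ℓ).val : ℝ) / 2 ^ (ℓ + 1) := by
    intro k
    induction k with
    | zero =>
      intro _
      have : ⌊y⌋ = 0 := Int.floor_eq_zero_iff.2 hy
      simp [this]
    | succ k ih =>
      intro hk
      have e1 := ih (by omega)
      have e2 := h k (by omega)
      have fl : ⌊(2 : ℝ) ^ k * y⌋ = ⌊(2 : ℝ) ^ (k + 1) * y⌋ / (2 : ℕ) := by
        rw [← Int.floor_div_natCast]
        congr 1
        push_cast
        rw [pow_succ]
        field_simp
      have hb : ∀ a : ZMod 2, (a = 0 ∧ a.val = 0) ∨ (a ≠ 0 ∧ a.val = 1) := by decide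
      have e3 : (2 : ℝ) ^ (k + 1) * ∑ ℓ ∈ Finset.range (k + 1), ((b ℓ).val : ℝ) / 2 ^ (ℓ + 1) =
          2 * (⌊(2 : ℝ) ^ k * y⌋ : ℝ) + (b k).val := by
        rw [e1, Finset.sum_range_succ, mul_add, mul_div_cancel₀ _ (by positivity), pow_succ]; ring
      rw [e3, fl]
      unfold rad sgn at e2
      push_cast
      rcases hb (b k) with ⟨h0, hv⟩ | ⟨h0, hv⟩
      · rw [if_pos h0] at e2
        have hev : Even ⌊(2 : ℝ) ^ (k + 1) * y⌋ := by
          by_contra hcon; rw [if_neg hcon] at e2; norm_num at e2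
        obtain ⟨r, hr⟩ := hev
        rw [hv, hr]
        have : (r + r) / 2 = r := by omega
        rw [this]; push_cast; ring
      · rw [if_neg h0] at e2
        have hev : ¬ Even ⌊(2 : ℝ) ^ (k + 1) * y⌋ := by
          intro hcon; rw [if_pos hcon] at e2; norm_num at e2
        obtain ⟨r, hr⟩ := Int.not_even_iff_odd.1 hev
        rw [hv, hr]
        have : (2 * r + 1) / 2 = r := by omega
        rw [this]; push_cast; ring
  have hk := key n le_rfl
  have f1 := Int.floor_le ((2 : ℝ) ^ n * y)
  have f2 := Int.lt_floor_add_one ((2 : ℝ) ^ n * y)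
  rw [hk] at f1 f2
  have hp : (0 : ℝ) < 2 ^ n := by positivity
  have g1 := le_of_mul_le_mul_left f1 hp
  have g2 : y < (∑ ℓ ∈ Finset.range n, ((b ℓ).val : ℝ) / 2 ^ (ℓ + 1)) + (2 ^ n)⁻¹ := by
    refine lt_of_mul_lt_mul_left ?_ hp.le
    rw [mul_add, mul_inv_cancel₀ hp.ne']; exact f2
  have g3 := binPt_sub_mem b n
  rw [abs_le]
  constructor <;> linarith [g3.1, g3.2]

variable {s : ℕ}

/-! ### Truncated Walsh series as functions of the digits -/

/-- The Walsh function with digit sets `κ`, as a function of the binary digits. -/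
def wchar (κ : Fin s → Finset ℕ) (b : Shifts s) : ℝ := ∏ j, ∏ ℓ ∈ κ j, sgn (b j ℓ)

lemma wchar_add (κ : Fin s → Finset ℕ) (a b : Shifts s) :
    wchar κ (a + b) = wchar κ a * wchar κ b := by
  simp only [wchar, ← Finset.prod_mul_distrib, Pi.add_apply, sgn_add]

lemma abs_wchar (κ : Fin s → Finset ℕ) (b : Shifts s) : |wchar κ b| = 1 := by
  simp [wchar, Finset.abs_prod, abs_sgn]

/-- All digit sets with digits below `L`. -/
def digitSets (s L : ℕ) : Finset (Fin s → Finset ℕ) :=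
  Fintype.piFinset fun _ => (Finset.range L).powerset

/-- The truncated Walsh series at the point with given binary digits. -/
def walTrunc (f : (Fin s → ℝ) → ℝ) (L : ℕ) (b : Shifts s) : ℝ :=
  ∑ κ ∈ digitSets s L, walCoef f κ * wchar κ b

/-- The dyadic Dirichlet kernel. -/
def walKernel (L : ℕ) (b : Shifts s) (y : Fin s → ℝ) : ℝ :=
  ∏ j, ∏ ℓ ∈ Finset.range L, (1 + sgn (b j ℓ) * rad ℓ (y j))

lemma walKernel_eq (L : ℕ) (b : Shifts s) (y : Fin s → ℝ) :
    walKernel L b y = ∑ κ ∈ digitSets s L, mwal κ y * wchar κ b := by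
  unfold walKernel digitSets
  simp only [Finset.prod_one_add]
  rw [Finset.prod_univ_sum]
  refine Finset.sum_congr rfl fun κ _ => ?_
  simp only [mwal, wal, wchar, ← Finset.prod_mul_distrib]
  exact Finset.prod_congr rfl fun j _ => Finset.prod_congr rfl fun ℓ _ => mul_comm _ _

lemma walKernel_nonneg (L : ℕ) (b : Shifts s) (y : Fin s → ℝ) : 0 ≤ walKernel L b y := by
  refine Finset.prod_nonneg fun j _ => Finset.prod_nonneg fun ℓ _ => ?_
  have h : |sgn (b j ℓ) * rad ℓ (y j)| = 1 := by rw [abs_mul, abs_sgn, abs_rad, mul_one]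
  linarith [neg_abs_le (sgn (b j ℓ) * rad ℓ (y j))]

lemma walCoef_const_one (κ : Fin s → Finset ℕ) [Decidable (κ = fun _ => ∅)] :
    walCoef (fun _ => 1) κ = if κ = fun _ => ∅ then 1 else 0 := by
  unfold walCoef
  simp only [one_mul]
  split_ifs with h
  · subst h; simp [mwal, wal]
  · refine integral_mwal κ ?_
    by_contra hcon
    push Not at hcon
    exact h (funext hcon)

lemma empty_mem_digitSets (L : ℕ) : (fun _ => ∅ : Fin s → Finset ℕ) ∈ digitSets s L :=
  Fintype.mem_piFinset.2 fun _ => Finset.mem_powerset.2 (Finset.empty_subset _)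

lemma walTrunc_eq_integral {f : (Fin s → ℝ) → ℝ} (hf : Continuous f) (L : ℕ) (b : Shifts s) :
    Integrable (fun y => f y * walKernel L b y) (unif (Fin s)) ∧
    walTrunc f L b = ∫ y, f y * walKernel L b y ∂unif (Fin s) := by
  have e : ∀ y, f y * walKernel L b y = ∑ κ ∈ digitSets s L, (f y * mwal κ y) * wchar κ b := fun y => by
    rw [walKernel_eq, Finset.mul_sum]
    exact Finset.sum_congr rfl fun κ _ => by ring
  simp only [e]
  refine ⟨integrable_finsetSum _ fun κ _ => (integrable_mul_mwal hf κ).mul_const _, ?_⟩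
  rw [integral_finsetSum _ fun κ _ => (integrable_mul_mwal hf κ).mul_const _]
  simp only [integral_mul_const]
  rfl

/-- The truncated series averages `f` against a nonnegative kernel of total mass 1, supported on
points sharing the first `L` digits with `b`; uniform continuity does the rest. Working with digit
sequences gives a bound for every shift, including those producing dyadic points. -/
lemma abs_walTrunc_sub_le {f : (Fin s → ℝ) → ℝ} (hf : ContinuousOn f (cube (Fin s))) {ε : ℝ}
    (hε : 0 < ε) : ∃ L, ∀ b : Shifts s, |walTrunc f L b - f (fun j => binPt (b j))| ≤ ε := by
  classical
  have huc := isCompact_cube.uniformContinuousOn_of_continuous hf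
  obtain ⟨δ, hδ, hfδ⟩ := Metric.uniformContinuousOn_iff.1 huc ε hε
  obtain ⟨L, hL⟩ := exists_pow_lt_of_lt_one hδ (by norm_num : (1 / 2 : ℝ) < 1)
  refine ⟨L, fun b => ?_⟩
  set x : Fin s → ℝ := fun j => binPt (b j) with hx
  have hxc : x ∈ cube (Fin s) := fun j _ => binPt_mem (b j)
  set g : (Fin s → ℝ) → ℝ := fun x => f (clamp x) with hg
  have hgc : Continuous g := continuous_comp_clamp hf
  have hfg : walTrunc f L b = walTrunc g L b :=
    Finset.sum_congr rfl fun κ _ => by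
      rw [walCoef_congr (f := f) (g := g) fun y hy => by simp only [hg, clamp_of_mem hy]]
  obtain ⟨hi1, h1⟩ := walTrunc_eq_integral (s := s) (continuous_const (y := (1 : ℝ))) L b
  obtain ⟨hig, hgi⟩ := walTrunc_eq_integral hgc L b
  have hone : walTrunc (s := s) (fun _ => 1) L b = 1 := by
    unfold walTrunc
    simp only [walCoef_const_one, ite_mul, one_mul, zero_mul]
    rw [Finset.sum_ite_eq' (digitSets s L) (fun _ => ∅) fun κ => wchar κ b,
      if_pos (empty_mem_digitSets L)]
    simp [wchar]
  have e : walTrunc f L b - f x = ∫ y, (g y - f x) * (1 * walKernel L b y) ∂unif (Fin s) := by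
    have : ∀ y, (g y - f x) * (1 * walKernel L b y) =
        g y * walKernel L b y - f x * (1 * walKernel L b y) := fun y => by ring
    simp only [this]
    rw [integral_sub hig (hi1.const_mul _), integral_const_mul, ← hgi, ← h1, hone, hfg, mul_one]
  rw [e]
  calc |∫ y, (g y - f x) * (1 * walKernel L b y) ∂unif (Fin s)|
      ≤ ∫ y, ε * (1 * walKernel L b y) ∂unif (Fin s) := by
        rw [← Real.norm_eq_abs]
        refine norm_integral_le_of_norm_le (hi1.const_mul ε) ?_
        have hI : ∀ᵐ y ∂unif (Fin s), y ∈ Set.univ.pi fun _ : Fin s => Set.Ico (0 : ℝ) 1 := by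
          rw [unif_eq_Ico]
          exact ae_restrict_mem (MeasurableSet.univ_pi fun _ => measurableSet_Ico)
        filter_upwards [hI] with y hy
        rw [norm_mul, one_mul, Real.norm_eq_abs, Real.norm_eq_abs, abs_of_nonneg (walKernel_nonneg L b y)]
        by_cases hk : walKernel L b y = 0
        · simp [hk]
        · refine mul_le_mul_of_nonneg_right ?_ (walKernel_nonneg L b y)
          have hyc : y ∈ cube (Fin s) := fun j _ => ⟨(hy j trivial).1, (hy j trivial).2.le⟩
          simp only [hg, clamp_of_mem hyc]
          refine (hfδ y hyc x hxc ?_).le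
          rw [dist_pi_lt_iff hδ]
          intro j
          rw [Real.dist_eq]
          refine (abs_sub_binPt_le (hy j trivial) (n := L) fun ℓ hℓ => ?_).trans_lt ?_
          · have h2 := Finset.prod_ne_zero_iff.1 (Finset.prod_ne_zero_iff.1 hk j (Finset.mem_univ j))
              ℓ (Finset.mem_range.2 hℓ)
            unfold rad sgn at h2 ⊢
            split_ifs at h2 ⊢ <;> first | rfl | norm_num at h2
          · simpa using hL
    _ = ε := by rw [integral_const_mul, ← h1, hone, mul_one]

/-! ### The digital net -/

variable {m : ℕ}

/-- The digits of the points of the unshifted net. -/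
def netDigits (A : GenMatrices s m) (i : ℕ) : Shifts s := fun j ℓ =>
  ∑ c : Fin m, A j ℓ c * indexDigit i c

lemma netPoint_eq (A : GenMatrices s m) (D : Shifts s) (i : ℕ) :
    netPoint A D i = fun j => binPt ((netDigits A i + D) j) := rfl

/-- The event that the Walsh function with digit sets `κ` is constant on the net. -/
def dualEvent (m : ℕ) (κ : Fin s → Finset ℕ) : Set (GenMatrices s m) :=
  {A | ∀ c : Fin m, ∑ j, ∑ ℓ ∈ κ j, A j ℓ c = 0}

/-- The bits of the index range freely over all binary vectors, so the sum factorizes; the induction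
splits off the top bit. -/
lemma sum_prod_testBit {m : ℕ} (e : Fin m → ℝ) :
    ∑ i ∈ Finset.range (2 ^ m), ∏ c : Fin m, (if i.testBit c then e c else 1) =
      ∏ c, (1 + e c) := by
  induction m with
  | zero => simp
  | succ m ih =>
    have hsplit : (2 : ℕ) ^ (m + 1) = 2 ^ m + 2 ^ m := by rw [pow_succ]; ring
    rw [hsplit, Finset.sum_range_add, Fin.prod_univ_castSucc, mul_add, mul_one,
      ← ih fun c => e c.castSucc, Finset.sum_mul]
    congr 1
    · refine Finset.sum_congr rfl fun i hi => ?_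
      rw [Fin.prod_univ_castSucc]
      have : i.testBit m = false := Nat.testBit_lt_two_pow (Finset.mem_range.1 hi)
      simp [this]
    · refine Finset.sum_congr rfl fun i hi => ?_
      rw [Fin.prod_univ_castSucc]
      have : i.testBit m = false := Nat.testBit_lt_two_pow (Finset.mem_range.1 hi)
      have h2 : ∀ c : Fin m, (2 ^ m + i).testBit c = i.testBit c := fun c =>
        Nat.testBit_two_pow_add_gt c.2 i
      simp [Nat.testBit_two_pow_add_eq, this, h2]

-- A sum of a character over a group: the Walsh function on the unshifted net is a character of the
-- index bits, trivial exactly on the dual event.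
open Classical in
lemma sum_wchar_netDigits (κ : Fin s → Finset ℕ) (A : GenMatrices s m) :
    ∑ i ∈ Finset.range (2 ^ m), wchar κ (netDigits A i) =
      2 ^ m * if A ∈ dualEvent m κ then 1 else 0 := by
  have e : ∀ i, wchar κ (netDigits A i) =
      ∏ c : Fin m, if i.testBit c then sgn (∑ j, ∑ ℓ ∈ κ j, A j ℓ c) else 1 := by
    intro i
    have e1 : wchar κ (netDigits A i) = sgn (∑ c : Fin m, (∑ j, ∑ ℓ ∈ κ j, A j ℓ c) * indexDigit i c) := by
      unfold wchar netDigits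
      simp only [Finset.sum_mul]
      rw [Finset.sum_comm, sgn_sum]
      refine Finset.prod_congr rfl fun j _ => ?_
      rw [Finset.sum_comm, sgn_sum]
    rw [e1, sgn_sum]
    refine Finset.prod_congr rfl fun c _ => ?_
    unfold indexDigit
    split_ifs
    · rw [mul_one]
    · simp [sgn]
  simp only [e]
  rw [sum_prod_testBit]
  split_ifs with h
  · simp only [dualEvent, Set.mem_ofPred_eq] at h
    simp [h, sgn]
    norm_num
  · simp only [dualEvent, Set.mem_ofPred_eq, not_forall] at h
    obtain ⟨c, hc⟩ := h
    rw [mul_zero]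
    refine Finset.prod_eq_zero (Finset.mem_univ c) ?_
    simp [sgn, hc]

open Classical in
/-- The deviation of the truncated Walsh series on the shifted net from its integral. -/
def truncDev (f : (Fin s → ℝ) → ℝ) (T : Finset (Fin s → Finset ℕ)) (A : GenMatrices s m)
    (D : Shifts s) : ℝ :=
  ∑ κ ∈ T, walCoef f κ * (if A ∈ dualEvent m κ then 1 else 0) * wchar κ D

/-- Averaging the truncated series over the net keeps only dual digit sets, and the empty one
contributes the integral. The uniform truncation error is inherited by the average. -/
lemma abs_netMean_sub_le {f : (Fin s → ℝ) → ℝ} {L : ℕ} {ε : ℝ}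
    (h : ∀ b : Shifts s, |walTrunc f L b - f (fun j => binPt (b j))| ≤ ε)
    [DecidableEq (Fin s → Finset ℕ)] (A : GenMatrices s m) (D : Shifts s) :
    |netMean f A D - cubeIntegral f - truncDev f ((digitSets s L).erase fun _ => ∅) A D| ≤ ε := by
  classical
  have e1 : cubeIntegral f + truncDev f ((digitSets s L).erase fun _ => ∅) A D =
      (∑ i ∈ Finset.range (2 ^ m), walTrunc f L (netDigits A i + D)) / 2 ^ m := by
    have e2 : ∑ i ∈ Finset.range (2 ^ m), walTrunc f L (netDigits A i + D) =
        2 ^ m * truncDev f (digitSets s L) A D := by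
      unfold walTrunc truncDev
      rw [Finset.sum_comm, Finset.mul_sum]
      refine Finset.sum_congr rfl fun κ _ => ?_
      simp only [wchar_add]
      rw [← Finset.mul_sum, ← Finset.sum_mul, sum_wchar_netDigits]
      ring
    rw [e2, mul_div_cancel_left₀ _ (by positivity)]
    unfold truncDev
    rw [← Finset.add_sum_erase _ _ (empty_mem_digitSets L)]
    congr 1
    have h1 : A ∈ dualEvent m (fun _ => ∅ : Fin s → Finset ℕ) := by simp [dualEvent]
    simp [h1, wchar, walCoef, mwal, wal, cubeIntegral, integral_cube_eq]
  have e3 : netMean f A D - cubeIntegral f - truncDev f ((digitSets s L).erase fun _ => ∅) A D =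
      (∑ i ∈ Finset.range (2 ^ m), (f (netPoint A D i) - walTrunc f L (netDigits A i + D))) / 2 ^ m := by
    rw [Finset.sum_sub_distrib, sub_div, ← e1]; unfold netMean; ring
  rw [e3, abs_div, abs_of_pos (by positivity : (0 : ℝ) < 2 ^ m), div_le_iff₀ (by positivity)]
  refine (Finset.abs_sum_le_sum_abs _ _).trans ?_
  calc _ ≤ ∑ i ∈ Finset.range (2 ^ m), ε := Finset.sum_le_sum fun i _ => by
        rw [abs_sub_comm, netPoint_eq]; exact h _
    _ = _ := by simp; ring

/-! ### The variance -/

instance : IsProbabilityMeasure (shiftLaw s) := by unfold shiftLaw; infer_instance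

lemma integral_sgn : ∫ b, sgn b ∂(PMF.uniformOfFintype (ZMod 2)).toMeasure = 0 := by
  rw [PMF.integral_eq_sum]
  have : (Finset.univ : Finset (ZMod 2)) = {0, 1} := by decide
  rw [this, Finset.sum_pair (by decide)]
  simp [sgn]

lemma integral_wchar (κ : Fin s → Finset ℕ) (h : ∃ j, κ j ≠ ∅) : ∫ D, wchar κ D ∂shiftLaw s = 0 := by
  obtain ⟨j, hj⟩ := h
  unfold shiftLaw wchar
  rw [integral_fintype_prod_eq_prod (f := fun j (D : ℕ → ZMod 2) => ∏ ℓ ∈ κ j, sgn (D ℓ))]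
  refine Finset.prod_eq_zero (Finset.mem_univ j) ?_
  have hm : AEStronglyMeasurable (fun y : κ j → ZMod 2 => ∏ ℓ, sgn (y ℓ))
      (Measure.pi fun _ : κ j => (PMF.uniformOfFintype (ZMod 2)).toMeasure) :=
    (measurable_of_countable _).aestronglyMeasurable
  have := integral_restrict_infinitePi (fun _ : ℕ => (PMF.uniformOfFintype (ZMod 2)).toMeasure) hm
  rw [integral_fintype_prod_eq_prod (f := fun _ b => sgn b)] at this
  obtain ⟨ℓ, hℓ⟩ := Finset.nonempty_iff_ne_empty.2 hj
  rw [Finset.prod_eq_zero (Finset.mem_univ (⟨ℓ, hℓ⟩ : κ j)) integral_sgn] at this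
  rw [← this]
  refine integral_congr_ae (Filter.Eventually.of_forall fun D => ?_)
  exact (Finset.prod_coe_sort (κ j) fun ℓ => sgn (D ℓ)).symm

lemma measurable_wchar (κ : Fin s → Finset ℕ) : Measurable (wchar κ) :=
  Finset.measurable_fun_prod _ fun j _ => Finset.measurable_fun_prod _ fun ℓ _ =>
    measurable_sgn.comp ((measurable_pi_apply ℓ).comp (measurable_pi_apply j))

lemma wchar_mul_wchar (κ κ' : Fin s → Finset ℕ) (D : Shifts s) :
    wchar κ D * wchar κ' D = wchar (fun j => symmDiff (κ j) (κ' j)) D := by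
  unfold wchar
  rw [← Finset.prod_mul_distrib]
  refine Finset.prod_congr rfl fun j _ => ?_
  simp only
  rw [← Finset.prod_sdiff (Finset.inter_subset_left : κ j ∩ κ' j ⊆ κ j),
    ← Finset.prod_sdiff (Finset.inter_subset_right : κ j ∩ κ' j ⊆ κ' j),
    Finset.sdiff_inter_self_left, Finset.sdiff_inter_self_right,
    symmDiff_def, Finset.sup_eq_union, Finset.prod_union
      (Finset.disjoint_left.2 fun a ha hb => (Finset.mem_sdiff.1 hb).2 (Finset.mem_sdiff.1 ha).1)]
  have : (∏ ℓ ∈ κ j ∩ κ' j, sgn (D j ℓ)) * ∏ ℓ ∈ κ j ∩ κ' j, sgn (D j ℓ) = 1 := by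
    rw [← Finset.prod_mul_distrib]; exact Finset.prod_eq_one fun ℓ _ => sgn_mul_sgn _
  linear_combination (∏ i ∈ κ j \ κ' j, sgn (D j i)) * (∏ i ∈ κ' j \ κ j, sgn (D j i)) * this

lemma integral_wchar_mul (κ κ' : Fin s → Finset ℕ) [Decidable (κ = κ')] :
    ∫ D, wchar κ D * wchar κ' D ∂shiftLaw s = if κ = κ' then 1 else 0 := by
  simp only [wchar_mul_wchar]
  split_ifs with h
  · subst h
    simp [wchar]
  · refine integral_wchar _ ?_
    by_contra hcon
    push Not at hcon
    exact h (funext fun i => symmDiff_eq_bot.1 (hcon i))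

lemma measurableSet_dualEvent (κ : Fin s → Finset ℕ) : MeasurableSet (dualEvent m κ) := by
  have : dualEvent m κ = ⋂ c : Fin m, {A | ∑ j, ∑ ℓ ∈ κ j, A j ℓ c = 0} := by
    ext A; simp [dualEvent]
  rw [this]
  refine MeasurableSet.iInter fun c => ?_
  have hm : Measurable fun A : GenMatrices s m => ∑ j, ∑ ℓ ∈ κ j, A j ℓ c :=
    Finset.measurable_fun_sum _ fun j _ => Finset.measurable_fun_sum _ fun ℓ _ =>
      (measurable_pi_apply c).comp ((measurable_pi_apply ℓ).comp (measurable_pi_apply j))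
  exact hm (measurableSet_singleton 0)

lemma measurable_truncDev (f : (Fin s → ℝ) → ℝ) (T : Finset (Fin s → Finset ℕ)) :
    Measurable fun ω : GenMatrices s m × Shifts s => truncDev f T ω.1 ω.2 := by
  classical
  unfold truncDev
  refine Finset.measurable_fun_sum _ fun κ _ => Measurable.mul (Measurable.mul measurable_const ?_)
    ((measurable_wchar κ).comp measurable_snd)
  exact Measurable.ite (measurable_fst (measurableSet_dualEvent κ)) measurable_const measurable_const

/-- For fixed matrices, distinct Walsh characters are orthogonal under the digital shift.
Covariances vanish whatever the joint law `P` of the matrices. -/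
lemma integral_truncDev_sq (f : (Fin s → ℝ) → ℝ) (T : Finset (Fin s → Finset ℕ))
    (P : Measure (GenMatrices s m)) [IsProbabilityMeasure P] :
    Integrable (fun ω : GenMatrices s m × Shifts s => truncDev f T ω.1 ω.2 ^ 2)
      (P.prod (shiftLaw s)) ∧
    ∫ ω, truncDev f T ω.1 ω.2 ^ 2 ∂P.prod (shiftLaw s) =
      ∑ κ ∈ T, walCoef f κ ^ 2 * P.real (dualEvent m κ) := by
  classical
  have hb : ∀ A D, |truncDev (m := m) f T A D| ≤ ∑ κ ∈ T, |walCoef f κ| := fun A D => by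
    refine (Finset.abs_sum_le_sum_abs _ _).trans (Finset.sum_le_sum fun κ _ => ?_)
    rw [abs_mul, abs_mul, abs_wchar, mul_one]
    refine mul_le_of_le_one_right (abs_nonneg _) ?_
    split_ifs <;> norm_num
  have hint : Integrable (fun ω : GenMatrices s m × Shifts s => truncDev f T ω.1 ω.2 ^ 2)
      (P.prod (shiftLaw s)) := by
    refine Integrable.of_bound ((measurable_truncDev f T).pow_const 2).aestronglyMeasurable
      ((∑ κ ∈ T, |walCoef f κ|) ^ 2) (Filter.Eventually.of_forall fun ω => ?_)
    rw [norm_pow]; exact pow_le_pow_left₀ (norm_nonneg _) (hb _ _) 2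
  refine ⟨hint, ?_⟩
  rw [integral_prod _ hint]
  have inner : ∀ A, ∫ D, truncDev (m := m) f T A D ^ 2 ∂shiftLaw s =
      ∑ κ ∈ T, walCoef f κ ^ 2 * (dualEvent m κ).indicator (fun _ => (1 : ℝ)) A := by
    intro A
    set c : (Fin s → Finset ℕ) → ℝ := fun κ =>
      walCoef f κ * (if A ∈ dualEvent m κ then 1 else 0) with hc
    have e : ∀ D, truncDev (m := m) f T A D ^ 2 =
        ∑ κ ∈ T, ∑ κ' ∈ T, c κ * c κ' * (wchar κ D * wchar κ' D) := fun D => by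
      have : truncDev (m := m) f T A D = ∑ κ ∈ T, c κ * wchar κ D := rfl
      rw [this, sq, Finset.sum_mul_sum]
      exact Finset.sum_congr rfl fun κ _ => Finset.sum_congr rfl fun κ' _ => by ring
    have hi : ∀ κ κ' : Fin s → Finset ℕ, Integrable (fun D => c κ * c κ' * (wchar κ D * wchar κ' D))
        (shiftLaw s) := fun κ κ' => by
      refine Integrable.const_mul (Integrable.of_bound
        ((measurable_wchar κ).mul (measurable_wchar κ')).aestronglyMeasurable 1
        (Filter.Eventually.of_forall fun D => ?_)) _
      rw [Real.norm_eq_abs, Pi.mul_apply, abs_mul, abs_wchar, abs_wchar, mul_one]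
    simp only [e]
    rw [integral_finsetSum _ fun κ _ => integrable_finsetSum _ fun κ' _ => hi κ κ']
    refine Finset.sum_congr rfl fun κ hκ => ?_
    rw [integral_finsetSum _ fun κ' _ => hi κ κ']
    simp only [integral_const_mul, integral_wchar_mul, mul_ite, mul_one, mul_zero]
    rw [Finset.sum_ite_eq, if_pos hκ]
    simp only [hc]
    by_cases h : A ∈ dualEvent m κ <;> simp [h, sq]
  simp only [inner]
  have hind : ∀ κ : Fin s → Finset ℕ, Integrable ((dualEvent m κ).indicator fun _ => (1 : ℝ)) P :=
    fun κ => (integrable_const 1).indicator (measurableSet_dualEvent κ)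
  rw [integral_finsetSum _ fun κ _ => (hind κ).const_mul _]
  refine Finset.sum_congr rfl fun κ _ => ?_
  rw [integral_const_mul, integral_indicator_const _ (measurableSet_dualEvent κ), smul_eq_mul, mul_one]

/-- The tail of the deviation: a union bound over the digit sets in `K`, Markov's inequality for
the other ones. -/
lemma measureReal_truncDev_le (f : (Fin s → ℝ) → ℝ) (T : Finset (Fin s → Finset ℕ))
    (K : (Fin s → Finset ℕ) → Prop) [DecidablePred K]
    (P : Measure (GenMatrices s m)) [IsProbabilityMeasure P] {B : ℝ} (hB : 0 < B) :
    (P.prod (shiftLaw s)).real {ω | B ≤ truncDev f T ω.1 ω.2 ^ 2} ≤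
      ∑ κ ∈ T, P.real (dualEvent m κ) * if K κ then 1 else walCoef f κ ^ 2 / B := by
  classical
  set μ := P.prod (shiftLaw s) with hμ
  have hsub : {ω : GenMatrices s m × Shifts s | B ≤ truncDev f T ω.1 ω.2 ^ 2} ⊆
      (⋃ κ ∈ T.filter K, (dualEvent m κ) ×ˢ (Set.univ : Set (Shifts s))) ∪
        {ω | B ≤ truncDev f (T.filter fun κ => ¬ K κ) ω.1 ω.2 ^ 2} := by
    intro ω hω
    by_cases h : ∃ κ ∈ T.filter K, ω.1 ∈ dualEvent m κ
    · obtain ⟨κ, hκ, h⟩ := h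
      exact Or.inl (Set.mem_iUnion₂.2 ⟨κ, hκ, h, trivial⟩)
    · right
      push Not at h
      have : truncDev f T ω.1 ω.2 = truncDev f (T.filter fun κ => ¬ K κ) ω.1 ω.2 := by
        unfold truncDev
        rw [← Finset.sum_filter_add_sum_filter_not T K, Finset.sum_eq_zero, zero_add]
        intro κ hκ
        rw [if_neg (h κ hκ)]; ring
      rw [Set.mem_ofPred_eq, ← this]; exact hω
  refine (measureReal_mono hsub).trans ((measureReal_union_le _ _).trans ?_)
  rw [← Finset.sum_filter_add_sum_filter_not T K]
  refine add_le_add ((measureReal_biUnion_finset_le _ _).trans (Finset.sum_le_sum fun κ hκ => ?_)) ?_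
  · rw [if_pos (Finset.mem_filter.1 hκ).2, mul_one, hμ, measureReal_prod_prod]
    simp
  · have hmk := mul_meas_ge_le_integral_of_nonneg
      (Filter.Eventually.of_forall fun ω => sq_nonneg _)
      (integral_truncDev_sq f (T.filter fun κ => ¬ K κ) P).1 B
    rw [(integral_truncDev_sq f (T.filter fun κ => ¬ K κ) P).2] at hmk
    rw [← le_div_iff₀' hB] at hmk
    refine hmk.trans (le_of_eq ?_)
    rw [Finset.sum_div]
    refine Finset.sum_congr rfl fun κ hκ => ?_
    rw [if_neg (Finset.mem_filter.1 hκ).2]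
    ring

end Net

/-! ### Digit weights and the probability of a dual digit set -/

section Weights

/-- All of `D` lies above `R`, so the decreasing list starts with `D` and the first `d` entries are
`D` itself. The shift by 1 converts 0-based digits to positions. -/
lemma topSum_image_succ {d : ℕ} {R D : Finset ℕ} (hlt : ∀ b ∈ R, ∀ a ∈ D, b < a)
    (hD : D.card = d ∨ R = ∅ ∧ D.card ≤ d) :
    topSum d ((R ∪ D).image (· + 1)) = ∑ a ∈ D, (a + 1) := by
  have hinj : Function.Injective (· + 1 : ℕ → ℕ) := add_left_injective 1
  set D' := D.image (· + 1) with hD'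
  set R' := R.image (· + 1) with hR'
  have hlt' : ∀ b ∈ R', ∀ a ∈ D', b < a := by
    intro b hb a ha
    obtain ⟨b', hb', rfl⟩ := Finset.mem_image.1 hb
    obtain ⟨a', ha', rfl⟩ := Finset.mem_image.1 ha
    simpa using hlt b' hb' a' ha'
  have hdis : Disjoint R' D' := Finset.disjoint_left.2 fun b hb hb' => lt_irrefl b (hlt' b hb b hb')
  have hcard : D'.card = D.card := Finset.card_image_of_injective _ hinj
  have hsort : (R' ∪ D').sort (· ≥ ·) = D'.sort (· ≥ ·) ++ R'.sort (· ≥ ·) := by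
    refine List.Perm.eq_of_pairwise (le := fun a b : ℕ => a ≥ b) ?_
      (Finset.pairwise_sort _ _) ?_ ?_
    · intro a b _ _ h1 h2; exact le_antisymm h2 h1
    · refine List.pairwise_append.2 ⟨Finset.pairwise_sort _ _, Finset.pairwise_sort _ _, ?_⟩
      intro a ha b hb
      exact (hlt' b ((Finset.mem_sort _).1 hb) a ((Finset.mem_sort _).1 ha)).le
    · refine (List.perm_ext_iff_of_nodup (Finset.sort_nodup _ _) ?_).2 fun a => ?_
      · refine List.nodup_append.2 ⟨Finset.sort_nodup _ _, Finset.sort_nodup _ _, ?_⟩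
        intro a ha b hb hab
        subst hab
        exact Finset.disjoint_left.1 hdis ((Finset.mem_sort _).1 hb) ((Finset.mem_sort _).1 ha)
      · simp [or_comm]
  have hsum : (D'.sort (· ≥ ·)).sum = ∑ a ∈ D, (a + 1) := by
    have : (D'.sort (· ≥ ·)).sum = ∑ a ∈ D', a := by
      rw [(Finset.sort_perm_toList D' (· ≥ ·)).sum_eq]
      simp
    rw [this, hD', Finset.sum_image fun a _ b _ h => hinj h]
  unfold topSum
  rw [Finset.image_union, hsort]
  rcases hD with hD | ⟨hR, hD⟩
  · rw [List.take_left' (by rw [Finset.length_sort, hcard, hD]), hsum]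
  · have : R' = ∅ := by rw [hR', hR]; rfl
    rw [this, Finset.sort_empty, List.append_nil, List.take_of_length_le, hsum]
    rw [Finset.length_sort, hcard]; exact hD

/-- The sum of the `d` largest digit positions, in terms of 0-based digits. -/
def topWt (d : ℕ) (τ : Finset ℕ) : ℕ := topSum d (τ.image (· + 1))

lemma exists_topWt_split (d : ℕ) (τ : Finset ℕ) : ∃ R D : Finset ℕ, R ∪ D = τ ∧
    (∀ b ∈ R, ∀ a ∈ D, b < a) ∧ (D.card = d ∨ R = ∅ ∧ D.card ≤ d) ∧
    topWt d τ = ∑ a ∈ D, (a + 1) := by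
  rcases le_total d τ.card with h | h
  · obtain ⟨R, D, h1, h2, h3⟩ := exists_top_split τ d h
    refine ⟨R, D, h1, h3, Or.inl h2, ?_⟩
    rw [topWt, ← h1, topSum_image_succ h3 (Or.inl h2)]
  · refine ⟨∅, τ, by simp, by simp, Or.inr ⟨rfl, h⟩, ?_⟩
    have := topSum_image_succ (R := ∅) (D := τ) (d := d) (by simp) (Or.inr ⟨rfl, h⟩)
    rwa [Finset.empty_union] at this

/-- If lower digits are present, `τ` has `α + 1 > d` elements above them, so the top `d` digits lie
in `τ`. The probability bound is therefore constant on a group. -/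
lemma topWt_union {d α : ℕ} (hdα : d ≤ α) {τ R : Finset ℕ} (hR : R ∈ lowerDigits α τ) :
    topWt d (R ∪ τ) = topWt d τ := by
  have hlt := lowerDigits_lt hR
  by_cases hc : τ.card = α + 1
  · obtain ⟨R', D, h1, h2, h3⟩ := exists_top_split τ d (by omega)
    unfold topWt
    have e : R ∪ τ = (R ∪ R') ∪ D := by rw [← h1, Finset.union_assoc]
    rw [e, topSum_image_succ (R := R ∪ R') ?_ (Or.inl h2)]
    · rw [← h1, topSum_image_succ h3 (Or.inl h2)]
    · intro b hb a ha
      rcases Finset.mem_union.1 hb with hb | hb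
      · exact hlt b hb a (h1 ▸ Finset.mem_union_right _ ha)
      · exact h3 b hb a ha
  · rw [lowerDigits, if_neg hc, Finset.mem_singleton] at hR
    rw [hR, Finset.empty_union]

lemma card_lowerDigits (α : ℕ) (τ : Finset ℕ) :
    (lowerDigits α τ).card = if τ.card = α + 1 then 2 ^ lead τ else 1 := by
  unfold lowerDigits
  split_ifs <;> simp

/-- The combined weight of a set of leading digits decays geometrically in all its elements. -/
lemma weight_le {α d : ℕ} {lam θ t η δ : ℝ} (hdα : d ≤ α) (ht1 : t ≤ 1)
    (hθ0 : 0 ≤ θ) (hδ0 : 0 < δ) (hδ1 : δ ≤ 2 * t - θ) (hδ2 : δ ≤ 2 * η * t)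
    (hθd : θ * d = t * (2 * (α + lam) + 1 - 2 * η) - 1)
    (τ : Finset ℕ) :
    (2 : ℝ) ^ (θ * topWt d τ) * decay α lam τ ^ (2 * t) *
      ((lowerDigits α τ).card : ℝ) ^ (1 - t) ≤
      ∏ a ∈ τ, ((2 : ℝ) ^ (-(δ / (α + 1)))) ^ (a + 1) := by
  obtain ⟨R, D, hRD, hlt, hDc, hw⟩ := exists_topWt_split d τ
  have hdis : Disjoint R D := Finset.disjoint_left.2 fun b hb hb' => lt_irrefl b (hlt b hb b hb')
  have hα1 : (0 : ℝ) < α + 1 := by positivity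
  have h2 : (0 : ℝ) < 2 := two_pos
  have hprod : ∀ T : Finset ℕ, ∏ a ∈ T, ((2 : ℝ) ^ (a + 1))⁻¹ =
      (2 : ℝ) ^ (-∑ a ∈ T, ((a : ℝ) + 1)) := fun T => by
    rw [← Finset.sum_neg_distrib, Real.rpow_sum_of_pos h2]
    refine Finset.prod_congr rfl fun a _ => ?_
    rw [Real.rpow_neg h2.le]
    congr 1
    exact_mod_cast (Real.rpow_natCast 2 (a + 1)).symm
  have hrhs : ∏ a ∈ τ, ((2 : ℝ) ^ (-(δ / (α + 1)))) ^ (a + 1) =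
      (2 : ℝ) ^ (-(δ / (α + 1)) * ∑ a ∈ τ, ((a : ℝ) + 1)) := by
    rw [Finset.mul_sum, Real.rpow_sum_of_pos h2]
    refine Finset.prod_congr rfl fun a _ => ?_
    rw [← Real.rpow_natCast, ← Real.rpow_mul h2.le]; push_cast; rfl
  rw [hrhs]
  have hw' : (topWt d τ : ℝ) = ∑ a ∈ D, ((a : ℝ) + 1) := by rw [hw]; push_cast; rfl
  have hsumτ : ∑ a ∈ τ, ((a : ℝ) + 1) = ∑ a ∈ R, ((a : ℝ) + 1) + ∑ a ∈ D, ((a : ℝ) + 1) := by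
    rw [← hRD, Finset.sum_union hdis]
  have hpos : ∀ T : Finset ℕ, 0 ≤ ∑ a ∈ T, ((a : ℝ) + 1) := fun T =>
    Finset.sum_nonneg fun a _ => by positivity
  by_cases hc : τ.card = α + 1
  · have hne : τ.Nonempty := by rw [← Finset.card_pos, hc]; omega
    set l : ℝ := (lead τ : ℝ) + 1 with hl
    have hl0 : 0 < l := by positivity
    have hdec : decay α lam τ = (2 : ℝ) ^ (-(∑ a ∈ τ.erase (lead τ), ((a : ℝ) + 1)) - lam * l) := by
      rw [decay, ibpPart, if_pos hc, if_pos hc, hprod, sub_eq_add_neg, Real.rpow_add h2]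
      congr 1
      rw [← Real.rpow_natCast, ← Real.rpow_neg h2.le, ← Real.rpow_mul h2.le]
      push_cast
      congr 1
      ring
    have hlow : ((lowerDigits α τ).card : ℝ) = (2 : ℝ) ^ (lead τ : ℝ) := by
      rw [card_lowerDigits, if_pos hc]; push_cast; rw [Real.rpow_natCast]
    rw [hdec, hlow, ← Real.rpow_mul h2.le, ← Real.rpow_mul h2.le, ← Real.rpow_add h2,
      ← Real.rpow_add h2]
    refine Real.rpow_le_rpow_of_exponent_le one_le_two ?_
    -- `D` has `d` elements and does not contain the smallest element
    have hDd : D.card = d := by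
      rcases hDc with h | ⟨h, h'⟩
      · exact h
      · rw [h, Finset.empty_union] at hRD; rw [hRD, hc] at h'; omega
    have hRc : R.card = α + 1 - d := by
      have := Finset.card_union_of_disjoint hdis
      rw [hRD, hc, hDd] at this; omega
    have hRne : R.Nonempty := by rw [← Finset.card_pos, hRc]; omega
    have hleadR : lead τ ∈ R := by
      have h1 := lead_mem hne
      rw [← hRD] at h1
      rcases Finset.mem_union.1 h1 with h | h
      · rw [← hRD]; exact h
      · obtain ⟨b, hb⟩ := hRne
        have h3 := hlt b hb _ h
        have h4 := lead_le (τ := τ) (by rw [← hRD]; exact Finset.mem_union_left _ hb : b ∈ τ)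
        rw [← hRD] at h4
        omega
    set Q := R.erase (lead τ) with hQ
    have hQc : Q.card = α - d := by rw [hQ, Finset.card_erase_of_mem hleadR, hRc]; omega
    have hRQ : ∑ a ∈ R, ((a : ℝ) + 1) = l + ∑ a ∈ Q, ((a : ℝ) + 1) :=
      (Finset.add_sum_erase R (fun a : ℕ => (a : ℝ) + 1) hleadR).symm
    have hτerase : ∑ a ∈ τ.erase (lead τ), ((a : ℝ) + 1) =
        ∑ a ∈ Q, ((a : ℝ) + 1) + ∑ a ∈ D, ((a : ℝ) + 1) := by
      have := Finset.add_sum_erase τ (fun a : ℕ => (a : ℝ) + 1) (lead_mem hne)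
      rw [hsumτ, hRQ] at this
      simp only [hl] at this
      linarith
    set SD := ∑ a ∈ D, ((a : ℝ) + 1) with hSD
    set SQ := ∑ a ∈ Q, ((a : ℝ) + 1) with hSQ
    have hge : ∀ a ∈ τ, l ≤ (a : ℝ) + 1 := fun a ha => by
      have : (lead τ : ℝ) ≤ a := by exact_mod_cast lead_le ha
      simp only [hl]; linarith
    have hSDl : (d : ℝ) * l ≤ SD := by
      rw [← hDd, ← nsmul_eq_mul]
      exact Finset.card_nsmul_le_sum D _ _ fun a ha =>
        hge a (by rw [← hRD]; exact Finset.mem_union_right _ ha)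
    have hSQl : ((α : ℝ) - d) * l ≤ SQ := by
      rw [← Nat.cast_sub hdα, ← hQc, ← nsmul_eq_mul]
      exact Finset.card_nsmul_le_sum Q _ _ fun a ha =>
        hge a (by rw [← hRD]; exact Finset.mem_union_left _ (Finset.mem_of_mem_erase ha))
    rw [hw', hsumτ, hRQ, hτerase]
    have hlead : (lead τ : ℝ) ≤ l := by simp only [hl]; linarith
    have b1 : (lead τ : ℝ) * (1 - t) ≤ l * (1 - t) :=
      mul_le_mul_of_nonneg_right hlead (by linarith)
    -- excess over the smallest element
    have xD : 0 ≤ SD - d * l := by linarith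
    have xQ : 0 ≤ SQ - (α - d) * l := by linarith
    have g1 : δ * (SD - d * l) ≤ (2 * t - θ) * (SD - d * l) := mul_le_mul_of_nonneg_right hδ1 xD
    have g2 : δ * (SQ - (α - d) * l) ≤ 2 * t * (SQ - (α - d) * l) :=
      mul_le_mul_of_nonneg_right (by linarith) xQ
    have g3 : δ * l ≤ 2 * η * t * l := mul_le_mul_of_nonneg_right hδ2 hl0.le
    have g4 : θ * d * l = (t * (2 * (α + lam) + 1 - 2 * η) - 1) * l := by rw [hθd]
    -- Each position in `τ` is `l` plus an excess. With no excess the exponent is at most `-2 * η *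
    -- t * l` by `hθd`. Excess in `D` enters with coefficient `θ - 2 * t`, excess in `Q` with `-2 *
    -- t`, both at most `-δ`.
    have up : θ * SD + (-(SQ + SD) - lam * l) * (2 * t) + (lead τ : ℝ) * (1 - t) ≤
        -δ * ((SD - d * l) + (SQ - (α - d) * l) + l) := by
      linarith
    refine up.trans ?_
    -- The total of the positions is `(α + 1) * l` plus the excesses, so spreading the decay over
    -- all of `τ` costs at most the factor `α + 1`.
    have fin : δ / (α + 1) * (l + SQ + SD) ≤ δ * ((SD - d * l) + (SQ - (α - d) * l) + l) := by
      rw [div_mul_eq_mul_div, div_le_iff₀ hα1, mul_assoc]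
      refine mul_le_mul_of_nonneg_left ?_ hδ0.le
      have h0 : (0 : ℝ) ≤ α := by positivity
      have := mul_nonneg h0 (add_nonneg xD xQ)
      linarith
    linarith
  · have hdec : decay α lam τ = (2 : ℝ) ^ (-∑ a ∈ τ, ((a : ℝ) + 1)) := by
      rw [decay, ibpPart, if_neg hc, if_neg hc, hprod, mul_one]
    have hlow : ((lowerDigits α τ).card : ℝ) = 1 := by
      rw [card_lowerDigits, if_neg hc]; norm_num
    rw [hdec, hlow, Real.one_rpow, mul_one, ← Real.rpow_mul h2.le, ← Real.rpow_add h2]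
    refine Real.rpow_le_rpow_of_exponent_le one_le_two ?_
    rw [hw']
    have h1 : ∑ a ∈ D, ((a : ℝ) + 1) ≤ ∑ a ∈ τ, ((a : ℝ) + 1) := by rw [hsumτ]; linarith [hpos R]
    set X := ∑ a ∈ τ, ((a : ℝ) + 1) with hX
    have hX0 : 0 ≤ X := hpos τ
    have g1 : θ * ∑ a ∈ D, ((a : ℝ) + 1) ≤ θ * X := mul_le_mul_of_nonneg_left h1 hθ0
    have g2 : δ / (α + 1) * X ≤ (2 * t - θ) * X := by
      refine mul_le_mul_of_nonneg_right (le_trans ?_ hδ1) hX0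
      exact div_le_self hδ0.le (by have : (0 : ℝ) ≤ α := by positivity
                                   linarith)
    linarith

variable {s m : ℕ}

open Classical in
/-- The coordinates with a nonempty digit set. -/
def digitSupp (κ : Fin s → Finset ℕ) : Finset (Fin s) := Finset.univ.filter fun j => κ j ≠ ∅

lemma mem_digitSupp {κ : Fin s → Finset ℕ} {j : Fin s} : j ∈ digitSupp κ ↔ κ j ≠ ∅ := by
  simp [digitSupp]

/-- The indicator of `a > b` is at most `2^(θ * (a - b))` for `θ ≥ 0`. This trades the threshold for
a quantity that factorizes over coordinates. -/
lemma SchemeBound.measureReal_dualEvent_le {P : Measure (GenMatrices s m)} {d : ℕ}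
    {tu : Finset (Fin s) → ℕ} (h : SchemeBound P d tu) {κ : Fin s → Finset ℕ}
    (hκ : (digitSupp κ).Nonempty) {θ : ℝ} (hθ : 0 ≤ θ) :
    P.real (dualEvent m κ) ≤ (2 : ℝ) ^ (-((m : ℝ) - tu (digitSupp κ)) +
      θ * (∑ j ∈ digitSupp κ, (topWt d (κ j) : ℝ) - d * (m - tu (digitSupp κ)))) := by
  classical
  set k : Fin s → ℕ := fun j => Finset.equivBitIndices.symm (κ j) with hk
  have hkκ : ∀ j, (k j).bitIndices.toFinset = κ j := fun j =>
    Finset.equivBitIndices.apply_symm_apply (κ j)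
  have hpos : ∀ j, bitPos (k j) = (κ j).image (· + 1) := fun j => by rw [bitPos, hkκ]
  have hk0 : ∀ j, k j ≠ 0 ↔ κ j ≠ ∅ := fun j => by
    refine not_congr ⟨fun h => ?_, fun h => ?_⟩
    · rw [← hkκ j, h]; simp
    · have h0 : Finset.equivBitIndices 0 = ∅ := by simp [Finset.equivBitIndices]
      rw [hk]; simp only; rw [h, ← h0, Equiv.symm_apply_apply]
  have hsupp : supp k = digitSupp κ := by
    ext j; rw [mem_digitSupp, ← hk0]; simp [supp]
  have hev : zEvent (m := m) k = dualEvent m κ := by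
    ext A
    simp only [zEvent, dualEvent, Set.mem_ofPred_eq]
    refine forall_congr' fun c => ?_
    have : ∀ j, ∑ ℓ ∈ bitPos (k j), A j (ℓ - 1) c = ∑ ℓ ∈ κ j, A j ℓ c := fun j => by
      rw [hpos, Finset.sum_image fun a _ b _ h => add_left_injective 1 h]
      simp
    simp only [this]
  have hkne : k ≠ 0 := by
    obtain ⟨j, hj⟩ := hκ
    intro h0
    exact (hk0 j).2 (mem_digitSupp.1 hj) (congrFun h0 j)
  have key := h k hkne
  rw [hev, hsupp] at key
  refine key.trans ?_
  set T : ℕ := ∑ j ∈ digitSupp κ, topSum d (bitPos (k j)) with hT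
  have hT' : ∑ j ∈ digitSupp κ, (topWt d (κ j) : ℝ) = (T : ℝ) := by
    rw [hT]; push_cast
    exact Finset.sum_congr rfl fun j _ => by rw [hpos]; rfl
  rw [hT', Real.rpow_add two_pos]
  have e1 : (2 : ℝ) ^ (-(m : ℤ) + (tu (digitSupp κ) : ℤ)) =
      (2 : ℝ) ^ (-((m : ℝ) - tu (digitSupp κ))) := by
    rw [← Real.rpow_intCast]; push_cast; congr 1; ring
  rw [e1]
  refine mul_le_mul_of_nonneg_left ?_ (by positivity)
  split_ifs with hlt
  · refine Real.one_le_rpow one_le_two (mul_nonneg hθ ?_)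
    have : (d : ℝ) * (m - tu (digitSupp κ)) < T := by exact_mod_cast hlt
    linarith
  · positivity

/-- Every digit set is an admissible lower set joined with its leading digits. -/
lemma exists_leading (α : ℕ) (κ : Finset ℕ) : ∃ τ : Finset ℕ, τ ⊆ κ ∧ τ.card ≤ α + 1 ∧
    (τ = ∅ ↔ κ = ∅) ∧ ∃ R ∈ lowerDigits α τ, κ = R ∪ τ := by
  rcases le_total κ.card (α + 1) with h | h
  · refine ⟨κ, subset_rfl, h, Iff.rfl, ∅, ?_, by simp⟩
    unfold lowerDigits; split_ifs <;> simp
  · obtain ⟨R, τ, h1, h2, h3⟩ := exists_top_split κ (α + 1) h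
    have hτ : τ.Nonempty := by rw [← Finset.card_pos]; omega
    refine ⟨τ, h1 ▸ Finset.subset_union_right, h2.le, ⟨fun h0 => ?_, fun h0 => ?_⟩, R, ?_, h1.symm⟩
    · exact absurd h0 (Finset.nonempty_iff_ne_empty.1 hτ)
    · rw [h0, Finset.card_empty] at h; omega
    · rw [lowerDigits, if_pos h2]
      exact Finset.mem_powerset.2 fun b hb => Finset.mem_range.2 (h3 b hb _ (lead_mem hτ))

end Weights

/-! ### Summing the cost of all groups, uniformly in the dimension -/

section Summation

variable {s m : ℕ}

lemma decay_nonneg (α : ℕ) (lam : ℝ) (τ : Finset ℕ) : 0 ≤ decay α lam τ := by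
  unfold decay
  split_ifs <;> positivity

/-- The digit sets sharing their leading digits: their total contribution to the tail bound is at
most a geometric mean of the union bound and the variance bound. -/
lemma sum_fiber_le {α d : ℕ} {lam : ℝ} (hdα : d ≤ α) {f : (Fin s → ℝ) → ℝ}
    (hf : IsMixedSmooth α f) {S : Fin s → Finset ℕ} (hS : (digitSupp S).Nonempty)
    (hfin : compVar α lam f (digitSupp S) ≠ ∞) (hcard : ∀ j, (S j).card ≤ α + 1)
    {P : Measure (GenMatrices s m)} {tu : Finset (Fin s) → ℕ} (hP : SchemeBound P d tu)
    {θ e B : ℝ} (hθ : 0 ≤ θ) (he0 : 0 < e) (he1 : e ≤ 1) (hB : 0 < B)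
    {F : Finset (Fin s → Finset ℕ)}
    (hF : ∀ κ ∈ F, ∃ R : Fin s → Finset ℕ, (∀ j, R j ∈ lowerDigits α (S j)) ∧
      κ = fun j => R j ∪ S j)
    {n X : ℝ} (hn : n = ∏ j, ((lowerDigits α (S j)).card : ℝ))
    (hX : X = (∏ j, decay α lam (S j)) ^ 2 * (compVar α lam f (digitSupp S)).toReal ^ 2 / B)
    {K : Prop} [Decidable K] (hK : K ↔ n ≤ X) :
    ∑ κ ∈ F, P.real (dualEvent m κ) * (if K then 1 else walCoef f κ ^ 2 / B) ≤
      (2 : ℝ) ^ (-((m : ℝ) - tu (digitSupp S)) +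
        θ * (∑ j ∈ digitSupp S, (topWt d (S j) : ℝ) - d * (m - tu (digitSupp S)))) *
      (n ^ (1 - e) * X ^ e) := by
  classical
  set q : ℝ := (2 : ℝ) ^ (-((m : ℝ) - tu (digitSupp S)) +
        θ * (∑ j ∈ digitSupp S, (topWt d (S j) : ℝ) - d * (m - tu (digitSupp S)))) with hq
  have hq0 : 0 ≤ q := by positivity
  set I := Fintype.piFinset fun j => lowerDigits α (S j) with hI
  have hsub : F ⊆ I.image fun R j => R j ∪ S j := fun κ hκ => by
    obtain ⟨R, hR, rfl⟩ := hF κ hκ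
    exact Finset.mem_image.2 ⟨R, Fintype.mem_piFinset.2 hR, rfl⟩
  have hinj : Set.InjOn (fun (R : Fin s → Finset ℕ) j => R j ∪ S j) I := by
    intro R hR R' hR' h
    funext j
    have hd : ∀ R ∈ I, Disjoint (R j) (S j) := fun R hR => Finset.disjoint_left.2 fun b hb hb' =>
      lt_irrefl b (lowerDigits_lt (Fintype.mem_piFinset.1 hR j) b hb b hb')
    have h1 := congrFun h j
    simp only at h1
    rw [← Finset.union_sdiff_cancel_right (hd R hR), h1,
      Finset.union_sdiff_cancel_right (hd R' hR')]
  have hprob : ∀ κ ∈ F, P.real (dualEvent m κ) ≤ q := fun κ hκ => by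
    obtain ⟨R, hR, rfl⟩ := hF κ hκ
    have hsupp : digitSupp (fun j => R j ∪ S j) = digitSupp S := by
      ext j
      rw [mem_digitSupp, mem_digitSupp]
      refine ⟨fun h h0 => h ?_, fun h h0 => h (Finset.union_eq_empty.1 h0).2⟩
      have h1 := hR j
      rw [lowerDigits, h0, if_neg (by simp), Finset.mem_singleton] at h1
      simp [h1, h0]
    have h1 := hP.measureReal_dualEvent_le (κ := fun j => R j ∪ S j) (hsupp ▸ hS) hθ
    rw [hsupp] at h1
    simpa only [topWt_union hdα (hR _)] using h1
  have hn1 : 1 ≤ n := by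
    rw [hn]
    refine Finset.one_le_prod fun j _ => ?_
    rw [card_lowerDigits]
    split_ifs
    · exact_mod_cast Nat.one_le_two_pow
    · simp
  have hn0 : 0 < n := by linarith
  have hX0 : 0 ≤ X := by rw [hX]; positivity
  have hcardF : (F.card : ℝ) ≤ n := by
    refine (Nat.cast_le.2 ((Finset.card_le_card hsub).trans Finset.card_image_le)).trans ?_
    rw [hI, Fintype.card_piFinset, hn]; push_cast; rfl
  -- Here `n` bounds the number of digit sets and `X` their total squared coefficient divided by
  -- `B`. Both branches use that the smaller of `n` and `X` is at most `n^(1-e) * X^e`.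
  by_cases hc : K
  · simp only [if_pos hc, mul_one]
    have h1 : n ≤ n ^ (1 - e) * X ^ e := by
      calc n = n ^ (1 - e) * n ^ e := by rw [← Real.rpow_add hn0, sub_add_cancel, Real.rpow_one]
        _ ≤ _ := by
          refine mul_le_mul_of_nonneg_left ?_ (by positivity)
          exact Real.rpow_le_rpow hn0.le (hK.1 hc) he0.le
    calc _ ≤ ∑ κ ∈ F, q := Finset.sum_le_sum hprob
      _ = F.card * q := by rw [Finset.sum_const, nsmul_eq_mul]
      _ ≤ n * q := mul_le_mul_of_nonneg_right hcardF hq0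
      _ ≤ _ := by rw [mul_comm]; exact mul_le_mul_of_nonneg_left h1 hq0
  · simp only [if_neg hc]
    have hXn : X ≤ n := by rw [hK] at hc; exact (not_le.1 hc).le
    have h1 : X ≤ n ^ (1 - e) * X ^ e := by
      rcases hX0.eq_or_lt with h | h
      · rw [← h]; positivity
      calc X = X ^ (1 - e) * X ^ e := by rw [← Real.rpow_add h, sub_add_cancel, Real.rpow_one]
        _ ≤ _ := by
          refine mul_le_mul_of_nonneg_right ?_ (by positivity)
          exact Real.rpow_le_rpow h.le hXn (by linarith)
    have h2 : ∑ κ ∈ F, walCoef f κ ^ 2 / B ≤ X := by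
      rw [← Finset.sum_div, hX]
      refine div_le_div_of_nonneg_right ?_ hB.le
      refine (Finset.sum_le_sum_of_subset_of_nonneg hsub fun _ _ _ => sq_nonneg _).trans ?_
      rw [Finset.sum_image hinj]
      exact sum_walCoef_sq_le hf hS.ne_empty hfin (fun j => mem_digitSupp.symm) hcard
    calc _ ≤ ∑ κ ∈ F, q * (walCoef f κ ^ 2 / B) := Finset.sum_le_sum fun κ hκ =>
          mul_le_mul_of_nonneg_right (hprob κ hκ) (by positivity)
      _ = q * ∑ κ ∈ F, walCoef f κ ^ 2 / B := by rw [Finset.mul_sum]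
      _ ≤ _ := mul_le_mul_of_nonneg_left (h2.trans h1) hq0

/-- The contribution of a family of leading digits factorizes over the coordinates. -/
lemma fiber_cost_le {α d : ℕ} {lam θ e η δ : ℝ} (hdα : d ≤ α) (he0 : 0 < e) (he1 : e ≤ 1)
    (hlam : 0 ≤ α + lam)
    (hθ0 : 0 ≤ θ) (hδ0 : 0 < δ) (hδ1 : δ ≤ 2 * e - θ) (hδ2 : δ ≤ 2 * η * e) (hη : 0 ≤ η)
    (hθd : θ * d = e * (2 * (α + lam) + 1 - 2 * η) - 1)
    {γ t : ℕ → ℝ} (hγ : ∀ j, 0 ≤ γ j) {S : Fin s → Finset ℕ} {tu : ℕ}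
    (htu : (tu : ℝ) ≤ ∑ j ∈ digitSupp S, t j) {C F V : ℝ} (hC : 0 < C) (hF : 0 < F) (hV0 : 0 ≤ V)
    (hV : V ≤ F * ∏ j ∈ digitSupp S, γ j) {n X : ℝ}
    (hn : n = ∏ j, ((lowerDigits α (S j)).card : ℝ))
    (hX : X = (∏ j, decay α lam (S j)) ^ 2 * V ^ 2 /
      (C * F ^ 2 * (2 : ℝ) ^ (-((2 * α + 2 * lam + 1 - 2 * η) * m)))) :
    (2 : ℝ) ^ (-((m : ℝ) - tu) +
        θ * (∑ j ∈ digitSupp S, (topWt d (S j) : ℝ) - d * (m - tu))) * (n ^ (1 - e) * X ^ e) ≤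
      C ^ (-e) * ∏ j, ((if S j = ∅ then 1 else
        γ j ^ (2 * e) * (2 : ℝ) ^ (e * (2 * (α + lam) + 1) * t j)) *
        ∏ a ∈ S j, ((2 : ℝ) ^ (-(δ / (α + 1)))) ^ (a + 1)) := by
  have h2 : (0 : ℝ) < 2 := two_pos
  set u := digitSupp S with hu
  set Γ := ∏ j ∈ u, γ j with hΓ
  have hΓ0 : 0 ≤ Γ := Finset.prod_nonneg fun j _ => hγ j
  have hdecay : 0 ≤ ∏ j, decay α lam (S j) := Finset.prod_nonneg fun j _ => decay_nonneg _ _ _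
  set Dc := ∏ j, decay α lam (S j) with hDc
  set ρ := e * (2 * (α + lam) + 1 - 2 * η) with hρ
  have hn0 : 0 ≤ n := hn ▸ Finset.prod_nonneg fun j _ => Nat.cast_nonneg _
  have hX0 : 0 ≤ X := hX ▸ div_nonneg (by positivity) (by positivity)
  have hXle : X ≤ (Dc * Γ) ^ 2 * (C⁻¹ * (2 : ℝ) ^ ((2 * α + 2 * lam + 1 - 2 * η) * m)) := by
    rw [hX, Real.rpow_neg h2.le, div_le_iff₀ (by positivity)]
    have : V ^ 2 ≤ (F * Γ) ^ 2 := pow_le_pow_left₀ hV0 hV 2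
    calc Dc ^ 2 * V ^ 2 ≤ Dc ^ 2 * (F * Γ) ^ 2 := mul_le_mul_of_nonneg_left this (sq_nonneg _)
      _ = _ := by
        have hF2 : F ^ 2 ≠ 0 := by positivity
        have hr : (2 : ℝ) ^ ((2 * α + 2 * lam + 1 - 2 * η) * m) ≠ 0 := by positivity
        generalize (2 : ℝ) ^ ((2 * α + 2 * lam + 1 - 2 * η) * m) = r at *
        rw [mul_pow, mul_pow]
        field_simp
  have hXe : X ^ e ≤ Dc ^ (2 * e) * Γ ^ (2 * e) * (C ^ (-e) * (2 : ℝ) ^ (ρ * m)) := by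
    refine (Real.rpow_le_rpow hX0 hXle he0.le).trans (le_of_eq ?_)
    rw [Real.mul_rpow (by positivity) (by positivity), Real.mul_rpow (by positivity) (by positivity),
      Real.inv_rpow hC.le, ← Real.rpow_neg hC.le, ← Real.rpow_mul h2.le, mul_pow,
      Real.mul_rpow (by positivity) (by positivity), ← Real.rpow_natCast, ← Real.rpow_natCast,
      ← Real.rpow_mul hdecay, ← Real.rpow_mul hΓ0]
    push_cast
    congr 3
    rw [hρ]; ring
  have htop : ∑ j ∈ u, (topWt d (S j) : ℝ) = ∑ j, (topWt d (S j) : ℝ) := by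
    refine Finset.sum_subset (Finset.subset_univ _) fun j _ hj => ?_
    have : S j = ∅ := by by_contra h; exact hj (mem_digitSupp.2 h)
    rw [this]; simp [topWt, topSum]
  -- By `hθd`, `1 + θ * d = ρ`. The factor `2^(-ρ * m)` from the probability thus cancels `2^(ρ *
  -- m)` from the threshold in `X^e`.
  have hexp : -((m : ℝ) - tu) + θ * (∑ j ∈ u, (topWt d (S j) : ℝ) - d * (m - tu)) =
      ∑ j, θ * (topWt d (S j) : ℝ) + (ρ * tu - ρ * m) := by
    rw [htop, ← Finset.mul_sum]
    linear_combination (tu - m : ℝ) * hθd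
  have hw : ∀ j, (2 : ℝ) ^ (θ * topWt d (S j)) * decay α lam (S j) ^ (2 * e) *
      ((lowerDigits α (S j)).card : ℝ) ^ (1 - e) ≤
      ∏ a ∈ S j, ((2 : ℝ) ^ (-(δ / (α + 1)))) ^ (a + 1) := fun j =>
    weight_le hdα he1 hθ0 hδ0 hδ1 hδ2 hθd (S j)
  have hprodw : (2 : ℝ) ^ (∑ j, θ * (topWt d (S j) : ℝ)) * Dc ^ (2 * e) * n ^ (1 - e) ≤
      ∏ j, ∏ a ∈ S j, ((2 : ℝ) ^ (-(δ / (α + 1)))) ^ (a + 1) := by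
    rw [Real.rpow_sum_of_pos h2, hDc, hn,
      ← Real.finsetProd_rpow _ _ fun j _ => decay_nonneg α lam (S j),
      ← Real.finsetProd_rpow _ _ fun j _ => Nat.cast_nonneg _, ← Finset.prod_mul_distrib,
      ← Finset.prod_mul_distrib]
    exact Finset.prod_le_prod (fun j _ => mul_nonneg (mul_nonneg (by positivity)
      (Real.rpow_nonneg (decay_nonneg _ _ _) _)) (by positivity)) fun j _ => hw j
  have hite : ∏ j, (if S j = ∅ then 1 else
        γ j ^ (2 * e) * (2 : ℝ) ^ (e * (2 * (α + lam) + 1) * t j)) =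
      Γ ^ (2 * e) * (2 : ℝ) ^ (e * (2 * (α + lam) + 1) * ∑ j ∈ u, t j) := by
    rw [hΓ, ← Real.finsetProd_rpow u (fun j => γ j) fun j _ => hγ j, Finset.mul_sum, Real.rpow_sum_of_pos h2,
      ← Finset.prod_mul_distrib, hu, digitSupp, Finset.prod_filter]
    refine Finset.prod_congr rfl fun j _ => ?_
    split_ifs <;> simp_all
  -- The `η` part of `ρ` is dropped using `tu ≥ 0`, before replacing `tu` by the sum of the `t j`,
  -- which could be negative termwise.
  have htu' : (2 : ℝ) ^ (ρ * tu) ≤ (2 : ℝ) ^ (e * (2 * (α + lam) + 1) * ∑ j ∈ u, t j) := by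
    refine Real.rpow_le_rpow_of_exponent_le one_le_two ?_
    have h1 : e * (2 * (α + lam) + 1) * tu ≤ e * (2 * (α + lam) + 1) * ∑ j ∈ u, t j :=
      mul_le_mul_of_nonneg_left htu (by positivity)
    have h3 : 0 ≤ e * (2 * η) * tu := by positivity
    rw [hρ]; linarith
  rw [Finset.prod_mul_distrib, hite, hexp, Real.rpow_add h2, Real.rpow_sub h2]
  set W := (2 : ℝ) ^ (∑ j, θ * (topWt d (S j) : ℝ))
  have hW : 0 ≤ W := by positivity
  calc W * ((2 : ℝ) ^ (ρ * tu) / (2 : ℝ) ^ (ρ * m)) * (n ^ (1 - e) * X ^ e)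
      ≤ W * ((2 : ℝ) ^ (ρ * tu) / (2 : ℝ) ^ (ρ * m)) *
        (n ^ (1 - e) * (Dc ^ (2 * e) * Γ ^ (2 * e) * (C ^ (-e) * (2 : ℝ) ^ (ρ * m)))) := by
        gcongr
    _ = C ^ (-e) * (Γ ^ (2 * e) * (2 : ℝ) ^ (ρ * tu) * (W * Dc ^ (2 * e) * n ^ (1 - e))) := by
        have : (2 : ℝ) ^ (ρ * m) ≠ 0 := by positivity
        field_simp
    _ ≤ _ := by
        refine mul_le_mul_of_nonneg_left ?_ (by positivity)
        exact mul_le_mul (mul_le_mul_of_nonneg_left htu' (by positivity)) hprodw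
          (by positivity) (by positivity)

lemma sum_powerset_le {x : ℝ} (hx0 : 0 ≤ x) (hx1 : x < 1) (L : ℕ) :
    ∑ τ ∈ (Finset.range L).powerset, ∏ a ∈ τ, x ^ (a + 1) ≤ Real.exp (1 - x)⁻¹ := by
  rw [← Finset.prod_one_add]
  calc ∏ a ∈ Finset.range L, (1 + x ^ (a + 1)) ≤ ∏ a ∈ Finset.range L, Real.exp (x ^ (a + 1)) :=
        Finset.prod_le_prod (fun a _ => by positivity) fun a _ => by
          rw [add_comm]; exact Real.add_one_le_exp _
    _ = Real.exp (∑ a ∈ Finset.range L, x ^ (a + 1)) := (Real.exp_sum _ _).symm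
    _ ≤ _ := by
        refine Real.exp_le_exp.2 ?_
        rw [← tsum_geometric_of_lt_one hx0 hx1]
        refine (Finset.sum_le_sum fun a _ => ?_).trans
          ((summable_geometric_of_lt_one hx0 hx1).sum_le_tsum _ fun a _ => by positivity)
        exact pow_le_pow_of_le_one hx0 hx1.le (Nat.le_succ a)

/-- The sum is a product over coordinates. An empty set contributes 1 and the nonempty ones at most
a constant times `g j`, so each factor is bounded by an exponential whose exponents are summable. -/
lemma sum_digitSets_le {x : ℝ} (hx0 : 0 ≤ x) (hx1 : x < 1) {g : ℕ → ℝ} (hg : ∀ j, 0 ≤ g j)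
    (hsum : Summable g) (L : ℕ) :
    ∑ S ∈ digitSets s L, ∏ j, ((if S j = ∅ then 1 else g j) * ∏ a ∈ S j, x ^ (a + 1)) ≤
      Real.exp (Real.exp (1 - x)⁻¹ * ∑' j, g j) := by
  unfold digitSets
  rw [← Finset.prod_univ_sum (fun _ : Fin s => (Finset.range L).powerset)
    fun j τ => (if τ = ∅ then 1 else g j) * ∏ a ∈ τ, x ^ (a + 1)]
  have h1 : ∀ j : Fin s, ∑ τ ∈ (Finset.range L).powerset,
      (if τ = ∅ then 1 else g j) * ∏ a ∈ τ, x ^ (a + 1) ≤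
      Real.exp (Real.exp (1 - x)⁻¹ * g j) := fun j => by
    have hle : ∀ τ ∈ (Finset.range L).powerset,
        (if τ = ∅ then 1 else g j) * ∏ a ∈ τ, x ^ (a + 1) ≤
        (if τ = ∅ then 1 else 0) + (∏ a ∈ τ, x ^ (a + 1)) * g j := fun τ _ => by
      split_ifs with h
      · subst h; simpa using hg j
      · rw [zero_add, mul_comm]
    refine (Finset.sum_le_sum hle).trans ?_
    rw [Finset.sum_add_distrib, Finset.sum_ite_eq' , if_pos (Finset.empty_mem_powerset _),
      ← Finset.sum_mul, add_comm]
    exact (add_le_add_left (mul_le_mul_of_nonneg_right (sum_powerset_le hx0 hx1 L) (hg j)) 1).trans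
      (Real.add_one_le_exp _)
  refine (Finset.prod_le_prod (fun j _ => Finset.sum_nonneg fun τ _ => mul_nonneg ?_
    (by positivity)) fun j _ => h1 j).trans ?_
  · split_ifs
    · exact zero_le_one
    · exact hg j
  rw [← Real.exp_sum, ← Finset.mul_sum]
  refine Real.exp_le_exp.2 (mul_le_mul_of_nonneg_left ?_ (by positivity))
  rw [Fin.sum_univ_eq_sum_range]
  exact hsum.sum_le_tsum _ fun j _ => hg j

/-- The leading digits of a digit set. -/
def leading (α : ℕ) (κ : Finset ℕ) : Finset ℕ := (exists_leading α κ).choose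

lemma leading_spec (α : ℕ) (κ : Finset ℕ) : leading α κ ⊆ κ ∧ (leading α κ).card ≤ α + 1 ∧
    (leading α κ = ∅ ↔ κ = ∅) ∧ ∃ R ∈ lowerDigits α (leading α κ), κ = R ∪ leading α κ :=
  (exists_leading α κ).choose_spec

lemma digitSupp_leading (α : ℕ) (κ : Fin s → Finset ℕ) :
    digitSupp (fun j => leading α (κ j)) = digitSupp κ := by
  ext j
  rw [mem_digitSupp, mem_digitSupp]
  exact not_congr (leading_spec α (κ j)).2.2.1

lemma compVar_le_varNorm (α : ℕ) (lam : ℝ) (f : (Fin s → ℝ) → ℝ) (u : Finset (Fin s)) :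
    compVar α lam f u ≤ varNorm α lam f := le_iSup (compVar α lam f) u

/-- The tail of the truncated deviation, uniformly in the dimension. -/
lemma exists_truncDev_tail {α : ℕ} {lam : ℝ} (hlam1 : lam ≤ 1) {d : ℕ} (hd : 1 ≤ d)
    (hdα : (d : ℝ) < α + lam) {γ t : ℕ → ℝ} (hγ : ∀ j, 0 ≤ γ j)
    (hsum : Summable fun j : ℕ =>
      (γ j ^ (1 / (α + lam + 1 / 2)) * (2 : ℝ) ^ t j) ^
        ((α + lam + 1 / 2) / (α + lam - d + 1 / 2)))
    {η : ℝ} (hη : 0 < η) (hηd : η ≤ d) :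
    ∃ C : ℝ, 0 < C ∧
      ∀ (s m : ℕ) (P : Measure (GenMatrices s m)) (_ : IsProbabilityMeasure P)
        (tu : Finset (Fin s) → ℕ) (_ : SchemeBound P d tu)
        (f : (Fin s → ℝ) → ℝ) (_ : IsMixedSmooth α f) (_ : varNorm α lam f ≠ ∞)
        (_ : varNorm α lam f ≠ 0)
        (_ : ∀ u : Finset (Fin s), u.Nonempty → relVar α lam f u ≤ ∏ j ∈ u, γ j)
        (_ : ∀ u : Finset (Fin s), u.Nonempty → (tu u : ℝ) ≤ ∑ j ∈ u, t j)
        [DecidableEq (Fin s → Finset ℕ)] (L : ℕ),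
        (P.prod (shiftLaw s)).real
            {ω | C * (varNorm α lam f).toReal ^ 2 *
                  (2 : ℝ) ^ (-((2 * α + 2 * lam + 1 - 2 * η) * m)) ≤
                truncDev f ((digitSets s L).erase fun _ => ∅) ω.1 ω.2 ^ 2} ≤ 1 / 8 := by
  have h2 : (0 : ℝ) < 2 := two_pos
  have hd0 : (0 : ℝ) < d := by exact_mod_cast hd
  have hdα' : d ≤ α := by
    have : (d : ℝ) < α + 1 := by linarith
    exact Nat.lt_succ_iff.1 (by exact_mod_cast this)
  have hp : 0 < 2 * (α + lam) + 1 - 2 * d := by linarith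
  -- With this `e`, cancellation of `2^m` forces `θ = 2 * e * (1 - η / d)`, so `2 * e - θ` is
  -- exactly `δ`. Moreover `2 * e = 1/(α + lam - d + 1/2)`, which makes `g` below the sequence
  -- assumed summable.
  set e : ℝ := (2 * (α + lam) + 1 - 2 * d)⁻¹ with he
  have he0 : 0 < e := by positivity
  have he1 : e ≤ 1 := inv_le_one_of_one_le₀ (by linarith)
  have hep : e * (2 * (α + lam) + 1 - 2 * d) = 1 := inv_mul_cancel₀ hp.ne'
  set θ : ℝ := (e * (2 * (α + lam) + 1 - 2 * η) - 1) / d with hθ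
  have hθd : θ * d = e * (2 * (α + lam) + 1 - 2 * η) - 1 := div_mul_cancel₀ _ hd0.ne'
  have hθ0 : 0 ≤ θ := by
    refine div_nonneg ?_ hd0.le
    have : e * (d - η) ≥ 0 := mul_nonneg he0.le (by linarith)
    linarith
  set δ : ℝ := 2 * η * e / d with hδ
  have hδ0 : 0 < δ := by positivity
  have hδ1 : δ ≤ 2 * e - θ := by
    rw [hδ, hθ, le_sub_iff_add_le, ← add_div, div_le_iff₀ hd0]
    linarith
  have hδ2 : δ ≤ 2 * η * e := div_le_self (by positivity) (by exact_mod_cast hd)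
  set x : ℝ := (2 : ℝ) ^ (-(δ / (α + 1))) with hx
  have hx0 : 0 ≤ x := by positivity
  have hx1 : x < 1 := Real.rpow_lt_one_of_one_lt_of_neg one_lt_two (by
    have : 0 < δ / (α + 1) := by positivity
    linarith)
  set g : ℕ → ℝ := fun j => γ j ^ (2 * e) * (2 : ℝ) ^ (e * (2 * (α + lam) + 1) * t j) with hg
  have hg0 : ∀ j, 0 ≤ g j := fun j => mul_nonneg (Real.rpow_nonneg (hγ j) _) (by positivity)
  have hq0 : 0 < α + lam + 1 / 2 := by linarith
  have hq1 : α + lam - d + 1 / 2 ≠ 0 := by linarith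
  have hgsum : Summable g := by
    refine hsum.congr fun j => ?_
    rw [Real.mul_rpow (Real.rpow_nonneg (hγ j) _) (by positivity), ← Real.rpow_mul (hγ j),
      ← Real.rpow_mul h2.le, hg]
    have e1 : e = (α + lam - d + 1 / 2)⁻¹ / 2 := by
      rw [he, div_eq_mul_inv, ← mul_inv]; congr 1; ring
    have e2 : 2 * (α + lam) + 1 = 2 * (α + lam + 1 / 2) := by ring
    simp only
    rw [e1, e2]
    generalize (α : ℝ) + lam + 1 / 2 = p at hq0 ⊢
    congr 2 <;> field_simp
  set E : ℝ := Real.exp (Real.exp (1 - x)⁻¹ * ∑' j, g j) with hE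
  have hE0 : 0 < E := Real.exp_pos _
  -- Chosen so that `C^(-e) * E = 1/8`.
  refine ⟨(8 * E) ^ e⁻¹, by positivity, ?_⟩
  set C : ℝ := (8 * E) ^ e⁻¹ with hC
  have hC0 : 0 < C := by positivity
  have hCe : C ^ (-e) * E = 1 / 8 := by
    rw [Real.rpow_neg hC0.le, hC, ← Real.rpow_mul (by positivity), inv_mul_cancel₀ he0.ne',
      Real.rpow_one]
    field_simp
  intro s m P hPp tu hP f hf hfin hne hrel htu _ L
  classical
  set F : ℝ := (varNorm α lam f).toReal with hF
  have hF0 : 0 < F := ENNReal.toReal_pos hne hfin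
  set B : ℝ := C * F ^ 2 * (2 : ℝ) ^ (-((2 * α + 2 * lam + 1 - 2 * η) * m)) with hB
  have hB0 : 0 < B := by positivity
  set key : (Fin s → Finset ℕ) → Fin s → Finset ℕ := fun κ j => leading α (κ j) with hkey
  set n : (Fin s → Finset ℕ) → ℝ := fun S => ∏ j, ((lowerDigits α (S j)).card : ℝ) with hn
  set X : (Fin s → Finset ℕ) → ℝ := fun S =>
    (∏ j, decay α lam (S j)) ^ 2 * (compVar α lam f (digitSupp S)).toReal ^ 2 / B with hX
  set T := (digitSets s L).erase fun _ => ∅ with hT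
  -- The choice between union bound and variance is made once per group of common leading digits.
  refine (measureReal_truncDev_le f T (fun κ => n (key κ) ≤ X (key κ)) P hB0).trans ?_
  have hmaps : ∀ κ ∈ T, key κ ∈ digitSets s L := fun κ hκ => by
    refine Fintype.mem_piFinset.2 fun j => Finset.mem_powerset.2 ?_
    exact (leading_spec α (κ j)).1.trans
      (Finset.mem_powerset.1 (Fintype.mem_piFinset.1 (Finset.mem_of_mem_erase hκ) j))
  rw [← Finset.sum_fiberwise_of_maps_to hmaps]
  calc _ ≤ ∑ S ∈ digitSets s L, C ^ (-e) * ∏ j, ((if S j = ∅ then 1 else g j) *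
        ∏ a ∈ S j, x ^ (a + 1)) := by
        refine Finset.sum_le_sum fun S _ => ?_
        rcases (T.filter fun κ => key κ = S).eq_empty_or_nonempty with h0 | ⟨κ₀, hκ₀⟩
        · rw [h0, Finset.sum_empty]
          refine mul_nonneg (by positivity) (Finset.prod_nonneg fun j _ => mul_nonneg ?_
            (by positivity))
          split_ifs
          · exact zero_le_one
          · exact hg0 j
        obtain ⟨hκT, hκS⟩ := Finset.mem_filter.1 hκ₀
        have hS : (digitSupp S).Nonempty := by
          rw [← hκS, hkey, digitSupp_leading, Finset.nonempty_iff_ne_empty]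
          intro h0
          refine (Finset.mem_erase.1 hκT).1 (funext fun j => ?_)
          by_contra hj
          have := mem_digitSupp.2 hj
          rw [h0] at this
          simp at this
        have hcv := compVar_le_varNorm α lam f (digitSupp S)
        have hcfin : compVar α lam f (digitSupp S) ≠ ∞ := ne_top_of_le_ne_top hfin hcv
        have hcard : ∀ j, (S j).card ≤ α + 1 := fun j => by
          rw [← hκS]; exact (leading_spec α _).2.1
        have hV : (compVar α lam f (digitSupp S)).toReal ≤ F * ∏ j ∈ digitSupp S, γ j := by
          have := hrel _ hS
          rw [relVar, ENNReal.toReal_div, div_le_iff₀ hF0] at this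
          rwa [mul_comm]
        have hsame : ∀ κ ∈ T.filter fun κ => key κ = S,
            P.real (dualEvent m κ) * (if n (key κ) ≤ X (key κ) then 1 else walCoef f κ ^ 2 / B) =
            P.real (dualEvent m κ) * (if n S ≤ X S then 1 else walCoef f κ ^ 2 / B) :=
          fun κ hκ => by rw [(Finset.mem_filter.1 hκ).2]
        rw [Finset.sum_congr rfl hsame]
        refine (sum_fiber_le hdα' hf hS hcfin hcard hP hθ0 he0 he1 hB0 ?_ rfl rfl Iff.rfl).trans
          (fiber_cost_le hdα' he0 he1 (by linarith) hθ0 hδ0 hδ1 hδ2 hη.le hθd hγ (htu _ hS) hC0 hF0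
            ENNReal.toReal_nonneg hV rfl rfl)
        intro κ hκ
        have hk := (Finset.mem_filter.1 hκ).2
        choose R hR using fun j => (leading_spec α (κ j)).2.2.2
        refine ⟨R, fun j => ?_, funext fun j => ?_⟩
        · rw [← hk]; exact (hR j).1
        · rw [← hk]; exact (hR j).2
    _ = C ^ (-e) * ∑ S ∈ digitSets s L, ∏ j, ((if S j = ∅ then 1 else g j) *
        ∏ a ∈ S j, x ^ (a + 1)) := by rw [Finset.mul_sum]
    _ ≤ C ^ (-e) * E := mul_le_mul_of_nonneg_left (sum_digitSets_le hx0 hx1 hg0 hgsum L)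
        (by positivity)
    _ = 1 / 8 := hCe

end Summation

section Tail

/-! ### The median -/

/-- The median together with all order statistics on its far side from `a` makes `r` values, each at
least as far from `a`. -/
lemma exists_card_of_sampleMedian {r : ℕ} (hr : 1 ≤ r) {y : Fin (2 * r - 1) → ℝ} {a c : ℝ}
    (h : c < |sampleMedian hr y - a| ^ 2) :
    ∃ J : Finset (Fin (2 * r - 1)), J.card = r ∧ ∀ i ∈ J, c < |y i - a| ^ 2 := by
  set i₀ : Fin (2 * r - 1) := ⟨r - 1, by omega⟩ with hi₀
  have hmono := Tuple.monotone_sort y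
  have hmed : sampleMedian hr y = y (Tuple.sort y i₀) := rfl
  rw [hmed] at h
  rcases le_total a (y (Tuple.sort y i₀)) with ha | ha
  · refine ⟨(Finset.Ici i₀).map (Tuple.sort y).toEmbedding, ?_, ?_⟩
    · rw [Finset.card_map, Fin.card_Ici, hi₀]; simp only; omega
    · intro i hi
      obtain ⟨k, hk, rfl⟩ := Finset.mem_map.1 hi
      have h1 : y (Tuple.sort y i₀) ≤ y (Tuple.sort y k) := hmono (Finset.mem_Ici.1 hk)
      refine h.trans_le (pow_le_pow_left₀ (abs_nonneg _) ?_ 2)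
      rw [Equiv.coe_toEmbedding, abs_of_nonneg (by linarith), abs_of_nonneg (by linarith)]
      linarith
  · refine ⟨(Finset.Iic i₀).map (Tuple.sort y).toEmbedding, ?_, ?_⟩
    · rw [Finset.card_map, Fin.card_Iic, hi₀]; simp only; omega
    · intro i hi
      obtain ⟨k, hk, rfl⟩ := Finset.mem_map.1 hi
      have h1 : y (Tuple.sort y k) ≤ y (Tuple.sort y i₀) := hmono (Finset.mem_Iic.1 hk)
      refine h.trans_le (pow_le_pow_left₀ (abs_nonneg _) ?_ 2)
      rw [Equiv.coe_toEmbedding, abs_of_nonpos (by linarith), abs_of_nonpos (by linarith)]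
      linarith

/-- If an event has probability at most `1/8`, it is unlikely to occur in the majority of
independent replicates. -/
lemma measureReal_pi_majority_le {Ω : Type*} [MeasurableSpace Ω] (μ : Measure Ω)
    [IsProbabilityMeasure μ] {E : Set Ω} (hE : μ.real E ≤ 1 / 8) {r : ℕ} (hr : 1 ≤ r) :
    (Measure.pi fun _ : Fin (2 * r - 1) => μ).real
      {ω | ∃ J : Finset (Fin (2 * r - 1)), J.card = r ∧ ∀ i ∈ J, ω i ∈ E} ≤
      (2 : ℝ) ^ (-(r : ℤ)) := by
  classical
  set N := 2 * r - 1 with hN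
  have hsub : {ω : Fin N → Ω | ∃ J : Finset (Fin N), J.card = r ∧ ∀ i ∈ J, ω i ∈ E} ⊆
      ⋃ J ∈ Finset.powersetCard r (Finset.univ : Finset (Fin N)),
        Set.univ.pi fun i => if i ∈ J then E else Set.univ := by
    rintro ω ⟨J, hJ, h⟩
    refine Set.mem_iUnion₂.2 ⟨J, Finset.mem_powersetCard.2 ⟨Finset.subset_univ _, hJ⟩, fun i _ => ?_⟩
    beta_reduce
    split_ifs with hi
    · exact h i hi
    · trivial
  have hone : ∀ J ∈ Finset.powersetCard r (Finset.univ : Finset (Fin N)),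
      (Measure.pi fun _ : Fin N => μ).real (Set.univ.pi fun i => if i ∈ J then E else Set.univ) ≤
        (1 / 8) ^ r := fun J hJ => by
    -- The product formula holds for arbitrary sets, so `E` need not be measurable.
    rw [measureReal_def, Measure.pi_pi, ENNReal.toReal_prod]
    have e : ∀ i, (μ (if i ∈ J then E else Set.univ)).toReal = if i ∈ J then μ.real E else 1 :=
      fun i => by split_ifs <;> simp [measureReal_def]
    simp only [e]
    rw [Finset.prod_ite_mem, Finset.univ_inter, Finset.prod_const, (Finset.mem_powersetCard.1 hJ).2]
    exact pow_le_pow_left₀ measureReal_nonneg hE r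
  refine (measureReal_mono hsub (measure_ne_top _ _)).trans ((measureReal_biUnion_finset_le _ _).trans
    ((Finset.sum_le_sum hone).trans ?_))
  rw [Finset.sum_const, nsmul_eq_mul, Finset.card_powersetCard, Finset.card_univ, Fintype.card_fin]
  -- At most `4^r` index sets, each of probability at most `8^(-r)`; this is why 1/8 is the target
  -- for one replicate.
  calc ((N.choose r : ℕ) : ℝ) * (1 / 8) ^ r ≤ (2 ^ (2 * r) : ℕ) * (1 / 8) ^ r := by
        refine mul_le_mul_of_nonneg_right (Nat.cast_le.2 ?_) (by positivity)
        exact (Nat.choose_le_two_pow N r).trans (Nat.pow_le_pow_right two_pos (by omega))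
    _ = (2 : ℝ) ^ (-(r : ℤ)) := by
        push_cast
        rw [pow_mul, ← mul_pow, zpow_neg, zpow_natCast, ← inv_pow]
        norm_num

/-! ### From the truncated deviation to one replicate of the estimator -/

variable {s m : ℕ}

/-- The group containing `κ` has total squared coefficient bounded by a multiple of its component
norm, which is zero. -/
lemma walCoef_eq_zero_of_varNorm_eq_zero {α : ℕ} {lam : ℝ} {f : (Fin s → ℝ) → ℝ} (hf : IsMixedSmooth α f)
    (h0 : varNorm α lam f = 0) {κ : Fin s → Finset ℕ} (hκ : κ ≠ fun _ => ∅) : walCoef f κ = 0 := by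
  classical
  set S : Fin s → Finset ℕ := fun j => leading α (κ j) with hS
  choose R hR using fun j => (leading_spec α (κ j)).2.2.2
  have hu : digitSupp S ≠ ∅ := by
    rw [hS, digitSupp_leading]
    intro h
    refine hκ (funext fun j => ?_)
    by_contra hj
    have := mem_digitSupp.2 hj
    rw [h] at this
    simp at this
  have hc : compVar α lam f (digitSupp S) = 0 :=
    le_antisymm (h0 ▸ compVar_le_varNorm α lam f _) bot_le
  have hle := sum_walCoef_sq_le hf hu (by rw [hc]; exact ENNReal.zero_ne_top)
    (fun j => mem_digitSupp.symm) fun j => (leading_spec α (κ j)).2.1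
  rw [hc, ENNReal.toReal_zero, zero_pow two_ne_zero, mul_zero] at hle
  have h1 := Finset.single_le_sum (f := fun R : Fin s → Finset ℕ => walCoef f (fun j => R j ∪ S j) ^ 2)
    (fun _ _ => sq_nonneg _)
    (Fintype.mem_piFinset.2 fun j => (hR j).1 : R ∈ Fintype.piFinset fun j => lowerDigits α (S j))
  have h2 : (fun j => R j ∪ S j) = κ := funext fun j => (hR j).2.symm
  rw [h2] at h1
  exact pow_eq_zero_iff two_ne_zero |>.1 (le_antisymm (h1.trans hle) (sq_nonneg _))

/-- All nonconstant coefficients vanish, so only the truncation error remains, and it is arbitrarily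
small. This settles the case where the threshold `B` is zero and Markov's inequality is unavailable.
-/
lemma netMean_eq_of_varNorm_eq_zero {α : ℕ} {lam : ℝ} {f : (Fin s → ℝ) → ℝ}
    (hf : IsMixedSmooth α f) (h0 : varNorm α lam f = 0) (A : GenMatrices s m) (D : Shifts s) :
    netMean f A D = cubeIntegral f := by
  classical
  have hc : ContinuousOn f (cube (Fin s)) := by
    have := hf.continuousOn 0 fun _ => Nat.zero_le _
    rwa [mixedDeriv_zero] at this
  refine eq_of_forall_dist_le fun ε hε => ?_
  obtain ⟨L, hL⟩ := abs_walTrunc_sub_le hc hε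
  have h1 := abs_netMean_sub_le hL A D
  have h2 : truncDev f ((digitSets s L).erase fun _ => ∅) A D = 0 := by
    unfold truncDev
    refine Finset.sum_eq_zero fun κ hκ => ?_
    rw [walCoef_eq_zero_of_varNorm_eq_zero hf h0 (Finset.mem_erase.1 hκ).1, zero_mul, zero_mul]
  rwa [h2, sub_zero] at h1

/-- The tail of the estimator in a single replicate, uniformly in the dimension. -/
lemma exists_netMean_tail {α : ℕ} {lam : ℝ} (hlam1 : lam ≤ 1) {d : ℕ} (hd : 1 ≤ d)
    (hdα : (d : ℝ) < α + lam) {γ t : ℕ → ℝ} (hγ : ∀ j, 0 ≤ γ j)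
    (hsum : Summable fun j : ℕ =>
      (γ j ^ (1 / (α + lam + 1 / 2)) * (2 : ℝ) ^ t j) ^
        ((α + lam + 1 / 2) / (α + lam - d + 1 / 2)))
    {η : ℝ} (hη : 0 < η) (hηd : η ≤ d) :
    ∃ C : ℝ, 0 < C ∧
      ∀ (s m : ℕ) (P : Measure (GenMatrices s m)) (_ : IsProbabilityMeasure P)
        (tu : Finset (Fin s) → ℕ) (_ : SchemeBound P d tu)
        (f : (Fin s → ℝ) → ℝ) (_ : IsMixedSmooth α f) (_ : varNorm α lam f ≠ ∞)
        (_ : ∀ u : Finset (Fin s), u.Nonempty → relVar α lam f u ≤ ∏ j ∈ u, γ j)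
        (_ : ∀ u : Finset (Fin s), u.Nonempty → (tu u : ℝ) ≤ ∑ j ∈ u, t j),
        (P.prod (shiftLaw s)).real
            {ω | C * (varNorm α lam f).toReal ^ 2 *
                  (2 : ℝ) ^ (-((2 * α + 2 * lam + 1 - 2 * η) * m)) <
                |netMean f ω.1 ω.2 - cubeIntegral f| ^ 2} ≤ 1 / 8 := by
  classical
  obtain ⟨C, hC, h⟩ := exists_truncDev_tail hlam1 hd hdα hγ hsum hη hηd
  -- The truncation error is made at most `√B`. An error above `2 * √B` then leaves a truncated
  -- deviation of at least `√B`, and squaring turns 2 into 4.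
  refine ⟨4 * C, by positivity, ?_⟩
  intro s m P hPp tu hP f hf hfin hrel htu
  by_cases h0 : varNorm α lam f = 0
  · simp only [netMean_eq_of_varNorm_eq_zero hf h0, h0]
    simp
  have hF : 0 < (varNorm α lam f).toReal := ENNReal.toReal_pos h0 hfin
  set B : ℝ := C * (varNorm α lam f).toReal ^ 2 *
    (2 : ℝ) ^ (-((2 * α + 2 * lam + 1 - 2 * η) * m)) with hB
  have hB0 : 0 < B := by positivity
  have hc : ContinuousOn f (cube (Fin s)) := by
    have := hf.continuousOn 0 fun _ => Nat.zero_le _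
    rwa [mixedDeriv_zero] at this
  obtain ⟨L, hL⟩ := abs_walTrunc_sub_le hc (Real.sqrt_pos.2 hB0)
  refine (measureReal_mono ?_).trans (h s m P hPp tu hP f hf hfin h0 hrel htu L)
  intro ω hω
  have h4 : 4 * B < |netMean f ω.1 ω.2 - cubeIntegral f| ^ 2 := by
    refine lt_of_eq_of_lt ?_ hω
    rw [hB]; ring
  have h1 := abs_netMean_sub_le hL ω.1 ω.2
  rw [Set.mem_ofPred_eq, ← hB]
  set x := netMean f ω.1 ω.2 - cubeIntegral f
  set y := truncDev f ((digitSets s L).erase fun _ => ∅) ω.1 ω.2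
  have h2 : 2 * √B < |x| := by
    refine lt_of_pow_lt_pow_left₀ 2 (abs_nonneg _) ?_
    rw [mul_pow, Real.sq_sqrt hB0.le]; linarith
  have h3 : √B ≤ |y| := by
    have := abs_sub_abs_le_abs_sub x y
    linarith
  rw [← Real.sq_sqrt hB0.le, ← sq_abs y]
  exact pow_le_pow_left₀ (Real.sqrt_nonneg _) h3 2

end Tail

end MedianNet

end

theorem theorem5p3 (α : ℕ) (lam : ℝ) (hlam0 : 0 < lam) (hlam1 : lam ≤ 1)
    (d : ℕ) (hd : 1 ≤ d) (hdα : (d : ℝ) < α + lam)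
    (γ t : ℕ → ℝ) (hγ : ∀ j, 0 ≤ γ j)
    (hsum : Summable fun j : ℕ =>
      (γ j ^ (1 / (α + lam + 1 / 2)) * (2 : ℝ) ^ t j) ^
        ((α + lam + 1 / 2) / (α + lam - d + 1 / 2)))
    (η : ℝ) (hη : 0 < η) :
    ∃ C : ℝ, 0 < C ∧
      ∀ (s m r : ℕ) (_ : 1 ≤ m) (hr : 1 ≤ r)
        (P : Measure (GenMatrices s m)) (_ : IsProbabilityMeasure P)
        (tu : Finset (Fin s) → ℕ) (_ : SchemeBound P d tu)
        (f : (Fin s → ℝ) → ℝ) (_ : IsMixedSmooth α f) (_ : varNorm α lam f ≠ ∞)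
        (_ : ∀ u : Finset (Fin s), u.Nonempty → relVar α lam f u ≤ ∏ j ∈ u, γ j)
        (_ : ∀ u : Finset (Fin s), u.Nonempty → (tu u : ℝ) ≤ ∑ j ∈ u, t j),
        (replicateLaw P r).real
            {ω | C * (varNorm α lam f).toReal ^ 2 *
                  (2 : ℝ) ^ (-((2 * α + 2 * lam + 1 - 2 * η) * m)) <
                |medianEstimator hr f ω - cubeIntegral f| ^ 2} ≤
          (2 : ℝ) ^ (-(r : ℤ)) := by
  have hd1 : (1 : ℝ) ≤ d := by exact_mod_cast hd
  -- Replacing `η` by `min η 1` secures `η ≤ d`, needed for `θ ≥ 0`. A smaller `η` gives a smaller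
  -- threshold, hence a stronger bound.
  obtain ⟨C, hC, h⟩ := exists_netMean_tail hlam1 hd hdα hγ hsum (lt_min hη one_pos)
    ((min_le_right η 1).trans hd1)
  refine ⟨C, hC, ?_⟩
  intro s m r _ hr P hPp tu hP f hf hfin hrel htu
  have : IsProbabilityMeasure (replicateLaw P r) := by unfold replicateLaw; infer_instance
  refine (measureReal_mono ?_).trans
    (measureReal_pi_majority_le (P.prod (shiftLaw s)) (h s m P hPp tu hP f hf hfin hrel htu) hr)
  intro ω hω
  refine exists_card_of_sampleMedian hr (lt_of_le_of_lt ?_ hω)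
  refine mul_le_mul_of_nonneg_left ?_ (by positivity)
  refine Real.rpow_le_rpow_of_exponent_le one_le_two (neg_le_neg ?_)
  refine mul_le_mul_of_nonneg_right ?_ (Nat.cast_nonneg m)
  linarith [min_le_left η 1]
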